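/- Let $Q$ be a finite quiver with vertex set $I$ and edge set $E$ (loops and multiple edges allowed), and let ${}_\rho T$ be a subtorus of $T=\mathbb C^*\times\prod_{e\in E}\mathbb C^*$. Let $q$ and $t_e$ ($e\in E$) denote the restrictions to ${}_\rho T$ of the coordinate characters of $T$, and let ${}_\rho\mathbb F$ be the fraction field of the representation ring $\mathrm{Rep}_{{}_\rho T}$. Assume that $q$ is generic, i.e. a nontrivial character of ${}_\rho T$, and that the characters of ${}_\rho T$ can be specialized to complex numbers (by evaluation at a point of ${}_\rho T$) so that $|q|<|t_e|<1$ for all $e\in E$. Let ${}_\rho\mathcal V=\bigoplus_{\boldsymbol n\in\mathbb N^I}{}_\rho\mathbb F[z_{ia}^{\pm1}]^{\mathrm{sym}}_{i\in I,\,1\le a\le n_i}$, where "sym" means symmetric in $z_{i1},\dots,z_{in_i}$ for each $i$ separately, with the shuffle product of $R$ of degree $\boldsymbol n$ and $R'$ of degree $\boldsymbol n'$ $$R*R'=\mathrm{Sym}\left[\frac{R(\dots,z_{i1},\dots,z_{in_i},\dots)\,R'(\dots,z_{i,n_i+1},\dots,z_{i,n_i+n_i'},\dots)}{\prod_{i}n_i!\,\prod_i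 n'_i!}\prod_{i,j\in I}\ \prod_{1\le a\le n_i}\ \prod_{n_j<b\le n_j+n'_j}\zeta_{ij}\!\left(\frac{z_{ia}}{z_{jb}}\right)\right],$$ where $\mathrm{Sym}$ is the sum over all permutations of $z_{i1},\dots,z_{i,n_i+n'_i}$ for each $i$ separately, and $$\zeta_{ij}(x)=\left(\frac{1-xq^{-1}}{1-x}\right)^{\delta^i_j}\prod_{e=\overrightarrow{ij}\in E}(1-t_ex)\prod_{e=\overrightarrow{ji}\in E}\left(1-\frac{qx}{t_e}\right).$$ Let ${}_\rho\mathcal S\subset{}_\rho\mathcal V$ be the direct sum, over $\boldsymbol n\in\mathbb N^I$, of the spaces of those $R$ of degree $\boldsymbol n$ such that for all $j\in I$ and $1\le k\le n_j$, the specialization $R|_{z_{j1}=x,\,z_{j2}=xq,\,\dots,\,z_{jk}=xq^{k-1}}$ is divisible (as a Laurent polynomial in $x$ and the remaining variables), for every variable $z_{ia}$ with $(i,a)\notin\{(j,1),\dots,(j,k)\}$, by $$\prod_{s=1}^{k-1}\left[\prod_{e=\overrightarrow{ij}\in E}\left(z_{ia}-q^st_e^{-1}x\right)\prod_{e=\overrightarrow{ji}\in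 E}\left(z_{ia}-q^{s-1}t_ex\right)\right].$$ For $i\in I$ let $\boldsymbol\varsigma_i\in\mathbb N^I$ be the vector with $1$ at $i$ and $0$ elsewhere. Then ${}_\rho\mathcal S$ is generated, as a unital algebra under $*$, by its graded pieces of degree $\boldsymbol\varsigma_i$, $i\in I$ (each of which is ${}_\rho\mathbb F[z_{i1}^{\pm1}]$, spanned by the $z_{i1}^d$, $d\in\mathbb Z$): the subalgebra ${}_\rho\mathring{\mathcal S}$ generated by these pieces equals ${}_\rho\mathcal S$. -/

import Mathlib

open scoped DirectSum

noncomputable section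

namespace QuiverShuffle

/-! ### Laurent polynomials and rational functions -/

/-- The ring `k[z_v, z_v⁻¹ : v ∈ σ]` of Laurent polynomials, as the group ring of `ℤ^σ`. -/
abbrev Laurent (k σ : Type*) [CommRing k] : Type _ := AddMonoidAlgebra k (σ →₀ ℤ)

/-- The field `k(z_v : v ∈ σ)` of rational functions. -/
abbrev RatFun (k σ : Type*) [CommRing k] : Type _ := FractionRing (Laurent k σ)

section Laurent

variable {k : Type*} [Field k] {σ τ υ : Type*}

/-- The variable `z_v`, as an invertible Laurent polynomial. -/
def Laurent.X (k : Type*) [Field k] {σ : Type*} (v : σ) : (Laurent k σ)ˣ where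
  val := AddMonoidAlgebra.single (Finsupp.single v 1) 1
  inv := AddMonoidAlgebra.single (Finsupp.single v (-1)) 1
  val_inv := by
    rw [AddMonoidAlgebra.single_mul_single, ← Finsupp.single_add]
    simp [AddMonoidAlgebra.one_def]
  inv_val := by
    rw [AddMonoidAlgebra.single_mul_single, ← Finsupp.single_add]
    simp [AddMonoidAlgebra.one_def]

/-- The variable `z_v` as a Laurent polynomial. -/
def Laurent.var (k : Type*) [Field k] {σ : Type*} (v : σ) : Laurent k σ :=
  (Laurent.X k v : (Laurent k σ)ˣ)

/-- The substitution `z_v ↦ u v` of invertible elements for the variables. -/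
def Laurent.subst {A : Type*} [CommRing A] [Algebra k A] (u : σ → Aˣ) : Laurent k σ →ₐ[k] A :=
  AddMonoidAlgebra.lift k A (σ →₀ ℤ)
    ((Units.coeHom A).comp
      { toFun := fun m => (Multiplicative.toAdd m).prod fun v d => u v ^ d
        map_one' := by simp
        map_mul' := fun a b => by
          rw [toAdd_mul]
          exact Finsupp.prod_add_index' (fun _ => zpow_zero _) (fun v d e => zpow_add _ d e) })

/-- Renaming the variables, `z_v ↦ z_{f v}`. -/
def Laurent.rename (k : Type*) [Field k] (f : σ ↪ τ) : Laurent k σ →ₐ[k] Laurent k τ :=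
  AddMonoidAlgebra.mapDomainAlgHom k k (Finsupp.mapDomain.addMonoidHom (M := ℤ) f)

theorem Laurent.rename_injective (f : σ ↪ τ) :
    Function.Injective (Laurent.rename k f) :=
  AddMonoidAlgebra.mapDomain_injective (Finsupp.mapDomain_injective f.injective)

theorem Laurent.rename_rename (f : σ ↪ τ) (g : τ ↪ υ) (p : Laurent k σ) :
    Laurent.rename k g (Laurent.rename k f p) = Laurent.rename k (f.trans g) p := by
  have : (Laurent.rename k g).comp (Laurent.rename k f) = Laurent.rename k (f.trans g) := by
    unfold Laurent.rename
    rw [← AddMonoidAlgebra.mapDomainAlgHom_comp]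
    congr 1
    ext x : 2
    simp [Finsupp.mapDomain_single]
  exact DFunLike.congr_fun this p

/-- Renaming the variables of a rational function, `z_v ↦ z_{f v}`. -/
def RatFun.rename (k : Type*) [Field k] (f : σ ↪ τ) : RatFun k σ →ₐ[k] RatFun k τ :=
  IsFractionRing.liftAlgHom (A := Laurent k σ)
    (g := (IsScalarTower.toAlgHom k (Laurent k τ) (RatFun k τ)).comp (Laurent.rename k f))
    (by
      rw [AlgHom.coe_comp]
      exact (IsFractionRing.injective (Laurent k τ) (RatFun k τ)).comp
        (Laurent.rename_injective f))

theorem RatFun.rename_algebraMap (f : σ ↪ τ) (p : Laurent k σ) :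
    RatFun.rename k f (algebraMap _ _ p) = algebraMap _ _ (Laurent.rename k f p) := by
  unfold RatFun.rename
  rw [IsFractionRing.liftAlgHom_apply, IsFractionRing.lift_algebraMap]
  rfl

theorem RatFun.rename_rename (f : σ ↪ τ) (g : τ ↪ υ) (r : RatFun k σ) :
    RatFun.rename k g (RatFun.rename k f r) = RatFun.rename k (f.trans g) r := by
  obtain ⟨a, b, -, rfl⟩ := IsFractionRing.div_surjective (A := Laurent k σ) r
  simp only [map_div₀, RatFun.rename_algebraMap, Laurent.rename_rename]

/-- The variable `z_v` as a rational function. -/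
def RatFun.X (k : Type*) [Field k] {σ : Type*} (v : σ) : RatFun k σ :=
  algebraMap (Laurent k σ) (RatFun k σ) (Laurent.var k v)

end Laurent

/-! ### The variables `z_{ia}` and their symmetries -/

section Variables

variable {I : Type*}

/-- The set of indices `(i, a)` of the variables `z_{ia}`, `i ∈ I`, `1 ≤ a ≤ n_i`
(the second index is counted from `0` here). -/
abbrev Var (n : I → ℕ) : Type _ := Σ i, Fin (n i)

/-- The group `∏ i, S(n_i)`. -/
abbrev VarPerm (n : I → ℕ) : Type _ := ∀ i, Equiv.Perm (Fin (n i))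

/-- `σ` acts on the variables by `z_{ia} ↦ z_{i,σ_i(a)}`. -/
def VarPerm.emb {n : I → ℕ} (σ : VarPerm n) : Var n ↪ Var n :=
  (Equiv.sigmaCongrRight σ).toEmbedding

/-- The variables `z_{ia}` with `a ≤ n_i`, among those of degree `n + m`. -/
def leftVar (n m : I → ℕ) : Var n ↪ Var (n + m) where
  toFun v := ⟨v.1, Fin.castAdd (m v.1) v.2⟩
  inj' := by
    rintro ⟨i, a⟩ ⟨j, b⟩ h
    obtain ⟨h₁, h₂⟩ := Sigma.mk.inj_iff.1 h
    dsimp only at h₁ h₂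
    subst h₁
    exact congrArg _ (Fin.castAdd_injective _ _ (eq_of_heq h₂))

/-- The variables `z_{i,n_i+a}` with `a ≤ m_i`, among those of degree `n + m`. -/
def rightVar (n m : I → ℕ) : Var m ↪ Var (n + m) where
  toFun v := ⟨v.1, Fin.natAdd (n v.1) v.2⟩
  inj' := by
    rintro ⟨i, a⟩ ⟨j, b⟩ h
    obtain ⟨h₁, h₂⟩ := Sigma.mk.inj_iff.1 h
    dsimp only at h₁ h₂
    subst h₁
    exact congrArg _ (Fin.natAdd_injective _ _ (eq_of_heq h₂))

variable (k : Type*) [Field k]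

/-- Rational functions in the `z_{ia}` that are symmetric in `z_{i1}, …, z_{in_i}` for each `i`
separately. -/
def SymRat (n : I → ℕ) : Submodule k (RatFun k (Var n)) where
  carrier := {r | ∀ σ : VarPerm n, RatFun.rename k σ.emb r = r}
  add_mem' := fun ha hb σ => by rw [map_add, ha σ, hb σ]
  zero_mem' := fun σ => map_zero _
  smul_mem' := fun c r hr σ => by rw [map_smul, hr σ]

variable {k}

/-- Symmetrization: the sum over all of `∏ i, S(n_i)`. -/
def symmetrize [Fintype I] [DecidableEq I] (n : I → ℕ) (r : RatFun k (Var n)) : RatFun k (Var n) :=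
  ∑ σ : VarPerm n, RatFun.rename k σ.emb r

theorem symmetrize_mem [Fintype I] [DecidableEq I] (n : I → ℕ) (r : RatFun k (Var n)) :
    symmetrize n r ∈ SymRat k n := by
  intro τ
  unfold symmetrize
  rw [map_sum]
  refine Fintype.sum_equiv (Equiv.mulLeft τ) _ _ fun σ => ?_
  rw [RatFun.rename_rename]
  rfl

end Variables

/-! ### The shuffle product and the shuffle algebra -/

/-- A quiver with vertex set `I` and edge set `E`; loops and multiple edges are allowed. -/
structure EdgeQuiver (I E : Type*) where
  src : E → I
  tgt : E → I

section Shuffle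

variable {I E : Type*} [Fintype I] [DecidableEq I] [Fintype E] {k : Type*} [Field k]
variable (Q : EdgeQuiver I E) (q : kˣ) (t : E → kˣ)

/-- `ζ_ij(x) = ((1 - x q⁻¹) / (1 - x))^{δ_ij} ∏_{e : i → j} (1 - t_e x) ∏_{e : j → i} (1 - q x / t_e)`,
where `x` is an element of an extension field `K` of `k`. -/
def zeta {K : Type*} [Field K] [Algebra k K] (i j : I) (x : K) : K :=
  (if i = j then (1 - x * algebraMap k K (q : k)⁻¹) / (1 - x) else 1) *
    (∏ e : E with Q.src e = i ∧ Q.tgt e = j, (1 - algebraMap k K (t e) * x)) *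
    ∏ e : E with Q.src e = j ∧ Q.tgt e = i, (1 - algebraMap k K (q / t e : k) * x)

/-- `∏ ζ_ij(z_{ia} / z_{jb})` over all `i, j` and all `a ≤ n_i`, `n_j < b ≤ n_j + m_j`. -/
def shuffleFactor (n m : I → ℕ) : RatFun k (Var (n + m)) :=
  ∏ v : Var n, ∏ w : Var m,
    zeta Q q t v.1 w.1 (RatFun.X k (leftVar n m v) / RatFun.X k (rightVar n m w))

/-- The shuffle product of symmetric rational functions of degrees `n` and `m`. -/
def shuffleMulAux (n m : I → ℕ) : SymRat k n →ₗ[k] SymRat k m →ₗ[k] SymRat k (n + m) :=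
  LinearMap.mk₂ k
    (fun R R' =>
      (((∏ i, (n i).factorial) * ∏ i, (m i).factorial : ℕ) : k)⁻¹ •
        (⟨symmetrize (n + m)
            (RatFun.rename k (leftVar n m) (R : RatFun k (Var n)) *
              RatFun.rename k (rightVar n m) (R' : RatFun k (Var m)) * shuffleFactor Q q t n m),
          symmetrize_mem _ _⟩ : SymRat k (n + m)))
    (fun R₁ R₂ R' => by
      rw [← smul_add]; congr 1; ext1
      simp [symmetrize, add_mul, Finset.sum_add_distrib])
    (fun c R R' => by
      rw [smul_comm]; congr 1; ext1
      simp [symmetrize, Finset.smul_sum])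
    (fun R R₁ R₂ => by
      rw [← smul_add]; congr 1; ext1
      simp [symmetrize, add_mul, mul_add, Finset.sum_add_distrib])
    (fun c R R' => by
      rw [smul_comm]; congr 1; ext1
      simp [symmetrize, Finset.smul_sum])

variable (I k) in
/-- The `ℕ^I`-graded space of symmetric rational functions.  The shuffle product is defined on all
of it; the Laurent polynomials form a subspace that is closed under the product. -/
abbrev Big : Type _ := ⨁ n : I → ℕ, SymRat k n

/-- The shuffle product. -/
def shuffleMul : Big I k →ₗ[k] Big I k →ₗ[k] Big I k :=
  DirectSum.toModule k (I → ℕ) _ fun n =>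
    LinearMap.flip <| DirectSum.toModule k (I → ℕ) _ fun m =>
      LinearMap.flip <|
        (shuffleMulAux Q q t n m).compr₂
          (DirectSum.lof k (I → ℕ) (fun n => SymRat k n) (n + m))

variable (I k) in
/-- The unit of the shuffle product: the constant `1` in degree `0`. -/
def shuffleOne : Big I k :=
  DirectSum.lof k (I → ℕ) (fun n => SymRat k n) 0 ⟨1, fun _ => map_one _⟩

/-- The substitution `z_{j1} = x, z_{j2} = x q, …, z_{jl} = x q^{l-1}`, the other variables being
left alone.  The new variable `x` is `none`, and the old variable `z_v` is `some v`. -/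
def chainSubst (n : I → ℕ) (j : I) (l : ℕ) :
    Laurent k (Var n) →ₐ[k] Laurent k (Option (Var n)) :=
  Laurent.subst fun v =>
    if v.1 = j ∧ v.2.val < l then
      Laurent.X k none * Units.map (algebraMap k (Laurent k (Option (Var n)))).toMonoidHom
        (q ^ v.2.val)
    else Laurent.X k (some v)

/-- For `v = (i, a)`, the product
`∏_{s=1}^{l-1} [∏_{e : i → j} (z_{ia} - q^s t_e⁻¹ x) ∏_{e : j → i} (z_{ia} - q^{s-1} t_e x)]`. -/
def wheelProduct (n : I → ℕ) (j : I) (l : ℕ) (v : Var n) : Laurent k (Option (Var n)) :=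
  ∏ s ∈ Finset.Ico 1 l,
    ((∏ e : E with Q.src e = v.1 ∧ Q.tgt e = j,
        (Laurent.var k (some v) -
          ((q : k) ^ s * (t e : k)⁻¹) • Laurent.var k none)) *
      ∏ e : E with Q.src e = j ∧ Q.tgt e = v.1,
        (Laurent.var k (some v) -
          ((q : k) ^ (s - 1) * (t e : k)) • Laurent.var k none))

/-- The many-variable wheel conditions: for every vertex `j` and `1 ≤ l ≤ n_j`, the specialization
of `P` at `z_{j1} = x, …, z_{jl} = x q^{l-1}` is divisible by `wheelProduct`, for each of the
variables `z_{ia}` that have not been specialized. -/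
def WheelCondition (n : I → ℕ) (P : Laurent k (Var n)) : Prop :=
  ∀ (j : I) (l : ℕ), 1 ≤ l → l ≤ n j → ∀ v : Var n, ¬ (v.1 = j ∧ v.2.val < l) →
    wheelProduct Q q t n j l v ∣ chainSubst q n j l P

/-- The degree `n` piece of the shuffle algebra: symmetric Laurent polynomials that satisfy the
wheel conditions. -/
def shufflePiece (n : I → ℕ) : Submodule k (SymRat k n) where
  carrier := {R | ∃ P : Laurent k (Var n), WheelCondition Q q t n P ∧
    algebraMap (Laurent k (Var n)) (RatFun k (Var n)) P = R}
  add_mem' := by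
    rintro R R' ⟨P, hP, h⟩ ⟨P', hP', h'⟩
    refine ⟨P + P', fun j l h1 h2 v hv => ?_, by rw [map_add, h, h']; rfl⟩
    rw [map_add]
    exact dvd_add (hP j l h1 h2 v hv) (hP' j l h1 h2 v hv)
  zero_mem' := ⟨0, fun j l _ _ v _ => by rw [map_zero]; exact dvd_zero _, by rw [map_zero]; rfl⟩
  smul_mem' := by
    rintro c R ⟨P, hP, h⟩
    refine ⟨c • P, fun j l h1 h2 v hv => ?_, ?_⟩
    · rw [map_smul, Algebra.smul_def]
      exact (hP j l h1 h2 v hv).mul_left _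
    · rw [Submodule.coe_smul, ← h, Algebra.smul_def, Algebra.smul_def, map_mul,
        ← IsScalarTower.algebraMap_apply]

/-- The shuffle algebra, as the direct sum of its graded pieces. -/
def shuffleAlgebra : Submodule k (Big I k) where
  carrier := {x | ∀ n, x n ∈ shufflePiece Q q t n}
  add_mem' := fun hx hy n => by
    rw [DirectSum.add_apply]; exact Submodule.add_mem _ (hx n) (hy n)
  zero_mem' := fun n => by rw [DirectSum.zero_apply]; exact Submodule.zero_mem _
  smul_mem' := fun c x hx n => by
    rw [DirectSum.smul_apply]; exact Submodule.smul_mem _ c (hx n)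

/-- The spherical subalgebra, generated for the shuffle product by the pieces of the shuffle
algebra whose degree is the vector with `1` at a vertex `i` and `0` elsewhere: the smallest
subspace that contains the unit and these pieces and is closed under the shuffle product. -/
def sphericalSubalgebra : Submodule k (Big I k) :=
  sInf {W | shuffleOne I k ∈ W ∧
    (∀ i : I, ∀ R ∈ shufflePiece Q q t (Pi.single i 1),
      DirectSum.lof k (I → ℕ) (fun n => SymRat k n) (Pi.single i 1) R ∈ W) ∧
    ∀ x ∈ W, ∀ y ∈ W, shuffleMul Q q t x y ∈ W}

end Shuffle

/-! ### Subtori of `T = ℂ* × ∏_e ℂ*` -/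

/-- A subtorus of `T = ℂ* × ∏_{e ∈ E} ℂ*`, through its character lattice `ℤ^rank` and the
restrictions `q` and `t e` of the coordinate characters of `T`.  The corresponding morphism of tori
`(ℂ*)^rank → T` is a closed embedding exactly when the restriction map on characters is onto. -/
structure Subtorus (E : Type*) where
  rank : ℕ
  q : Fin rank →₀ ℤ
  t : E → Fin rank →₀ ℤ
  closure_eq_top : AddSubgroup.closure (insert q (Set.range t)) = ⊤

namespace Subtorus

variable {E : Type*} (ρ : Subtorus E)

/-- The fraction field of the representation ring of the subtorus. -/
abbrev CoeffField : Type := FractionRing (Laurent ℤ (Fin ρ.rank))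

/-- A character of the subtorus as an invertible element of the coefficient field. -/
def char (χ : Fin ρ.rank →₀ ℤ) : ρ.CoeffFieldˣ :=
  Units.mk0
    (algebraMap (Laurent ℤ (Fin ρ.rank)) ρ.CoeffField (AddMonoidAlgebra.single χ 1))
    (by
      rw [Ne, FaithfulSMul.algebraMap_eq_zero_iff]
      simp)

/-- The value of a character at a complex point of the subtorus. -/
def charValue {r : ℕ} (θ : Fin r → ℂˣ) (χ : Fin r →₀ ℤ) : ℂ :=
  ((∏ a, θ a ^ χ a : ℂˣ) : ℂ)

/-- The parameter `q` is generic: its restriction to the subtorus is a nontrivial character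
(equivalently, it is not a root of unity in the coefficient field). -/
def QGeneric : Prop := ρ.q ≠ 0

/-- The characters can be specialized to complex numbers with `|q| < |t_e| < 1` for all `e`. -/
def CanSpecialize : Prop :=
  ∃ θ : Fin ρ.rank → ℂˣ, ∀ e : E,
    ‖charValue θ ρ.q‖ < ‖charValue θ (ρ.t e)‖ ∧ ‖charValue θ (ρ.t e)‖ < 1

end Subtorus

end QuiverShuffle

end

set_option linter.unusedSectionVars false

noncomputable section

namespace QuiverShuffle

/-! ### Products of primes -/

section Primes

variable {R ι : Type*} [CommRing R] [IsDomain R]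

/-! Up to an invertible monomial, `ζ_ij(z_u / z_v)` is `ξ(u,v) = ∏ (z_v - κ z_u)`, times `(z_u - q
z_v)/(z_u - z_v)` when the colours agree; here `κ` runs over the weights `t_e`, `q / t_e` of the
arrows of the doubled quiver. Products of degree-one elements span the same space as the "words"
`Sym [f ∏ ξ(u,v)]`, the product being over pairs with `u` before `v` in some ordering of the
variables and `f` any Laurent polynomial. The claim is that words span exactly the symmetric Laurent
polynomials satisfying the wheel conditions. The only input on the parameters is `SmallIn`: all `κ`
and `q` lie in a multiplicative semigroup avoiding `1`. The many-variable wheel conditions are then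
equivalent to the three-variable ones (`IsWheel`), because the linear factors for distinct `s` are
coprime.

Words are wheel elements (`exists_isWheel_of_word`): symmetrization removes the diagonal poles, and
each ordering satisfies the conditions by itself.

Conversely (`IsWheel.toRat_mem_wordSpan`), let `R` be a wheel element in the variables `U`, and
induct on `U`. Put `B_y = ∏_{z ≠ y} ∏_κ (z_z - κ z_y)`. The `B_y` have no common zero: at one, every
variable would be a multiple, by an element of the semigroup, of another, and following this
relation around a cycle would put `1` in the semigroup (`span_prod_tProd_eq_top`). Hence it suffices
to treat each `B_y R`, and by a Lagrange-type identity to put `Sym [z_y^i B_y R / Δ_y]` in the span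
of words, where `Δ_y = ∏ (z_y - z_v)` over the other `v` of the same colour.

Since `B_y ∏ (z_y - q z_v) / Δ_y` is the product of the `ξ(y,z)`, the numerator is divided by `∏
(z_y - q z_v)` (`IsWheelAt.exists_division`). The quotient is a wheel element in fewer variables, so
it yields words beginning with `y`. The remainder is interpolated from the values at `z_y = q z_c`;
there the wheel conditions produce the factor `B_c` in the remaining variables
(`IsWheelAt.exists_spec_eq`), so the same problem arises with `c` in place of `y` and one free
variable fewer. The variables already used form a chain standing at the front of the word, and
auxiliary factors (`chainNum`, `interpCorr`) are inserted so that every new `c` can be moved in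
front of that chain (`exists_chainTerm_eq`). The recursion `sym_chainTerm_mem` ends when no variable
is left. -/

theorem prod_prime_dvd_of_dvd_mul (s : Finset ι) (p : ι → R) (hp : ∀ i ∈ s, Prime (p i)) {y : R}
    (hy : ∀ i ∈ s, ¬ p i ∣ y) {x : R} (h : ∏ i ∈ s, p i ∣ x * y) : ∏ i ∈ s, p i ∣ x := by
  classical
  induction s using Finset.induction_on generalizing x with
  | empty => simp
  | insert a s ha ih =>
    rw [Finset.prod_insert ha] at h ⊢
    have h1 : p a ∣ x :=
      ((hp a (by simp)).dvd_or_dvd ((dvd_mul_right _ _).trans h)).resolve_right (hy a (by simp))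
    obtain ⟨x', rfl⟩ := h1
    rw [mul_assoc] at h
    refine mul_dvd_mul_left _ (ih (fun i hi => hp i (by simp [hi])) (fun i hi => hy i (by simp [hi]))
      ((mul_dvd_mul_iff_left (hp a (by simp)).ne_zero).1 h))

theorem prod_prime_mul_dvd (s : Finset ι) (p : ι → R) (hp : ∀ i ∈ s, Prime (p i)) {x y : R}
    (hy : ∀ i ∈ s, ¬ p i ∣ y) (hs : ∏ i ∈ s, p i ∣ x) (hyx : y ∣ x) :
    (∏ i ∈ s, p i) * y ∣ x := by
  obtain ⟨x', rfl⟩ := hyx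
  rw [mul_comm y x'] at *
  exact mul_dvd_mul_right (prod_prime_dvd_of_dvd_mul s p hp hy hs) _

/-- A product of pairwise coprime products of primes divides `x` if each factor does. -/
theorem prod_prod_prime_dvd {κ : Type*} (s : Finset ι) (r : ι → Finset κ) (p : ι → κ → R)
    (hp : ∀ i ∈ s, ∀ j ∈ r i, Prime (p i j))
    (hne : ∀ i ∈ s, ∀ i' ∈ s, i ≠ i' → ∀ j ∈ r i, ∀ j' ∈ r i', ¬ p i j ∣ p i' j')
    {x : R} (hx : ∀ i ∈ s, ∏ j ∈ r i, p i j ∣ x) : ∏ i ∈ s, ∏ j ∈ r i, p i j ∣ x := by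
  classical
  induction s using Finset.induction_on with
  | empty => simp
  | insert a s ha ih =>
    rw [Finset.prod_insert ha]
    refine prod_prime_mul_dvd _ _ (hp a (by simp)) ?_ (hx a (by simp))
      (ih (fun i hi => hp i (by simp [hi]))
        (fun i hi i' hi' => hne i (by simp [hi]) i' (by simp [hi'])) fun i hi => hx i (by simp [hi]))
    intro j hj hdvd
    obtain ⟨i', hi', h'⟩ := (hp a (by simp) j hj).exists_mem_finset_dvd hdvd
    obtain ⟨j', hj', h'⟩ := (hp a (by simp) j hj).exists_mem_finset_dvd h'
    exact hne a (by simp) i' (by simp [hi']) (by rintro rfl; exact ha hi') j hj j' hj' h'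

theorem prod_prime_dvd (s : Finset ι) (p : ι → R) (hp : ∀ i ∈ s, Prime (p i))
    (hne : ∀ i ∈ s, ∀ i' ∈ s, i ≠ i' → ¬ p i ∣ p i') {x : R} (hx : ∀ i ∈ s, p i ∣ x) :
    ∏ i ∈ s, p i ∣ x := by
  have := prod_prod_prime_dvd s (fun _ => (Finset.univ : Finset Unit)) (fun i _ => p i)
    (x := x) (fun i hi _ _ => hp i hi) (fun i hi i' hi' h _ _ _ _ => hne i hi i' hi' h)
    (fun i hi => by simpa using hx i hi)
  simpa using this

end Primes

/-! ### Substitutions in Laurent polynomials -/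

section Laurent

variable {k : Type*} [Field k] {V W : Type*}

namespace Laurent

/-- Every basis element of the group ring is a monomial in the invertible variables. Hence an
algebra map is determined by its values on variables, which is how all identities between
substitutions are checked. -/
theorem coe_prod_X (m : V →₀ ℤ) :
    ((m.prod fun v d => Laurent.X k v ^ d : (Laurent k V)ˣ) : Laurent k V) =
      AddMonoidAlgebra.single m 1 := by
  have hz : ∀ (v : V) (d : ℤ), ((Laurent.X k v ^ d : (Laurent k V)ˣ) : Laurent k V) =
      AddMonoidAlgebra.single (Finsupp.single v d) 1 := by
    intro v d
    let φ : Multiplicative ℤ →* Laurent k V :=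
      (AddMonoidAlgebra.of k (V →₀ ℤ)).comp
        (AddMonoidHom.toMultiplicative (Finsupp.singleAddHom v))
    have : ((Units.coeHom (Laurent k V)).comp (zpowersHom _ (Laurent.X k v))) = φ := by
      ext
      simp [φ, Laurent.X, zpowersHom]
    have := DFunLike.congr_fun this (Multiplicative.ofAdd d)
    simpa [φ, zpowersHom] using this
  classical
  rw [Finsupp.prod]
  induction m using Finsupp.induction with
  | zero => simp [AddMonoidAlgebra.one_def]
  | single_add a b f ha hb ih =>
    rw [← Finsupp.prod, Finsupp.prod_add_index' (fun _ => zpow_zero _) (fun v d e => zpow_add _ d e),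
      Finsupp.prod_single_index (zpow_zero _), Units.val_mul, hz, Finsupp.prod, ih,
      AddMonoidAlgebra.single_mul_single, one_mul]

theorem subst_var {A : Type*} [CommRing A] [Algebra k A] (u : V → Aˣ) (v : V) :
    Laurent.subst (k := k) u (Laurent.var k v) = u v := by
  unfold Laurent.subst Laurent.var Laurent.X
  rw [AddMonoidAlgebra.lift_single, one_smul]
  exact congrArg Units.val ((Finsupp.prod_single_index (zpow_zero _)).trans (zpow_one _))

theorem algHom_ext {A : Type*} [CommRing A] [Algebra k A] {f g : Laurent k V →ₐ[k] A}
    (h : ∀ v, f (Laurent.var k v) = g (Laurent.var k v)) : f = g := by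
  refine AddMonoidAlgebra.algHom_ext (R := k) (fun m => ?_) (by ext)
  rw [← coe_prod_X]
  have key : Units.map (f : Laurent k V →* A) (m.prod fun v d => Laurent.X k v ^ d) =
      Units.map (g : Laurent k V →* A) (m.prod fun v d => Laurent.X k v ^ d) := by
    rw [map_finsuppProd, map_finsuppProd]
    refine Finsupp.prod_congr fun v _ => ?_
    rw [map_zpow, map_zpow]
    congr 1
    ext
    exact h v
  exact congrArg Units.val key

theorem rename_var (f : V ↪ W) (v : V) :
    Laurent.rename k f (Laurent.var k v) = Laurent.var k (f v) := by
  simp [Laurent.rename, Laurent.var, Laurent.X, AddMonoidAlgebra.mapDomain_single]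

theorem isUnit_var (v : V) : IsUnit (Laurent.var k v) := (Laurent.X k v).isUnit

theorem var_ne_zero (v : V) : Laurent.var k v ≠ 0 := (isUnit_var v).ne_zero

/-- A constant as an invertible Laurent polynomial. -/
def C (k : Type*) [Field k] (V : Type*) : kˣ →* (Laurent k V)ˣ :=
  Units.map (algebraMap k (Laurent k V)).toMonoidHom

theorem coe_C (c : kˣ) : ((C k V c : (Laurent k V)ˣ) : Laurent k V) = algebraMap k _ (c : k) := rfl

/-- The linear form `z_u - c z_v`. -/
def lin (c : kˣ) (u v : V) : Laurent k V := Laurent.var k u - (c : k) • Laurent.var k v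

theorem lin_one_swap (a b : V) : Laurent.lin (k := k) 1 b a = -Laurent.lin 1 a b := by
  simp [Laurent.lin]

theorem smul_var_eq_smul_var {a b : k} (ha : a ≠ 0) {u v : V} :
    a • Laurent.var k u = b • Laurent.var k v ↔ u = v ∧ a = b := by
  constructor
  · intro h
    have h' : AddMonoidAlgebra.single (Finsupp.single u (1 : ℤ)) a =
        AddMonoidAlgebra.single (Finsupp.single v (1 : ℤ)) b := by
      simpa [Laurent.var, Laurent.X, AddMonoidAlgebra.smul_single] using h
    rcases AddMonoidAlgebra.single_inj.1 h' with ⟨h1, h2⟩ | ⟨h1, -⟩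
    · exact ⟨(Finsupp.single_left_inj one_ne_zero).1 h1, h2⟩
    · exact absurd h1 ha
  · rintro ⟨rfl, rfl⟩; rfl

theorem lin_ne_zero (c : kˣ) {u v : V} (h : u ≠ v) : lin c u v ≠ 0 := by
  intro h0
  have : (1 : k) • Laurent.var k u = (c : k) • Laurent.var k v := by
    rw [one_smul]; exact sub_eq_zero.1 h0
  exact h ((smul_var_eq_smul_var one_ne_zero).1 this).1

variable [DecidableEq V]

/-- The substitution `z_u ↦ c z_v`. -/
def spec (c : kˣ) (u v : V) : Laurent k V →ₐ[k] Laurent k V :=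
  Laurent.subst fun w => if w = u then Laurent.X k v * C k V c else Laurent.X k w

theorem spec_var_self (c : kˣ) (u v : V) :
    spec c u v (Laurent.var k u) = (c : k) • Laurent.var k v := by
  rw [spec, subst_var, if_pos rfl, Algebra.smul_def, mul_comm]; rfl

theorem spec_var_of_ne (c : kˣ) {u v w : V} (h : w ≠ u) :
    spec c u v (Laurent.var k w) = Laurent.var k w := by
  rw [spec, subst_var, if_neg h]; rfl

/-- Modulo `z_u - c z_v` the substitution does nothing to variables, hence nothing at all. So the
kernel of `spec c u v` is generated by the linear form; divisibility becomes vanishing, and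
primality follows since the target is a domain. -/
theorem lin_dvd_sub_spec (c : kˣ) (u v : V) (x : Laurent k V) : lin c u v ∣ x - spec c u v x := by
  rw [← Ideal.mem_span_singleton, ← Ideal.Quotient.eq]
  have : Ideal.Quotient.mkₐ k (Ideal.span {lin c u v}) =
      (Ideal.Quotient.mkₐ k (Ideal.span {lin c u v})).comp (spec c u v) := by
    refine Laurent.algHom_ext fun w => ?_
    by_cases h : w = u
    · subst h
      rw [AlgHom.comp_apply, spec_var_self]
      exact Ideal.Quotient.eq.2 (Ideal.mem_span_singleton_self _)
    · rw [AlgHom.comp_apply, spec_var_of_ne _ h]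
  exact DFunLike.congr_fun this x

theorem spec_lin (c : kˣ) {u v : V} (h : u ≠ v) : spec c u v (lin c u v) = 0 := by
  rw [lin, map_sub, map_smul, spec_var_self, spec_var_of_ne _ h.symm, sub_self]

theorem lin_dvd_iff (c : kˣ) {u v : V} (h : u ≠ v) {x : Laurent k V} :
    lin c u v ∣ x ↔ spec c u v x = 0 := by
  constructor
  · rintro ⟨y, rfl⟩
    rw [map_mul, spec_lin c h, zero_mul]
  · intro hx
    have := lin_dvd_sub_spec c u v x
    rwa [hx, sub_zero] at this

theorem prime_lin (c : kˣ) {u v : V} (h : u ≠ v) : Prime (lin c u v) := by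
  refine ⟨lin_ne_zero c h, fun hu => ?_, fun x y hxy => ?_⟩
  · have := hu.map (spec c u v)
    rw [spec_lin c h] at this
    exact not_isUnit_zero this
  · rw [lin_dvd_iff c h, map_mul, mul_eq_zero] at hxy
    exact hxy.imp (lin_dvd_iff c h).2 (lin_dvd_iff c h).2

theorem not_lin_dvd_lin_of_ne (c d : kˣ) {u v w x : V} (huv : u ≠ v) (hwx : w ≠ x)
    (hw : w ≠ u) (hx : w ≠ v) :
    ¬ lin c u v ∣ lin d w x := by
  rw [lin_dvd_iff c huv, lin, map_sub, map_smul, spec_var_of_ne c hw]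
  by_cases h : x = u
  · subst h
    rw [spec_var_self, sub_eq_zero, smul_smul]
    intro h0
    rw [← one_smul k (Laurent.var k w)] at h0
    exact hx ((smul_var_eq_smul_var one_ne_zero).1 h0).1
  · rw [spec_var_of_ne c h]
    exact lin_ne_zero d hwx

theorem not_lin_dvd_lin_of_ne' (c d : kˣ) {u v w x : V} (huv : u ≠ v) (hwx : w ≠ x)
    (hw : x ≠ u) (hx : x ≠ v) :
    ¬ lin c u v ∣ lin d w x := by
  classical
  have : lin d w x = algebraMap k _ (-(d : k)) * lin d⁻¹ x w := by
    rw [← Algebra.smul_def, lin, lin, smul_sub, smul_smul, Units.val_inv_eq_inv_val, neg_mul,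
      mul_inv_cancel₀ d.ne_zero, neg_smul, neg_smul, one_smul]
    ring
  rw [this]
  intro h
  refine ((prime_lin c huv).dvd_or_dvd h).elim (fun h => ?_)
    (not_lin_dvd_lin_of_ne c d⁻¹ huv hwx.symm hw hx)
  refine (prime_lin c huv).not_isUnit (isUnit_of_dvd_unit h ?_)
  exact (IsUnit.mk0 _ (neg_ne_zero.2 d.ne_zero)).map _

theorem not_lin_dvd_lin_of_coeff_ne (c d : kˣ) {u v : V} (huv : u ≠ v) (hcd : c ≠ d) :
    ¬ lin c u v ∣ lin d u v := by
  rw [lin_dvd_iff c huv, lin, map_sub, map_smul, spec_var_of_ne c huv.symm, spec_var_self,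
    ← sub_smul, smul_eq_zero, not_or]
  exact ⟨sub_ne_zero.2 fun h => hcd (Units.ext h), var_ne_zero v⟩

end Laurent

end Laurent

/-! ### Permutations of the variables and removal of diagonal poles -/

section Action

variable {k : Type*} [Field k] {V : Type*}

/-- The inclusion of Laurent polynomials into rational functions. -/
abbrev toRat (k V : Type*) [Field k] : Laurent k V →+* RatFun k V :=
  algebraMap (Laurent k V) (RatFun k V)

theorem toRat_injective : Function.Injective (toRat k V) :=
  IsFractionRing.injective (Laurent k V) (RatFun k V)

theorem toRat_ne_zero {x : Laurent k V} (h : x ≠ 0) : toRat k V x ≠ 0 :=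
  (map_ne_zero_iff _ toRat_injective).2 h

theorem toRat_smul (c : k) (x : Laurent k V) : toRat k V (c • x) = c • toRat k V x := by
  rw [Algebra.smul_def, Algebra.smul_def, map_mul]; rfl

/-- A permutation of the variables, acting on Laurent polynomials. -/
abbrev pact (k : Type*) [Field k] (σ : Equiv.Perm V) : Laurent k V →ₐ[k] Laurent k V :=
  Laurent.rename k σ.toEmbedding

/-- A permutation of the variables, acting on rational functions. -/
abbrev act (k : Type*) [Field k] (σ : Equiv.Perm V) : RatFun k V →ₐ[k] RatFun k V :=
  RatFun.rename k σ.toEmbedding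

theorem act_toRat (σ : Equiv.Perm V) (x : Laurent k V) :
    act k σ (toRat k V x) = toRat k V (pact k σ x) :=
  RatFun.rename_algebraMap _ _

theorem act_mul (σ τ : Equiv.Perm V) (x : RatFun k V) : act k (σ * τ) x = act k σ (act k τ x) := by
  have : (σ * τ).toEmbedding = τ.toEmbedding.trans σ.toEmbedding := rfl
  rw [act, act, act, this, RatFun.rename_rename]

theorem pact_var (σ : Equiv.Perm V) (v : V) :
    pact k σ (Laurent.var k v) = Laurent.var k (σ v) := Laurent.rename_var _ _

theorem pact_lin (σ : Equiv.Perm V) (c : kˣ) (u v : V) :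
    pact k σ (Laurent.lin c u v) = Laurent.lin c (σ u) (σ v) := by
  simp only [Laurent.lin, map_sub, map_smul, pact_var]

variable [DecidableEq V]

theorem pact_spec (σ : Equiv.Perm V) (c : kˣ) (u v : V) (x : Laurent k V) :
    pact k σ (Laurent.spec c u v x) = Laurent.spec c (σ u) (σ v) (pact k σ x) := by
  have : (pact k σ).comp (Laurent.spec c u v) =
      (Laurent.spec c (σ u) (σ v)).comp (pact k σ) := by
    refine Laurent.algHom_ext fun w => ?_
    simp only [AlgHom.comp_apply, pact_var]
    by_cases h : w = u
    · subst h; simp only [Laurent.spec_var_self, map_smul, pact_var]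
    · rw [Laurent.spec_var_of_ne _ h, Laurent.spec_var_of_ne _ (σ.injective.ne h), pact_var]
  exact DFunLike.congr_fun this x

theorem spec_pact_swap (a b : V) (x : Laurent k V) :
    Laurent.spec 1 a b (pact k (Equiv.swap a b) x) = Laurent.spec 1 a b x := by
  have : (Laurent.spec 1 a b).comp (pact k (Equiv.swap a b)) = Laurent.spec (k := k) 1 a b := by
    refine Laurent.algHom_ext fun w => ?_
    simp only [AlgHom.comp_apply, pact_var]
    by_cases ha : w = a
    · subst ha
      rw [Equiv.swap_apply_left, Laurent.spec_var_self]
      by_cases hb : b = w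
      · subst hb; rw [Laurent.spec_var_self]
      · rw [Laurent.spec_var_of_ne _ hb, Units.val_one, one_smul]
    by_cases hb : w = b
    · subst hb
      rw [Equiv.swap_apply_right, Laurent.spec_var_self, Laurent.spec_var_of_ne _ ha,
        Units.val_one, one_smul]
    · rw [Equiv.swap_apply_of_ne_of_ne ha hb]
  exact DFunLike.congr_fun this x

/-- A rational function whose poles are simple and lie along diagonals `z_a = z_b`, and that is
invariant under the corresponding transpositions, is a Laurent polynomial. -/
theorem exists_toRat_of_swap_invariant [CharZero k] (S : Finset (V × V))
    (hne : ∀ p ∈ S, p.1 ≠ p.2) (hS : ∀ p ∈ S, p.swap ∉ S) {r : RatFun k V} {x : Laurent k V}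
    (hr : ∀ p ∈ S, act k (Equiv.swap p.1 p.2) r = r)
    (h : toRat k V (∏ p ∈ S, Laurent.lin 1 p.1 p.2) * r = toRat k V x) :
    ∃ y, r = toRat k V y := by
  have hnd : ∀ p ∈ S, ∀ p' ∈ S, p ≠ p' →
      ¬ Laurent.lin (k := k) 1 p.1 p.2 ∣ Laurent.lin 1 p'.1 p'.2 := by
    intro p hp p' hp' hpp
    by_cases h1 : p'.1 ≠ p.1 ∧ p'.1 ≠ p.2
    · exact Laurent.not_lin_dvd_lin_of_ne _ _ (hne p hp) (hne p' hp') h1.1 h1.2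
    · by_cases h2 : p'.2 ≠ p.1 ∧ p'.2 ≠ p.2
      · exact Laurent.not_lin_dvd_lin_of_ne' _ _ (hne p hp) (hne p' hp') h2.1 h2.2
      · exfalso
        have h3 := hne p' hp'
        have h4 := hS p hp
        obtain ⟨a, b⟩ := p
        obtain ⟨c, d⟩ := p'
        simp only [ne_eq, Prod.mk.injEq, Prod.swap_prod_mk] at *
        grind
  have hx : ∏ p ∈ S, Laurent.lin 1 p.1 p.2 ∣ x := by
    refine prod_prime_dvd S _ (fun p hp => Laurent.prime_lin 1 (hne p hp)) hnd fun p hp => ?_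
    rw [← Finset.mul_prod_erase S _ hp] at h
    set D := ∏ p ∈ S.erase p, Laurent.lin (k := k) 1 p.1 p.2 with hD
    set ℓ := Laurent.lin (k := k) 1 p.1 p.2 with hℓ
    have hD0 : Laurent.spec 1 p.1 p.2 D ≠ 0 := by
      rw [hD, map_prod, Finset.prod_ne_zero_iff]
      intro p' hp'
      rw [Finset.mem_erase] at hp'
      rw [Ne, ← Laurent.lin_dvd_iff _ (hne p hp)]
      exact hnd p hp p' hp'.2 hp'.1.symm
    have h2 := congrArg (act k (Equiv.swap p.1 p.2)) h
    rw [map_mul, act_toRat, act_toRat, hr p hp] at h2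
    -- Both sides are the product of `ℓ D`, its transform under the transposition, and `r`.
    have h3 : ℓ * D * pact k (Equiv.swap p.1 p.2) x =
        pact k (Equiv.swap p.1 p.2) (ℓ * D) * x := by
      apply toRat_injective
      rw [map_mul (toRat k V) (ℓ * D), map_mul (toRat k V) _ x, ← h, ← h2]
      ring
    have h4 : pact k (Equiv.swap p.1 p.2) ℓ = -ℓ := by
      rw [hℓ, pact_lin, Equiv.swap_apply_left, Equiv.swap_apply_right]
      simp [Laurent.lin]
    rw [map_mul, h4] at h3
    have h5 : D * pact k (Equiv.swap p.1 p.2) x = -(pact k (Equiv.swap p.1 p.2) D * x) := by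
      have : ℓ ≠ 0 := Laurent.lin_ne_zero 1 (hne p hp)
      apply mul_left_cancel₀ this
      linear_combination h3
    -- On the diagonal the transposition becomes invisible, so the sign coming from `ℓ` gives `2 D x
    -- = 0` there. As `2` and `D` are nonzero on the diagonal, `x` vanishes on it.
    have h6 := congrArg (Laurent.spec 1 p.1 p.2) h5
    rw [map_mul, map_neg, map_mul, spec_pact_swap, spec_pact_swap] at h6
    have h7 : (2 : Laurent k V) * (Laurent.spec 1 p.1 p.2 D * Laurent.spec 1 p.1 p.2 x) = 0 := by
      linear_combination h6
    have h2' : (2 : Laurent k V) ≠ 0 := by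
      have : (2 : Laurent k V) = algebraMap k _ 2 := (map_ofNat _ 2).symm
      rw [this]
      exact ((IsUnit.mk0 (2 : k) two_ne_zero).map (algebraMap k (Laurent k V))).ne_zero
    rw [Laurent.lin_dvd_iff _ (hne p hp)]
    exact (mul_eq_zero.1 ((mul_eq_zero.1 h7).resolve_left h2')).resolve_left hD0
  obtain ⟨y, rfl⟩ := hx
  refine ⟨y, mul_left_cancel₀ (toRat_ne_zero ?_) (h.trans (map_mul _ _ _))⟩
  exact Finset.prod_ne_zero_iff.2 fun p hp => Laurent.lin_ne_zero 1 (hne p hp)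

end Action

/-! ### Symmetrization over a set of coloured variables -/

section Sym

variable {k : Type*} [Field k] {V I : Type*} [Fintype V] [DecidableEq V] (col : V → I)

open Classical in
/-- The colour-preserving permutations of the variables that fix those outside `U`. -/
def colPerm (U : Finset V) : Finset (Equiv.Perm V) :=
  Finset.univ.filter fun σ => (∀ v, col (σ v) = col v) ∧ ∀ v, v ∉ U → σ v = v

variable {col} {U U' : Finset V}

theorem mem_colPerm {σ : Equiv.Perm V} :
    σ ∈ colPerm col U ↔ (∀ v, col (σ v) = col v) ∧ ∀ v, v ∉ U → σ v = v := by
  simp [colPerm]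

theorem one_mem_colPerm : 1 ∈ colPerm col U := by simp [mem_colPerm]

theorem mul_mem_colPerm {σ τ : Equiv.Perm V} (hσ : σ ∈ colPerm col U) (hτ : τ ∈ colPerm col U) :
    σ * τ ∈ colPerm col U := by
  rw [mem_colPerm] at *
  refine ⟨fun v => ?_, fun v hv => ?_⟩
  · rw [Equiv.Perm.mul_apply, hσ.1, hτ.1]
  · rw [Equiv.Perm.mul_apply, hτ.2 v hv, hσ.2 v hv]

theorem inv_mem_colPerm {σ : Equiv.Perm V} (hσ : σ ∈ colPerm col U) : σ⁻¹ ∈ colPerm col U := by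
  rw [mem_colPerm] at *
  refine ⟨fun v => ?_, fun v hv => ?_⟩
  · rw [← hσ.1 (σ⁻¹ v)]
    exact congrArg col (Equiv.apply_symm_apply σ v)
  · rw [Equiv.Perm.inv_eq_iff_eq, hσ.2 v hv]

theorem colPerm_mono (h : U' ⊆ U) : colPerm col U' ⊆ colPerm col U := fun σ hσ => by
  rw [mem_colPerm] at *
  exact ⟨hσ.1, fun v hv => hσ.2 v fun h' => hv (h h')⟩

theorem apply_mem_of_mem_colPerm {σ : Equiv.Perm V} (hσ : σ ∈ colPerm col U) {v : V} :
    σ v ∈ U ↔ v ∈ U := by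
  rw [mem_colPerm] at hσ
  constructor
  · intro h
    by_contra h'
    rw [hσ.2 v h'] at h
    exact h' h
  · intro h
    by_contra h'
    have := σ.injective (hσ.2 _ h')
    rw [this] at h'
    exact h' h

theorem map_colPerm {σ : Equiv.Perm V} (hσ : σ ∈ colPerm col U) : U.map σ.toEmbedding = U := by
  ext v
  rw [Finset.mem_map_equiv, ← apply_mem_of_mem_colPerm hσ, Equiv.apply_symm_apply]

theorem prod_comp_colPerm {M : Type*} [CommMonoid M] {σ : Equiv.Perm V} (hσ : σ ∈ colPerm col U)
    (f : V → M) : ∏ v ∈ U, f (σ v) = ∏ v ∈ U, f v := by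
  conv_rhs => rw [← map_colPerm hσ, Finset.prod_map]
  rfl

theorem swap_mem_colPerm {a b : V} (ha : a ∈ U) (hb : b ∈ U) (hab : col a = col b) :
    Equiv.swap a b ∈ colPerm col U := by
  rw [mem_colPerm]
  refine ⟨fun v => ?_, fun v hv => Equiv.swap_apply_of_ne_of_ne ?_ ?_⟩
  · rw [Equiv.swap_apply_def]
    split_ifs with h1 h2
    · rw [h1, hab]
    · rw [h2, hab]
    · rfl
  · rintro rfl; exact hv ha
  · rintro rfl; exact hv hb

variable (col U) in
/-- Symmetrization over `colPerm col U`. -/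
def sym (x : RatFun k V) : RatFun k V := ∑ σ ∈ colPerm col U, act k σ x

theorem sym_add (x y : RatFun k V) : sym col U (x + y) = sym col U x + sym col U y := by
  simp [sym, Finset.sum_add_distrib]

theorem sym_sum {ι : Type*} (s : Finset ι) (x : ι → RatFun k V) :
    sym col U (∑ i ∈ s, x i) = ∑ i ∈ s, sym col U (x i) := by
  simp only [sym, map_sum]
  exact Finset.sum_comm

theorem sym_smul (c : k) (x : RatFun k V) : sym col U (c • x) = c • sym col U x := by
  simp [sym, Finset.smul_sum]

theorem sym_act {τ : Equiv.Perm V} (hτ : τ ∈ colPerm col U) (x : RatFun k V) :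
    sym col U (act k τ x) = sym col U x := by
  unfold sym
  refine Finset.sum_bij' (fun σ _ => σ * τ) (fun σ _ => σ * τ⁻¹)
    (fun σ hσ => mul_mem_colPerm hσ hτ) (fun σ hσ => mul_mem_colPerm hσ (inv_mem_colPerm hτ))
    (by simp) (by simp) fun σ _ => (act_mul _ _ _).symm

theorem act_sym {τ : Equiv.Perm V} (hτ : τ ∈ colPerm col U) (x : RatFun k V) :
    act k τ (sym col U x) = sym col U x := by
  unfold sym
  rw [map_sum]
  refine Finset.sum_bij' (fun σ _ => τ * σ) (fun σ _ => τ⁻¹ * σ)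
    (fun σ hσ => mul_mem_colPerm hτ hσ) (fun σ hσ => mul_mem_colPerm (inv_mem_colPerm hτ) hσ)
    (by simp) (by simp) fun σ _ => (act_mul _ _ _).symm

theorem sym_mul_of_invariant {g : RatFun k V} (hg : ∀ σ ∈ colPerm col U, act k σ g = g)
    (x : RatFun k V) : sym col U (g * x) = g * sym col U x := by
  unfold sym
  rw [Finset.mul_sum]
  exact Finset.sum_congr rfl fun σ hσ => by rw [map_mul, hg σ hσ]

/-- The inner permutations fix `g` and lie in the outer group, so each of them is absorbed by the
outer sum. -/
theorem sym_mul_sym (hU : U' ⊆ U) {g : RatFun k V} (hg : ∀ σ ∈ colPerm col U', act k σ g = g)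
    (x : RatFun k V) :
    sym col U (g * sym col U' x) = (colPerm col U').card • sym col U (g * x) := by
  rw [← sym_mul_of_invariant hg, sym.eq_1 col U', sym_sum,
    Finset.sum_congr rfl fun τ hτ => sym_act (colPerm_mono hU hτ) (g * x), Finset.sum_const]

theorem sym_of_invariant {x : RatFun k V} (hx : ∀ σ ∈ colPerm col U, act k σ x = x) :
    sym col U x = (colPerm col U).card • x := by
  rw [sym, Finset.sum_congr rfl hx, Finset.sum_const]

theorem card_colPerm_ne_zero [CharZero k] : ((colPerm col U).card : k) ≠ 0 :=
  Nat.cast_ne_zero.2 (Finset.card_ne_zero_of_mem one_mem_colPerm)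

end Sym

/-! ### Words -/

/-- The product of `g u v` over all pairs with `u` before `v` in a list. -/
def pairProd {V M : Type*} [CommMonoid M] (g : V → V → M) : List V → M
  | [] => 1
  | u :: L => (L.map (g u)).prod * pairProd g L

section PairProd

variable {V M : Type*} [CommMonoid M]

theorem pairProd_append (g : V → V → M) (L L' : List V) :
    pairProd g (L ++ L') =
      pairProd g L * (L.map fun u => (L'.map (g u)).prod).prod * pairProd g L' := by
  induction L with
  | nil => simp [pairProd]
  | cons u L ih =>
    simp only [List.cons_append, pairProd, List.map_append, List.prod_append, ih, List.map_cons,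
      List.prod_cons]
    ac_rfl

theorem map_pairProd {M' F : Type*} [CommMonoid M'] [FunLike F M M'] [MonoidHomClass F M M']
    (φ : F) (g : V → V → M) (L : List V) :
    φ (pairProd g L) = pairProd (fun u v => φ (g u v)) L := by
  induction L with
  | nil => simp [pairProd]
  | cons u L ih => simp [pairProd, ih, map_list_prod, Function.comp_def]

theorem pairProd_map {W : Type*} (g : V → V → M) (f : W → V) (L : List W) :
    pairProd g (L.map f) = pairProd (fun u v => g (f u) (f v)) L := by
  induction L with
  | nil => simp [pairProd]
  | cons u L ih => simp [pairProd, ih, Function.comp_def]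

theorem pairProd_congr {g h : V → V → M} {L : List V}
    (H : ∀ u ∈ L, ∀ v ∈ L, g u v = h u v) : pairProd g L = pairProd h L := by
  induction L with
  | nil => rfl
  | cons u L ih =>
    rw [pairProd, pairProd, ih fun u hu v hv => H u (by simp [hu]) v (by simp [hv])]
    congr 2
    exact List.map_congr_left fun v hv => H u (by simp) v (by simp [hv])

variable [DecidableEq V]

theorem list_prod_map_eq_finset_prod {L : List V} (hL : L.Nodup) (f : V → M) :
    (L.map f).prod = ∏ v ∈ L.toFinset, f v :=
  (List.prod_toFinset f hL).symm

/-- The pairs `(u, v)` with `u` before `v`. -/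
def pairs : List V → Finset (V × V)
  | [] => ∅
  | u :: L => L.toFinset.image (fun v => (u, v)) ∪ pairs L

theorem mem_of_mem_pairs {L : List V} {p : V × V} (hp : p ∈ pairs L) : p.1 ∈ L ∧ p.2 ∈ L := by
  induction L with
  | nil => simp [pairs] at hp
  | cons u L ih =>
    simp only [pairs, Finset.mem_union, Finset.mem_image, List.mem_toFinset] at hp
    rcases hp with ⟨v, hv, rfl⟩ | hp
    · simp [hv]
    · simp [ih hp]

theorem pairProd_eq_prod_pairs {L : List V} (hL : L.Nodup) (g : V → V → M) :
    pairProd g L = ∏ p ∈ pairs L, g p.1 p.2 := by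
  induction L with
  | nil => simp [pairProd, pairs]
  | cons u L ih =>
    rw [List.nodup_cons] at hL
    rw [pairProd, pairs, Finset.prod_union, ih hL.2, list_prod_map_eq_finset_prod hL.2,
      Finset.prod_image fun _ _ _ _ h => (Prod.mk.inj h).2]
    rw [Finset.disjoint_left]
    intro p hp hp'
    simp only [Finset.mem_image, List.mem_toFinset] at hp
    obtain ⟨v, hv, rfl⟩ := hp
    exact hL.1 (mem_of_mem_pairs hp').1

theorem ne_and_swap_notMem_pairs {L : List V} (hL : L.Nodup) {p : V × V} (hp : p ∈ pairs L) :
    p.1 ≠ p.2 ∧ p.swap ∉ pairs L := by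
  induction L with
  | nil => simp [pairs] at hp
  | cons u L ih =>
    rw [List.nodup_cons] at hL
    simp only [pairs, Finset.mem_union, Finset.mem_image, List.mem_toFinset] at hp ⊢
    rcases hp with ⟨v, hv, rfl⟩ | hp
    · refine ⟨fun h => hL.1 (by rwa [show u = v from h]), ?_⟩
      rintro (⟨w, hw, h⟩ | h)
      · simp only [Prod.swap_prod_mk, Prod.mk.injEq] at h
        exact hL.1 (h.2 ▸ hw)
      · exact hL.1 (mem_of_mem_pairs h).2
    · refine ⟨(ih hL.2 hp).1, ?_⟩
      rintro (⟨w, hw, h⟩ | h)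
      · rw [Prod.ext_iff] at h
        exact hL.1 (by rw [show u = p.2 from h.1]; exact (mem_of_mem_pairs hp).2)
      · exact (ih hL.2 hp).2 h

theorem mem_pairs_or {L : List V} {a b : V} (ha : a ∈ L) (hb : b ∈ L) (hab : a ≠ b) :
    (a, b) ∈ pairs L ∨ (b, a) ∈ pairs L := by
  induction L with
  | nil => simp at ha
  | cons u L ih =>
    simp only [pairs, Finset.mem_union, Finset.mem_image, List.mem_toFinset]
    simp only [List.mem_cons] at ha hb
    rcases ha with rfl | ha <;> rcases hb with rfl | hb
    · exact absurd rfl hab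
    · exact Or.inl (Or.inl ⟨b, hb, rfl⟩)
    · exact Or.inr (Or.inl ⟨a, ha, rfl⟩)
    · exact (ih ha hb).imp Or.inr Or.inr

end PairProd

section Words

variable {k : Type*} [Field k] {V I : Type*} [Fintype V] [DecidableEq V] {col : V → I}

/-- The span of the symmetrizations of `f ∏ ξ(u, v)`, the product over the pairs with `u` before `v`
in some ordering of `U`, and `f` any Laurent polynomial. -/
def wordSpan (col : V → I) (ξ : V → V → RatFun k V) (U : Finset V) : Submodule k (RatFun k V) :=
  Submodule.span k {x | ∃ (f : Laurent k V) (L : List V), L.Nodup ∧ L.toFinset = U ∧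
    x = sym col U (toRat k V f * pairProd ξ L)}

/-- The factors `ξ(u, v)` are permuted by the colour-preserving permutations. -/
def Equivariant (col : V → I) (ξ : V → V → RatFun k V) : Prop :=
  ∀ σ : Equiv.Perm V, (∀ v, col (σ v) = col v) → ∀ u v, act k σ (ξ u v) = ξ (σ u) (σ v)

variable {ξ : V → V → RatFun k V} {U U' : Finset V}

theorem act_wordSpan {x : RatFun k V} (hx : x ∈ wordSpan col ξ U) {σ : Equiv.Perm V}
    (hσ : σ ∈ colPerm col U) : act k σ x = x := by
  induction hx using Submodule.span_induction with
  | mem x hx => obtain ⟨f, L, -, -, rfl⟩ := hx; exact act_sym hσ _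
  | zero => exact map_zero _
  | add x y _ _ hx hy => rw [map_add, hx, hy]
  | smul c x _ hx => rw [map_smul, hx]

/-- A symmetric factor passes through the symmetrization and merges with the free polynomial `f` of
a word. -/
theorem mul_mem_wordSpan {g : Laurent k V} (hg : ∀ σ ∈ colPerm col U, pact k σ g = g)
    {x : RatFun k V} (hx : x ∈ wordSpan col ξ U) : toRat k V g * x ∈ wordSpan col ξ U := by
  induction hx using Submodule.span_induction with
  | mem x hx =>
    obtain ⟨f, L, h1, h2, rfl⟩ := hx
    refine Submodule.subset_span ⟨g * f, L, h1, h2, ?_⟩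
    rw [← sym_mul_of_invariant fun σ hσ => by rw [act_toRat, hg σ hσ], map_mul, mul_assoc]
  | zero => rw [mul_zero]; exact zero_mem _
  | add x y _ _ hx hy => rw [mul_add]; exact add_mem hx hy
  | smul c x _ hx => rw [mul_smul_comm]; exact Submodule.smul_mem _ c hx

theorem act_prod_right (hξ : Equivariant col ξ) {s : V} (hs : s ∉ U) {σ : Equiv.Perm V}
    (hσ : σ ∈ colPerm col U) : act k σ (∏ z ∈ U, ξ s z) = ∏ z ∈ U, ξ s z := by
  have h := mem_colPerm.1 hσ
  rw [map_prod, Finset.prod_congr rfl fun z _ => hξ σ h.1 s z, h.2 s hs,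
    prod_comp_colPerm hσ fun z => ξ s z]

theorem act_pairProd_of_disjoint (hξ : Equivariant col ξ) {C : List V} (hC : ∀ s ∈ C, s ∉ U)
    {σ : Equiv.Perm V} (hσ : σ ∈ colPerm col U) : act k σ (pairProd ξ C) = pairProd ξ C := by
  have h := mem_colPerm.1 hσ
  rw [map_pairProd]
  exact pairProd_congr fun u hu v hv => by
    rw [hξ σ h.1, h.2 u (hC u hu), h.2 v (hC v hv)]

/-- Putting a fixed list of variables in front of words. -/
theorem sym_prefix_mem_wordSpan (hξ : Equivariant col ξ) {C : List V} (hC : C.Nodup)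
    (hCU : ∀ s ∈ C, s ∉ U') (hU : U = C.toFinset ∪ U')
    {g : Laurent k V} (hg : ∀ σ ∈ colPerm col U', pact k σ g = g)
    {x : RatFun k V} (hx : x ∈ wordSpan col ξ U') :
    sym col U (toRat k V g * pairProd ξ C * (C.map fun s => ∏ z ∈ U', ξ s z).prod * x) ∈
      wordSpan col ξ U := by
  have hG : ∀ σ ∈ colPerm col U',
      act k σ (toRat k V g * pairProd ξ C * (C.map fun s => ∏ z ∈ U', ξ s z).prod) =
        toRat k V g * pairProd ξ C * (C.map fun s => ∏ z ∈ U', ξ s z).prod := by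
    intro σ hσ
    rw [map_mul, map_mul, act_toRat, hg σ hσ, act_pairProd_of_disjoint hξ hCU hσ, map_list_prod,
      List.map_map]
    congr 2
    exact List.map_congr_left fun s hs => act_prod_right hξ (hCU s hs) hσ
  induction hx using Submodule.span_induction with
  | mem x hx =>
    obtain ⟨f, L, h1, h2, rfl⟩ := hx
    -- The prefix factor is invariant under the permutations of `U'`, so the inner symmetrization
    -- only costs an integer factor, and the result is the word for `C ++ L`.
    rw [sym_mul_sym (by rw [hU]; exact Finset.subset_union_right) hG]
    refine Submodule.smul_of_tower_mem _ _ (Submodule.subset_span ⟨g * f, C ++ L, ?_, ?_, ?_⟩)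
    · refine hC.append h1 fun s hs hs' => hCU s hs ?_
      rw [← h2]; exact List.mem_toFinset.2 hs'
    · rw [List.toFinset_append, h2, hU]
    · rw [pairProd_append, map_mul]
      have : (fun s => (L.map (ξ s)).prod) = fun s => ∏ z ∈ U', ξ s z := by
        ext1 s; rw [list_prod_map_eq_finset_prod h1, h2]
      rw [this]
      congr 1
      ring
  | zero => rw [mul_zero]; simp [sym]
  | add x y _ _ hx hy => rw [mul_add, sym_add]; exact add_mem hx hy
  | smul c x _ hx => rw [mul_smul_comm, sym_smul]; exact Submodule.smul_mem _ c hx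

/-- A rational function that is invariant under `colPerm` and has simple poles along diagonals is a
Laurent polynomial. -/
theorem exists_toRat_of_invariant [DecidableEq I] [CharZero k] {L : List V} (hL : L.Nodup)
    {r : RatFun k V} (hr : ∀ σ ∈ colPerm col L.toFinset, act k σ r = r) {x : Laurent k V}
    (h : toRat k V (pairProd (fun a b => if col a = col b then Laurent.lin 1 a b else 1) L) * r =
      toRat k V x) : ∃ y, r = toRat k V y := by
  rw [pairProd_eq_prod_pairs hL, ← Finset.prod_filter] at h
  refine exists_toRat_of_swap_invariant ((pairs L).filter fun p => col p.1 = col p.2)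
    (fun p hp => ?_) (fun p hp hp' => ?_) (fun p hp => ?_) h <;> rw [Finset.mem_filter] at hp
  · exact (ne_and_swap_notMem_pairs hL hp.1).1
  · exact (ne_and_swap_notMem_pairs hL hp.1).2 (Finset.mem_filter.1 hp').1
  · have := mem_of_mem_pairs hp.1
    exact hr _ (swap_mem_colPerm (List.mem_toFinset.2 this.1) (List.mem_toFinset.2 this.2) hp.2)

end Words

/-! ### Weights of the doubled quiver and the factors `ξ` -/

section Weights

variable {I E : Type*} [DecidableEq I] [Fintype E] {k : Type*} [Field k]

/-- The weights `t_e` and `q / t_e` of the arrows of the doubled quiver. -/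
def kap (q : kˣ) (t : E → kˣ) : E ⊕ E → kˣ := Sum.elim t fun e => q / t e

/-- The arrows of the doubled quiver from `i` to `j`. -/
def arrows (Q : EdgeQuiver I E) (i j : I) : Finset (E ⊕ E) :=
  (Finset.univ.filter fun e => Q.src e = i ∧ Q.tgt e = j).disjSum
    (Finset.univ.filter fun e => Q.src e = j ∧ Q.tgt e = i)

/-- The parameters `q`, `t_e` and `q / t_e` lie in a semigroup that does not contain `1`. -/
structure SmallIn (N : Subsemigroup kˣ) (q : kˣ) (t : E → kˣ) : Prop where
  one_notMem : (1 : kˣ) ∉ N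
  q_mem : q ∈ N
  kap_mem : ∀ p, kap q t p ∈ N

theorem kap_swap (q : kˣ) (t : E → kˣ) (p : E ⊕ E) : kap q t p.swap = q / kap q t p := by
  rcases p with e | e <;> simp [kap]

theorem swap_mem_arrows {Q : EdgeQuiver I E} {i j : I} {p : E ⊕ E} :
    p.swap ∈ arrows Q i j ↔ p ∈ arrows Q j i := by
  rcases p with e | e <;> simp [arrows]

namespace SmallIn

variable {N : Subsemigroup kˣ} {q : kˣ} {t : E → kˣ} (h : SmallIn N q t)
include h

theorem ne_one {x : kˣ} (hx : x ∈ N) : x ≠ 1 := fun h' => h.one_notMem (h' ▸ hx)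

theorem div_kap_mem (p : E ⊕ E) : q / kap q t p ∈ N := kap_swap q t p ▸ h.kap_mem _

theorem q_ne_kap (p : E ⊕ E) : q ≠ kap q t p := fun h' =>
  h.ne_one (h.div_kap_mem p) (by rw [← h', div_self'])

theorem pow_mem (n : ℕ) : q ^ (n + 1) ∈ N := by
  induction n with
  | zero => simpa using h.q_mem
  | succ n ih => rw [pow_succ]; exact N.mul_mem ih h.q_mem

theorem pow_ne_kap (n : ℕ) (p : E ⊕ E) : q ^ (n + 1) ≠ kap q t p := by
  intro h'
  have : q ^ n * (q / kap q t p) = 1 := by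
    rw [← h', pow_succ, ← mul_div_assoc, div_self']
  cases n with
  | zero => exact h.ne_one (h.div_kap_mem p) (by simpa using this)
  | succ n => exact h.ne_one (N.mul_mem (h.pow_mem n) (h.div_kap_mem p)) this

/-- Equality would write `1` as `κ · q^n · (q / κ')`, a product of elements of `N`. This is what
keeps the linear factors of a wheel product with different `s` coprime. -/
theorem pow_mul_kap_ne_kap (n : ℕ) (p p' : E ⊕ E) : q ^ (n + 1) * kap q t p ≠ kap q t p' := by
  intro h'
  have h2 : kap q t p * (q ^ (n + 1) / kap q t p') = 1 := by
    rw [← h', mul_comm, div_mul_eq_mul_div, div_self']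
  have h3 : q ^ (n + 1) / kap q t p' ∈ N := by
    rw [pow_succ, mul_div_assoc]
    cases n with
    | zero => simpa using h.div_kap_mem p'
    | succ n => exact N.mul_mem (h.pow_mem n) (h.div_kap_mem p')
  exact h.ne_one (N.mul_mem (h.kap_mem p) h3) h2

end SmallIn

variable (Q : EdgeQuiver I E) (q : kˣ) (t : E → kˣ) {V : Type*} (col : V → I)

/-- The product of `z_v - κ z_u` over the weights `κ` of the arrows from the colour of `u` to that
of `v`. -/
def tProd (u v : V) : Laurent k V :=
  ∏ p ∈ arrows Q (col u) (col v), Laurent.lin (kap q t p) v u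

/-- The shuffle factor of `z_u / z_v`, up to a monomial. -/
def xi (u v : V) : RatFun k V :=
  toRat k V (tProd Q q t col u v) *
    if col u = col v then toRat k V (Laurent.lin q u v) / toRat k V (Laurent.lin 1 u v) else 1

variable {Q q t col}

theorem tProd_ne_zero {u v : V} (h : u ≠ v) : tProd Q q t col u v ≠ 0 :=
  Finset.prod_ne_zero_iff.2 fun _ _ => Laurent.lin_ne_zero _ h.symm

theorem pact_tProd {σ : Equiv.Perm V} (hσ : ∀ v, col (σ v) = col v) (u v : V) :
    pact k σ (tProd Q q t col u v) = tProd Q q t col (σ u) (σ v) := by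
  rw [tProd, tProd, map_prod, hσ, hσ]
  exact Finset.prod_congr rfl fun p _ => pact_lin _ _ _ _

theorem equivariant_xi : Equivariant col (xi Q q t col : V → V → RatFun k V) := by
  intro σ hσ u v
  rw [xi, xi, map_mul, act_toRat, pact_tProd hσ, apply_ite (act k σ), map_div₀, act_toRat,
    act_toRat, pact_lin, pact_lin, map_one, hσ, hσ]

variable [DecidableEq V]

theorem spec_lin_of_ne (c d : kˣ) {u v w x : V} (hw : w ≠ u) (hx : x ≠ u) :
    Laurent.spec c u v (Laurent.lin d w x) = Laurent.lin d w x := by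
  rw [Laurent.lin, map_sub, map_smul, Laurent.spec_var_of_ne _ hw, Laurent.spec_var_of_ne _ hx]

theorem spec_tProd_of_ne (c : kˣ) {u v w x : V} (hw : w ≠ u) (hx : x ≠ u) :
    Laurent.spec c u v (tProd Q q t col w x) = tProd Q q t col w x := by
  rw [tProd, map_prod]
  exact Finset.prod_congr rfl fun p _ => spec_lin_of_ne _ _ hx hw

/-- The tool for cancelling denominators in wheel conditions: `y` must not vanish identically on any
of the hyperplanes `z_z = κ z_a`. Weights may repeat, which is why the statement is about products
of primes and not about distinct ones. -/
theorem tProd_dvd_of_dvd_mul {a z : V} (haz : z ≠ a) {x y : Laurent k V}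
    (hy : ∀ p ∈ arrows Q (col a) (col z), Laurent.spec (kap q t p) z a y ≠ 0)
    (h : tProd Q q t col a z ∣ x * y) : tProd Q q t col a z ∣ x :=
  prod_prime_dvd_of_dvd_mul _ _ (fun _ _ => Laurent.prime_lin _ haz)
    (fun p hp h' => hy p hp ((Laurent.lin_dvd_iff _ haz).1 h')) h

theorem prod_tProd_dvd {a : V} {U : Finset V} (ha : a ∉ U) {x : Laurent k V}
    (h : ∀ z ∈ U, tProd Q q t col a z ∣ x) : ∏ z ∈ U, tProd Q q t col a z ∣ x := by
  have hne : ∀ z ∈ U, z ≠ a := fun z hz h => ha (h ▸ hz)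
  exact prod_prod_prime_dvd U (fun z => arrows Q (col a) (col z))
    (fun z p => Laurent.lin (kap q t p) z a) (fun z hz p _ => Laurent.prime_lin _ (hne z hz))
    (fun z hz z' hz' hzz p _ p' _ => Laurent.not_lin_dvd_lin_of_ne _ _ (hne z hz) (hne z' hz')
      hzz.symm (hne z' hz')) h

/-- The products of linear forms attached to the variables of a nonempty set have no common zero. -/
theorem span_prod_tProd_eq_top {N : Subsemigroup kˣ} (hN : SmallIn N q t) {U : Finset V}
    (hU : U.Nonempty) :
    Ideal.span ((fun y => ∏ z ∈ U.erase y, tProd Q q t col y z) '' (U : Set V)) = ⊤ := by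
  by_contra hne
  obtain ⟨M, hM, hle⟩ := Ideal.exists_le_maximal _ hne
  -- In the residue field of `M` each variable `y` gets a successor `z` with `z_z = κ z_y` and `κ ∈
  -- N`.
  have key : ∀ y : U, ∃ (z : U) (κ : kˣ), κ ∈ N ∧ Laurent.lin κ (z : V) (y : V) ∈ M := by
    rintro ⟨y, hy⟩
    have h1 : ∏ z ∈ U.erase y, tProd Q q t col y z ∈ M :=
      hle (Ideal.subset_span ⟨y, hy, rfl⟩)
    obtain ⟨z, hz, h2⟩ := (hM.isPrime.prod_mem_iff).1 h1
    obtain ⟨p, -, h3⟩ := (hM.isPrime.prod_mem_iff).1 h2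
    exact ⟨⟨z, Finset.mem_of_mem_erase hz⟩, _, hN.kap_mem p, h3⟩
  choose nxt κ hκ hmem using key
  let π := Ideal.Quotient.mkₐ k M
  have hstep : ∀ y : U, π (Laurent.var k (nxt y : V)) = (κ y : k) • π (Laurent.var k (y : V)) := by
    intro y
    rw [← map_smul]
    exact Ideal.Quotient.eq.2 (hmem y)
  have hiter : ∀ (n : ℕ) (y : U), ∃ c ∈ N,
      π (Laurent.var k (nxt^[n + 1] y : V)) = (c : k) • π (Laurent.var k (y : V)) := by
    intro n
    induction n with
    | zero => exact fun y => ⟨κ y, hκ y, hstep y⟩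
    | succ n ih =>
      intro y
      obtain ⟨c, hc, h⟩ := ih (nxt y)
      refine ⟨c * κ y, N.mul_mem hc (hκ y), ?_⟩
      rw [Function.iterate_succ_apply, h, hstep, smul_smul, Units.val_mul]
  obtain ⟨y0, hy0⟩ := hU
  obtain ⟨i, j, hij, heq⟩ :=
    Finite.exists_ne_map_eq_of_infinite fun n : ℕ => nxt^[n] (⟨y0, hy0⟩ : U)
  wlog hlt : i < j generalizing i j
  · exact this j i hij.symm heq.symm (by omega)
  obtain ⟨n, rfl⟩ := Nat.exists_eq_add_of_lt hlt
  obtain ⟨c, hc, h⟩ := hiter n (nxt^[i] ⟨y0, hy0⟩)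
  rw [← Function.iterate_add_apply, show n + 1 + i = i + n + 1 by ring] at h
  rw [← heq] at h
  set y := nxt^[i] ⟨y0, hy0⟩
  -- The successor map on the finite set `U` has a cycle. Going around it multiplies `z_y` by some
  -- `c ∈ N`, so `(c - 1) z_y ∈ M`; as `c ≠ 1` this is a unit.
  have h1 : π (algebraMap k _ ((c : k) - 1) * Laurent.var k (y : V)) = 0 := by
    rw [← Algebra.smul_def, map_smul, sub_smul, ← h, one_smul, sub_self]
  have h2 : algebraMap k _ ((c : k) - 1) * Laurent.var k (y : V) ∈ M :=
    Ideal.Quotient.eq_zero_iff_mem.1 h1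
  refine hM.ne_top (Ideal.eq_top_of_isUnit_mem _ h2 (IsUnit.mul (IsUnit.map _ ?_)
    (Laurent.isUnit_var _)))
  refine (sub_ne_zero.2 fun h3 => ?_).isUnit
  exact hN.ne_one hc (Units.ext h3)

end Weights

/-! ### Three-variable wheel conditions -/

section Wheel

variable {I E : Type*} [DecidableEq I] [Fintype E] {k : Type*} [Field k]
variable (Q : EdgeQuiver I E) (q : kˣ) (t : E → kˣ)
variable {V : Type*} [Fintype V] [DecidableEq V] (col : V → I)

/-- Laurent polynomials that are symmetric and satisfy the three-variable wheel conditions in the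
variables from `U`. -/
structure IsWheel (U : Finset V) (R : Laurent k V) : Prop where
  pact_eq : ∀ σ ∈ colPerm col U, pact k σ R = R
  dvd : ∀ a ∈ U, ∀ b ∈ U, a ≠ b → col a = col b → ∀ z ∈ U, z ≠ a → z ≠ b →
    tProd Q q t col a z ∣ Laurent.spec q b a R

/-- A variant of `IsWheel` with a further variable `y`, which may serve as the last one of a
two-term chain. -/
structure IsWheelAt (U : Finset V) (y : V) (R : Laurent k V) : Prop where
  pact_eq : ∀ σ ∈ colPerm col U, pact k σ R = R
  dvd : ∀ a ∈ U, ∀ b ∈ insert y U, a ≠ b → col a = col b → ∀ z ∈ U, z ≠ a → z ≠ b →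
    tProd Q q t col a z ∣ Laurent.spec q b a R

variable {Q q t col} {U : Finset V} {y : V}

/-- Entry point of the chain argument: `y` leaves `U`. The multiplier has to be invariant only under
permutations fixing `y`, so powers of `z_y` are allowed. -/
theorem IsWheel.isWheelAt {R : Laurent k V} (hR : IsWheel Q q t col U R) (hy : y ∈ U)
    {f : Laurent k V} (hf : ∀ σ ∈ colPerm col (U.erase y), pact k σ f = f) :
    IsWheelAt Q q t col (U.erase y) y (f * R) where
  pact_eq σ hσ := by rw [map_mul, hf σ hσ, hR.pact_eq σ (colPerm_mono (Finset.erase_subset _ _) hσ)]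
  dvd a ha b hb hab hcol z hz hza hzb := by
    rw [Finset.insert_erase hy] at hb
    rw [map_mul]
    exact (hR.dvd a (Finset.mem_of_mem_erase ha) b hb hab hcol z (Finset.mem_of_mem_erase hz)
      hza hzb).mul_left _

theorem IsWheelAt.mul {R : Laurent k V} (hR : IsWheelAt Q q t col U y R)
    {f : Laurent k V} (hf : ∀ σ ∈ colPerm col U, pact k σ f = f) :
    IsWheelAt Q q t col U y (f * R) where
  pact_eq σ hσ := by rw [map_mul, hf σ hσ, hR.pact_eq σ hσ]
  dvd a ha b hb hab hcol z hz hza hzb := by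
    rw [map_mul]
    exact (hR.dvd a ha b hb hab hcol z hz hza hzb).mul_left _

/-- The substitution `z_b ↦ q z_a`, `z_z ↦ κ z_a` on a variable. -/
theorem spec_spec_var (c κ : kˣ) {a b z : V} (hzb : z ≠ b) (hza : z ≠ a) (w : V) :
    Laurent.spec κ z a (Laurent.spec c b a (Laurent.var k w)) =
      ((if w = b then c else if w = z then κ else 1 : kˣ) : k) •
        Laurent.var k (if w = b ∨ w = z then a else w) := by
  by_cases hb : w = b
  · subst hb
    rw [Laurent.spec_var_self, map_smul, Laurent.spec_var_of_ne _ hza.symm]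
    simp
  · rw [Laurent.spec_var_of_ne _ hb]
    by_cases hz : w = z
    · subst hz
      rw [Laurent.spec_var_self]
      simp [hb]
    · rw [Laurent.spec_var_of_ne _ hz]
      simp [hb, hz]

/-- The three variables `a`, `b`, `z` become distinct multiples `1`, `c`, `κ` of `z_a`, so no
diagonal contains the locus of a wheel condition. Vandermonde factors can therefore be cancelled
from such conditions. -/
theorem spec_spec_lin_one_ne_zero {c κ : kˣ} (hc : c ≠ 1) (hκ : κ ≠ 1) (hcκ : c ≠ κ) {a b z : V}
    (hzb : z ≠ b) (hza : z ≠ a) {v w : V} (hvw : v ≠ w) :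
    Laurent.spec κ z a (Laurent.spec c b a (Laurent.lin (k := k) 1 v w)) ≠ 0 := by
  rw [Laurent.lin, map_sub, map_sub, Units.val_one, one_smul, spec_spec_var c κ hzb hza,
    spec_spec_var c κ hzb hza, sub_ne_zero, Ne, Laurent.smul_var_eq_smul_var (Units.ne_zero _),
    Units.val_inj]
  grind

/-- Substitutions for different variables, the second of which is replaced by multiples of
a variable `a`. -/
theorem exists_spec_comp (c : kˣ) {a b y x : V} (hyb : y ≠ b) (hya : y ≠ a) (hxy : x ≠ y) :
    ∃ (d : kˣ) (w : V), ∀ R : Laurent k V,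
      Laurent.spec c b a (Laurent.spec c y x R) =
        Laurent.spec d y w (Laurent.spec c b a R) := by
  by_cases hx : x = b
  · subst hx
    refine ⟨c * c, a, DFunLike.congr_fun (f := (Laurent.spec c x a).comp (Laurent.spec c y x))
      (g := (Laurent.spec (c * c) y a).comp (Laurent.spec c x a))
      (Laurent.algHom_ext fun w => ?_)⟩
    simp only [AlgHom.comp_apply]
    by_cases h1 : w = y
    · subst h1
      rw [Laurent.spec_var_self, map_smul, Laurent.spec_var_self, Laurent.spec_var_of_ne _ hyb,
        Laurent.spec_var_self, smul_smul, Units.val_mul]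
    · rw [Laurent.spec_var_of_ne _ h1]
      by_cases h2 : w = x
      · subst h2
        rw [Laurent.spec_var_self, map_smul, Laurent.spec_var_of_ne _ hya.symm]
      · rw [Laurent.spec_var_of_ne _ h2, Laurent.spec_var_of_ne _ h1]
  · refine ⟨c, x, DFunLike.congr_fun (f := (Laurent.spec c b a).comp (Laurent.spec c y x))
      (g := (Laurent.spec c y x).comp (Laurent.spec c b a)) (Laurent.algHom_ext fun w => ?_)⟩
    simp only [AlgHom.comp_apply]
    by_cases h1 : w = y
    · subst h1
      rw [Laurent.spec_var_self, map_smul, Laurent.spec_var_of_ne _ hx,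
        Laurent.spec_var_of_ne _ hyb, Laurent.spec_var_self]
    · rw [Laurent.spec_var_of_ne _ h1]
      by_cases h2 : w = b
      · subst h2
        rw [Laurent.spec_var_self, map_smul, Laurent.spec_var_of_ne _ hya.symm]
      · rw [Laurent.spec_var_of_ne _ h2, Laurent.spec_var_of_ne _ h1]

theorem spec_spec_self (c d : kˣ) {y x w : V} (hxy : x ≠ y) (R : Laurent k V) :
    Laurent.spec d y w (Laurent.spec c y x R) = Laurent.spec c y x R := by
  refine DFunLike.congr_fun (f := (Laurent.spec d y w).comp (Laurent.spec c y x))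
    (Laurent.algHom_ext fun v => ?_) R
  simp only [AlgHom.comp_apply]
  by_cases h1 : v = y
  · subst h1
    rw [Laurent.spec_var_self, map_smul, Laurent.spec_var_of_ne _ hxy]
  · rw [Laurent.spec_var_of_ne _ h1, Laurent.spec_var_of_ne _ h1]

theorem prod_tProd_erase_invariant {c : V} {σ : Equiv.Perm V}
    (hσ : σ ∈ colPerm col (U.erase c)) :
    pact k σ (∏ z ∈ U.erase c, tProd Q q t col c z) = ∏ z ∈ U.erase c, tProd Q q t col c z := by
  have h := mem_colPerm.1 hσ
  rw [map_prod, Finset.prod_congr rfl fun z _ => pact_tProd h.1 c z, h.2 c (by simp),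
    prod_comp_colPerm hσ fun z => tProd Q q t col c z]

/-- Shortening of a chain. -/
theorem IsWheelAt.exists_spec_eq {N : Subsemigroup kˣ} (hN : SmallIn N q t) {R : Laurent k V}
    (hR : IsWheelAt Q q t col U y R) (hy : y ∉ U) {c : V} (hc : c ∈ U) (hcy : col c = col y) :
    ∃ R', Laurent.spec q y c R = (∏ z ∈ U.erase c, tProd Q q t col c z) * R' ∧
      IsWheelAt Q q t col (U.erase c) c R' := by
  have hne : c ≠ y := fun h => hy (h ▸ hc)
  -- The wheel conditions with `a = c`, `b = y` give the factor of each `z` separately; factors for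
  -- different `z` are coprime.
  obtain ⟨R', hR'⟩ : ∏ z ∈ U.erase c, tProd Q q t col c z ∣ Laurent.spec q y c R := by
    refine prod_tProd_dvd (by simp) fun z hz => ?_
    rw [Finset.mem_erase] at hz
    exact hR.dvd c hc y (by simp) hne hcy z hz.2 hz.1 fun h => hy (h ▸ hz.2)
  have hB : ∏ z ∈ U.erase c, tProd Q q t col c z ≠ 0 :=
    Finset.prod_ne_zero_iff.2 fun z hz => tProd_ne_zero (Finset.ne_of_mem_erase hz).symm
  refine ⟨R', hR', fun σ hσ => ?_, fun a ha b hb hab hcol z hz hza hzb => ?_⟩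
  · apply mul_left_cancel₀ hB
    have h := mem_colPerm.1 hσ
    rw [← hR']
    conv_lhs => rw [← prod_tProd_erase_invariant hσ]
    rw [← map_mul, ← hR', pact_spec, h.2 c (by simp), h.2 y fun h' => hy (Finset.mem_of_mem_erase h'),
      hR.pact_eq σ (colPerm_mono (Finset.erase_subset _ _) hσ)]
  · rw [Finset.insert_erase hc] at hb
    rw [Finset.mem_erase] at ha hz
    have hyb : y ≠ b := fun h => hy (h ▸ hb)
    have hya : y ≠ a := fun h => hy (h ▸ ha.2)
    have hyz : z ≠ y := fun h => hy (h ▸ hz.2)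
    obtain ⟨d, w, hdw⟩ := exists_spec_comp (k := k) q hyb hya hne
    -- The two substitutions can be exchanged, after changing the target of `z_y`, and a
    -- substitution for `z_y` does not touch the linear forms in `z_z` and `z_a`.
    have h1 : tProd Q q t col a z ∣ Laurent.spec q b a (Laurent.spec q y c R) := by
      rw [hdw, ← spec_tProd_of_ne d (v := w) hya.symm hyz]
      exact map_dvd _ (hR.dvd a ha.2 b (by simp [hb]) hab hcol z hz.2 hza hzb)
    rw [hR', map_mul, mul_comm] at h1
    refine tProd_dvd_of_dvd_mul hza (fun p hp => ?_) h1
    rw [map_prod, map_prod, Finset.prod_ne_zero_iff]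
    intro v hv
    rw [tProd, map_prod, map_prod, Finset.prod_ne_zero_iff]
    intro p' hp'
    rw [Finset.mem_erase] at hv
    rw [Laurent.lin, map_sub, map_sub, map_smul, map_smul, spec_spec_var q _ hzb hza,
      spec_spec_var q _ hzb hza, sub_ne_zero, smul_smul, Ne,
      Laurent.smul_var_eq_smul_var (Units.ne_zero _), ← Units.val_mul, Units.val_inj]
    -- A factor `z_v - κ' z_c` could vanish at `z_b = q z_a`, `z_z = κ z_a` only for `c = b` and `v
    -- ∈ {a, z}`, which would force `q κ' = 1` or `q κ' = κ`.
    have e1 := hN.pow_mul_kap_ne_kap 0 p' p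
    have e2 : q * kap q t p' ≠ 1 := hN.ne_one (N.mul_mem hN.q_mem (hN.kap_mem p'))
    rw [zero_add, pow_one] at e1
    rintro ⟨h2, h3⟩
    have h4 : c ≠ z := hz.1.symm
    have h5 : c ≠ a := ha.1.symm
    by_cases hcb : c = b
    · subst hcb
      simp only [true_or, if_true, if_neg hv.1] at h2 h3
      rw [mul_comm] at h3
      by_cases hvz : v = z
      · rw [if_pos hvz] at h3; exact e1 h3.symm
      · rw [if_neg hvz] at h3; exact e2 h3.symm
    · simp only [hcb, h4, or_self, if_false] at h2
      split_ifs at h2 with h6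
      · exact h5 h2.symm
      · exact hv.1 h2

end Wheel

/-! ### Division with remainder by interpolation -/

section Division

variable {I E : Type*} [DecidableEq I] [Fintype E] {k : Type*} [Field k]
variable {Q : EdgeQuiver I E} {q : kˣ} {t : E → kˣ}
variable {V : Type*} [Fintype V] [DecidableEq V] {col : V → I} {U : Finset V} {y : V}

theorem spec_lin_self (c : kˣ) {y x v : V} (hv : v ≠ y) :
    Laurent.spec c y x (Laurent.lin c y v) = algebraMap k _ (c : k) * Laurent.lin 1 x v := by
  rw [Laurent.lin, map_sub, map_smul, Laurent.spec_var_self, Laurent.spec_var_of_ne _ hv,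
    ← Algebra.smul_def, Laurent.lin, Units.val_one, one_smul, smul_sub]

/-- The factor of `z_a - z_b` of a Vandermonde determinant for each colour. -/
def diag (k : Type*) [Field k] (col : V → I) (a b : V) : Laurent k V :=
  if col a = col b then Laurent.lin 1 a b else 1

theorem lin_dvd_pairProd_diag {L : List V} (hL : L.Nodup) {a b : V} (ha : a ∈ L) (hb : b ∈ L)
    (hab : a ≠ b) (hcol : col a = col b) : Laurent.lin 1 a b ∣ pairProd (diag k col) L := by
  rw [pairProd_eq_prod_pairs hL]
  rcases mem_pairs_or ha hb hab with h | h
  · refine dvd_trans ?_ (Finset.dvd_prod_of_mem _ h)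
    simp [diag, hcol]
  · refine dvd_trans ?_ (Finset.dvd_prod_of_mem _ h)
    simp only [diag, hcol, if_true]
    rw [Laurent.lin_one_swap a b, dvd_neg]

theorem prod_lin_dvd_pairProd_diag {L : List V} (hL : L.Nodup) {c : V} (hc : c ∈ L) {S : Finset V}
    (hS : ∀ v ∈ S, v ∈ L ∧ v ≠ c ∧ col v = col c) :
    ∏ v ∈ S, Laurent.lin 1 c v ∣ pairProd (diag k col) L := by
  refine prod_prime_dvd _ _ (fun v hv => Laurent.prime_lin _ (hS v hv).2.1.symm)
    (fun v hv v' hv' hvv => ?_)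
    fun v hv => lin_dvd_pairProd_diag hL hc (hS v hv).1 (hS v hv).2.1.symm (hS v hv).2.2.symm
  exact Laurent.not_lin_dvd_lin_of_ne' _ _ (hS v hv).2.1.symm (hS v' hv').2.1.symm
    (hS v' hv').2.1 hvv.symm

theorem pairProd_diag_ne_zero {L : List V} (hL : L.Nodup) : pairProd (diag k col) L ≠ 0 := by
  rw [pairProd_eq_prod_pairs hL, Finset.prod_ne_zero_iff]
  intro p hp
  rw [diag]
  split_ifs
  · exact Laurent.lin_ne_zero _ (ne_and_swap_notMem_pairs hL hp).1
  · exact one_ne_zero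

/-- The numerator of the interpolating factors. -/
def interpNum (q : kˣ) (col : V → I) (U : Finset V) (y : V) (Φ : V → Laurent k V) (c : V) :
    Laurent k V :=
  (∏ v ∈ (U.filter fun v => col v = col y).erase c, Laurent.lin q y v) * Φ c

theorem spec_interpNum (hy : y ∉ U) (Φ : V → Laurent k V) (c : V) :
    Laurent.spec q y c (interpNum q col U y Φ c) =
      (∏ v ∈ (U.filter fun v => col v = col y).erase c,
        algebraMap k _ (q : k) * Laurent.lin 1 c v) * Laurent.spec q y c (Φ c) := by
  rw [interpNum, map_mul, map_prod]
  congr 1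
  refine Finset.prod_congr rfl fun v hv => spec_lin_self q ?_
  rintro rfl
  exact hy (Finset.mem_filter.1 (Finset.mem_of_mem_erase hv)).1

theorem pact_interpNum (hy : y ∉ U) {Φ : V → Laurent k V}
    (hΦ : ∀ σ ∈ colPerm col U, ∀ c, pact k σ (Φ c) = Φ (σ c)) {σ : Equiv.Perm V}
    (hσ : σ ∈ colPerm col U) (c : V) :
    pact k σ (interpNum q col U y Φ c) = interpNum q col U y Φ (σ c) := by
  have h := mem_colPerm.1 hσ
  rw [interpNum, map_mul, map_prod, hΦ σ hσ, interpNum]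
  congr 1
  refine Finset.prod_equiv σ (fun v => ?_) fun v _ => by rw [pact_lin, h.2 y hy]
  simp [h.1, apply_mem_of_mem_colPerm hσ]

theorem sum_filter_comp_colPerm {M : Type*} [AddCommMonoid M] {σ : Equiv.Perm V}
    (hσ : σ ∈ colPerm col U) (i : I) (f : V → M) :
    ∑ c ∈ U.filter (fun v => col v = i), f (σ c) = ∑ c ∈ U.filter (fun v => col v = i), f c := by
  have h := mem_colPerm.1 hσ
  refine Finset.sum_equiv σ (fun v => ?_) fun v _ => rfl
  simp [h.1, apply_mem_of_mem_colPerm hσ]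

theorem prod_filter_comp_colPerm {M : Type*} [CommMonoid M] {σ : Equiv.Perm V}
    (hσ : σ ∈ colPerm col U) (i : I) (f : V → M) :
    ∏ c ∈ U.filter (fun v => col v = i), f (σ c) = ∏ c ∈ U.filter (fun v => col v = i), f c := by
  have h := mem_colPerm.1 hσ
  refine Finset.prod_equiv σ (fun v => ?_) fun v _ => rfl
  simp [h.1, apply_mem_of_mem_colPerm hσ]

/-- Division with remainder by `∏ (z_y - q z_v)`; the remainder is found by interpolation at the
points `z_y = q z_c`. -/
theorem IsWheelAt.exists_division [CharZero k] {N : Subsemigroup kˣ} (hN : SmallIn N q t)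
    {g : Laurent k V} (hg : IsWheelAt Q q t col U y g) (hy : y ∉ U) (Φ : V → Laurent k V)
    (hΦ : ∀ σ ∈ colPerm col U, ∀ c, pact k σ (Φ c) = Φ (σ c))
    (hu : ∀ c ∈ U, col c = col y → IsUnit (Laurent.spec q y c (Φ c))) :
    ∃ h, IsWheel Q q t col U h ∧
      toRat k V g =
        toRat k V (∏ v ∈ U.filter (fun v => col v = col y), Laurent.lin q y v) * toRat k V h +
        ∑ c ∈ U.filter (fun v => col v = col y), toRat k V (Laurent.spec q y c g) *
          (toRat k V (interpNum q col U y Φ c) /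
            toRat k V (Laurent.spec q y c (interpNum q col U y Φ c))) := by
  set Uy := U.filter fun v => col v = col y with hUy
  set Ψ := interpNum q col U y Φ with hΨ
  set D := pairProd (diag k col) U.toList with hD
  have hmemU : ∀ {v}, v ∈ Uy → v ∈ U ∧ col v = col y := fun hv => Finset.mem_filter.1 hv
  have hne : ∀ {v}, v ∈ U → v ≠ y := fun hv h => hy (h ▸ hv)
  have hDnodup : U.toList.Nodup := U.nodup_toList
  have hD0 : D ≠ 0 := pairProd_diag_ne_zero hDnodup
  -- At `z_y = q z_c` the numerator becomes `∏ (z_c - z_v)` times a unit, so the Vandermonde product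
  -- `D` clears all denominators of the interpolation formula.
  have hdvd : ∀ c ∈ Uy, Laurent.spec q y c (Ψ c) ∣ D := by
    intro c hc
    rw [hΨ, spec_interpNum hy, Finset.prod_mul_distrib, Finset.prod_const]
    refine ((hu c (hmemU hc).1 (hmemU hc).2).mul_right_dvd).2 ?_
    refine ((((IsUnit.mk0 (q : k) q.ne_zero).map
      (algebraMap k (Laurent k V))).pow _).mul_left_dvd).2 ?_
    refine prod_lin_dvd_pairProd_diag hDnodup (by simpa using (hmemU hc).1) fun v hv => ?_
    rw [Finset.mem_erase] at hv
    exact ⟨by simpa using (hmemU hv.2).1, hv.1, (hmemU hv.2).2.trans (hmemU hc).2.symm⟩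
  have hΨ0 : ∀ c ∈ Uy, Laurent.spec q y c (Ψ c) ≠ 0 := fun c hc h => hD0 (by
    have := hdvd c hc
    rwa [h, zero_dvd_iff] at this)
  have hF : ∀ c, ∃ F : Laurent k V, c ∈ Uy → F * Laurent.spec q y c (Ψ c) = D * Ψ c := by
    intro c
    by_cases hc : c ∈ Uy
    · obtain ⟨G, hG⟩ := hdvd c hc
      exact ⟨G * Ψ c, fun _ => by rw [hG]; ring⟩
    · exact ⟨0, fun h => absurd h hc⟩
  choose F hF using hF
  have hFrat : ∀ c ∈ Uy, toRat k V D * (toRat k V (Ψ c) / toRat k V (Laurent.spec q y c (Ψ c))) =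
      toRat k V (F c) := by
    intro c hc
    rw [← mul_div_assoc, ← map_mul, ← hF c hc, map_mul, mul_div_assoc,
      div_self (toRat_ne_zero (hΨ0 c hc)), mul_one]
  set r : RatFun k V := toRat k V g - ∑ c ∈ Uy, toRat k V (Laurent.spec q y c g) *
    (toRat k V (Ψ c) / toRat k V (Laurent.spec q y c (Ψ c))) with hr
  have hDr : toRat k V D * r = toRat k V (D * g - ∑ c ∈ Uy, Laurent.spec q y c g * F c) := by
    rw [hr, mul_sub, Finset.mul_sum, map_sub, map_mul, map_sum]
    congr 1
    refine Finset.sum_congr rfl fun c hc => ?_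
    rw [map_mul, ← hFrat c hc]
    ring
  have hrinv : ∀ σ ∈ colPerm col U, act k σ r = r := by
    intro σ hσ
    have h := mem_colPerm.1 hσ
    rw [hr, map_sub, map_sum, act_toRat, hg.pact_eq σ hσ]
    congr 1
    conv_rhs => rw [hUy, ← sum_filter_comp_colPerm hσ]
    refine Finset.sum_congr rfl fun c _ => ?_
    rw [map_mul, map_div₀, act_toRat, act_toRat, act_toRat, pact_spec, pact_spec,
      hg.pact_eq σ hσ, hΨ, pact_interpNum hy hΦ hσ, h.2 y hy]
  -- The individual terms have poles on the diagonals, but these are simple and `r` is symmetric, so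
  -- they cancel.
  obtain ⟨r0, hr0⟩ : ∃ r0, r = toRat k V r0 := by
    refine exists_toRat_of_invariant (col := col) hDnodup (fun σ hσ => ?_) hDr
    rw [Finset.toList_toFinset] at hσ
    exact hrinv σ hσ
  have hDr0 : D * r0 = D * g - ∑ c ∈ Uy, Laurent.spec q y c g * F c := by
    apply toRat_injective
    rw [map_mul, ← hr0, hDr]
  have hspecD : ∀ v, Laurent.spec q y v D = D := by
    intro v
    rw [hD, map_pairProd]
    refine pairProd_congr fun a ha b hb => ?_
    rw [diag, apply_ite (Laurent.spec q y v), map_one, spec_lin_of_ne _ _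
      (hne (Finset.mem_toList.1 ha)) (hne (Finset.mem_toList.1 hb))]
  -- The Lagrange property: `F c / D` is `1` at `z_y = q z_c` and `0` at the other nodes. So `r0`
  -- vanishes at every node and is divisible by `∏ (z_y - q z_v)`.
  have hspecF : ∀ v ∈ Uy, ∀ c ∈ Uy, Laurent.spec q y v (F c) = if c = v then D else 0 := by
    intro v hv c hc
    have h1 := congrArg (Laurent.spec q y v) (hF c hc)
    rw [map_mul, map_mul, hspecD, spec_spec_self _ _ (hne (hmemU hc).1)] at h1
    split_ifs with hcv
    · subst hcv
      exact mul_right_cancel₀ (hΨ0 c hc) h1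
    · have h2 : Laurent.spec q y v (Ψ c) = 0 := by
        rw [hΨ, interpNum, map_mul, map_prod,
          Finset.prod_eq_zero (Finset.mem_erase.2 ⟨Ne.symm hcv, hv⟩)
            (Laurent.spec_lin q (hne (hmemU hv).1).symm), zero_mul]
      rw [h2, mul_zero] at h1
      exact (mul_eq_zero.1 h1).resolve_right (hΨ0 c hc)
  obtain ⟨h, hh⟩ : ∏ v ∈ Uy, Laurent.lin q y v ∣ r0 := by
    refine prod_prime_dvd _ _ (fun v hv => Laurent.prime_lin _ (hne (hmemU hv).1).symm)
      (fun v hv v' hv' hvv => Laurent.not_lin_dvd_lin_of_ne' _ _ (hne (hmemU hv).1).symm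
        (hne (hmemU hv').1).symm (hne (hmemU hv').1) hvv.symm) fun v hv => ?_
    rw [Laurent.lin_dvd_iff _ (hne (hmemU hv).1).symm]
    have h1 := congrArg (Laurent.spec q y v) hDr0
    rw [map_mul, map_sub, map_mul, map_sum, hspecD,
      Finset.sum_congr rfl fun c hc => by
        rw [map_mul, spec_spec_self _ _ (hne (hmemU hc).1), hspecF v hv c hc]] at h1
    simp only [mul_ite, mul_zero, Finset.sum_ite_eq', hv, if_true] at h1
    refine (mul_eq_zero.1 (h1.trans ?_)).resolve_left hD0
    ring
  have hN0 : ∏ v ∈ Uy, Laurent.lin q y v ≠ 0 :=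
    Finset.prod_ne_zero_iff.2 fun v hv => Laurent.lin_ne_zero _ (hne (hmemU hv).1).symm
  refine ⟨h, ⟨fun σ hσ => ?_, fun a ha b hb hab hcol z hz hza hzb => ?_⟩, ?_⟩
  · have h0 := mem_colPerm.1 hσ
    have h1 : pact k σ r0 = r0 := by
      apply toRat_injective
      rw [← act_toRat, ← hr0, hrinv σ hσ]
    have h2 : pact k σ (∏ v ∈ Uy, Laurent.lin q y v) = ∏ v ∈ Uy, Laurent.lin q y v := by
      rw [map_prod, Finset.prod_congr rfl fun v _ => pact_lin σ q y v, h0.2 y hy, hUy,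
        prod_filter_comp_colPerm hσ _ fun v => Laurent.lin q y v]
    rw [hh, map_mul, h2] at h1
    exact mul_left_cancel₀ hN0 h1
  -- `D r0` is a combination of `g` and of its specializations, which all satisfy the wheel
  -- condition. Then `D` and the divisor are cancelled, neither of them vanishing on the locus in
  -- question.
  · have h1 : tProd Q q t col a z ∣ Laurent.spec q b a (D * r0) := by
      rw [hDr0, map_sub, map_mul, map_sum]
      refine dvd_sub ((hg.dvd a ha b (by simp [hb]) hab hcol z hz hza hzb).mul_left _)
        (Finset.dvd_sum fun c hc => ?_)
      rw [map_mul]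
      refine Dvd.dvd.mul_right ?_ _
      obtain ⟨d, w, hdw⟩ := exists_spec_comp (k := k) q (hne hb).symm (hne ha).symm
        (hne (hmemU hc).1)
      rw [hdw, ← spec_tProd_of_ne d (v := w) (hne ha) (hne hz)]
      exact map_dvd _ (hg.dvd a ha b (by simp [hb]) hab hcol z hz hza hzb)
    rw [hh, ← mul_assoc, mul_comm, map_mul] at h1
    refine tProd_dvd_of_dvd_mul hza (fun p _ => ?_) h1
    rw [map_mul, map_mul, mul_ne_zero_iff]
    constructor
    · rw [hD, pairProd_eq_prod_pairs hDnodup, map_prod, map_prod, Finset.prod_ne_zero_iff]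
      intro x hx
      rw [diag]
      split_ifs
      · exact spec_spec_lin_one_ne_zero (hN.ne_one hN.q_mem) (hN.ne_one (hN.kap_mem p))
          (hN.q_ne_kap p) hzb hza (ne_and_swap_notMem_pairs hDnodup hx).1
      · simp
    · rw [map_prod, map_prod, Finset.prod_ne_zero_iff]
      intro v hv
      rw [Laurent.lin, map_sub, map_sub, map_smul, map_smul, spec_spec_var q _ hzb hza,
        spec_spec_var q _ hzb hza, sub_ne_zero, smul_smul, Ne,
        Laurent.smul_var_eq_smul_var (Units.ne_zero _)]
      rintro ⟨h2, -⟩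
      rw [if_neg (by simp [(hne hb).symm, (hne hz).symm])] at h2
      split_ifs at h2
      · exact hne ha h2.symm
      · exact hne (hmemU hv).1 h2.symm
  · rw [← map_mul, ← hh, ← hr0, hr, sub_add_cancel]

end Division

/-! ### Chains and their reduction to words -/

section Generation

variable {I E : Type*} [DecidableEq I] [Fintype E] {k : Type*} [Field k]
variable (Q : EdgeQuiver I E) (q : kˣ) (t : E → kˣ)
variable {V : Type*} (col : V → I)

/-- The numerator of `xi` for two variables of the same colour, at `λ z_y` and `z_s`. -/
def xiNum (l : kˣ) (y s : V) : Laurent k V :=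
  ((l : k) • Laurent.var k y - (q : k) • Laurent.var k s) *
    ∏ p ∈ arrows Q (col y) (col s), Laurent.lin (kap q t p * l) s y

/-- The product of `xiNum` over `λ = q⁻¹, …, q⁻ᵐ` and all `s` in a list. -/
def chainNum (m : ℕ) (y : V) (C : List V) : Laurent k V :=
  (C.map fun s => ∏ r ∈ Finset.range m, xiNum Q q t col (q⁻¹ ^ (r + 1)) y s).prod

variable {Q q t col}

theorem pact_xiNum {σ : Equiv.Perm V} (hσ : ∀ v, col (σ v) = col v) (l : kˣ) (y s : V) :
    pact k σ (xiNum Q q t col l y s) = xiNum Q q t col l (σ y) (σ s) := by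
  rw [xiNum, xiNum, map_mul, map_prod, map_sub, map_smul, map_smul, pact_var, pact_var, hσ, hσ]
  simp only [pact_lin]

theorem xiNum_one (y s : V) :
    xiNum Q q t col 1 y s = Laurent.lin q y s * tProd Q q t col y s := by
  simp [xiNum, tProd, Laurent.lin]

variable [DecidableEq V]

theorem spec_xiNum {y c s : V} (hs : s ≠ y) (hc : col c = col y) (l : kˣ) :
    Laurent.spec q y c (xiNum Q q t col l y s) = xiNum Q q t col (l * q) c s := by
  rw [xiNum, xiNum, map_mul, map_prod, map_sub, map_smul, map_smul, Laurent.spec_var_self,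
    Laurent.spec_var_of_ne _ hs, hc, smul_smul, Units.val_mul]
  congr 1
  refine Finset.prod_congr rfl fun p _ => ?_
  rw [Laurent.lin, Laurent.lin, map_sub, map_smul, Laurent.spec_var_self,
    Laurent.spec_var_of_ne _ hs, smul_smul, ← mul_assoc, Units.val_mul _ q]

theorem isUnit_smul_var {a : k} (ha : a ≠ 0) (v : V) : IsUnit (a • Laurent.var k v) := by
  rw [Algebra.smul_def]
  exact (ha.isUnit.map _).mul (Laurent.isUnit_var v)

/-- At `z_y = q z_c` every factor is a multiple of `z_c`, with scalar `q⁻ʳ - q²` or `q - κ q⁻ʳ`;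
these are nonzero since `q^(r+2) ≠ 1` and `q^(r+1) ≠ κ`. So normalizing the interpolating factors to
`1` at the nodes introduces no new denominators from the correction. -/
theorem isUnit_spec_xiNum {N : Subsemigroup kˣ} (hN : SmallIn N q t) {y c : V} (hc : c ≠ y)
    (r : ℕ) : IsUnit (Laurent.spec q y c (xiNum Q q t col (q⁻¹ ^ r) c y)) := by
  rw [xiNum, map_mul, map_prod]
  refine IsUnit.mul ?_ ?_
  · rw [map_sub, map_smul, map_smul, Laurent.spec_var_self, Laurent.spec_var_of_ne _ hc, smul_smul,
      ← sub_smul]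
    refine isUnit_smul_var (sub_ne_zero.2 fun h => ?_) c
    rw [← Units.val_mul, Units.val_inj, inv_pow, inv_eq_iff_mul_eq_one] at h
    refine hN.ne_one (hN.pow_mem (r + 1)) ?_
    rw [← h, pow_succ, pow_succ, mul_assoc]
  · refine Finset.prod_induction _ IsUnit (fun _ _ => IsUnit.mul) isUnit_one fun p _ => ?_
    rw [Laurent.lin, map_sub, map_smul, Laurent.spec_var_self, Laurent.spec_var_of_ne _ hc,
      ← sub_smul]
    refine isUnit_smul_var (sub_ne_zero.2 fun h => ?_) c
    rw [Units.val_inj, inv_pow, eq_mul_inv_iff_mul_eq] at h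
    exact hN.pow_ne_kap r p (by rw [← h, pow_succ, mul_comm])

/-- The exchange relation that moves `c` in front of `s`: at the price of `xiNum` at `λ = 1`, the
factor `ξ(s,c)` becomes `ξ(c,s)` times a Laurent polynomial. -/
theorem xi_mul_xiNum {s c : V} (h : col s = col c) (hsc : s ≠ c) :
    xi Q q t col s c * toRat k V (xiNum Q q t col 1 c s) =
      toRat k V (-(tProd Q q t col s c * Laurent.lin q s c)) * xi Q q t col c s := by
  have h1 : toRat k V (Laurent.lin 1 s c) ≠ 0 := toRat_ne_zero (Laurent.lin_ne_zero _ hsc)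
  rw [xi, xi, if_pos h, if_pos h.symm, xiNum_one, Laurent.lin_one_swap s c]
  simp only [map_neg, map_mul]
  field_simp

/-- The `r = 0` factor of the interpolating correction thus supplies `ξ(c,y)`, and its `z_y - z_c`
cancels a factor of `Δ_y`. -/
theorem xiNum_one_eq {c y : V} (h : col c = col y) (hcy : c ≠ y) :
    toRat k V (xiNum Q q t col 1 c y) =
      -(xi Q q t col c y * toRat k V (Laurent.lin 1 y c)) := by
  have h1 : toRat k V (Laurent.lin 1 c y) ≠ 0 := toRat_ne_zero (Laurent.lin_ne_zero _ hcy)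
  rw [xi, if_pos h, xiNum_one, Laurent.lin_one_swap c y]
  simp only [map_neg, map_mul]
  field_simp

/-- This explains why the division is by `∏ (z_y - q z_v)`: a multiple of it completes `B_y / Δ_y`
to the factors of a word starting with `y`. -/
theorem prod_xi (U : Finset V) (y : V) :
    ∏ z ∈ U, xi Q q t col y z = toRat k V (∏ z ∈ U, tProd Q q t col y z) *
      (toRat k V (∏ v ∈ U.filter (fun v => col v = col y), Laurent.lin q y v) /
        toRat k V (∏ v ∈ U.filter (fun v => col v = col y), Laurent.lin 1 y v)) := by
  simp only [xi, Finset.prod_mul_distrib, map_prod]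
  rw [← Finset.prod_div_distrib, Finset.prod_filter]
  simp only [eq_comm]

/-- Putting `z_y = q z_c` multiplies every `λ` by `q`. The factors with `λ = q⁻¹` turn into those
with `λ = 1`, needed to move `c` in front of the chain, and the others form the same product for `c`
with one power of `q` fewer. A supply of one power per free variable therefore lasts for the whole
recursion. -/
theorem spec_chainNum {y c : V} {C : List V} (hy : y ∉ C) (hc : col c = col y) (m : ℕ) :
    Laurent.spec q y c (chainNum Q q t col (m + 1) y C) =
      chainNum Q q t col m c C * (C.map fun s => xiNum Q q t col 1 c s).prod := by
  rw [chainNum, map_list_prod, List.map_map, chainNum, ← List.prod_map_mul]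
  congr 1
  refine List.map_congr_left fun s hs => ?_
  have hsy : s ≠ y := fun h => hy (h ▸ hs)
  rw [Function.comp_apply, map_prod, Finset.prod_congr rfl fun r _ => spec_xiNum hsy hc _]
  have : ∀ r : ℕ, q⁻¹ ^ (r + 1) * q = q⁻¹ ^ r := fun r => by
    rw [pow_succ, inv_mul_cancel_right]
  simp only [this]
  rw [Finset.prod_range_succ', pow_zero]

variable [Fintype V] {U U' : Finset V}

theorem pact_chainNum {σ : Equiv.Perm V} (hσ : σ ∈ colPerm col U) {y : V} (hy : y ∉ U) {C : List V}
    (hC : ∀ s ∈ C, s ∉ U) (m : ℕ) :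
    pact k σ (chainNum Q q t col m y C) = chainNum Q q t col m y C := by
  have h := mem_colPerm.1 hσ
  rw [chainNum, map_list_prod, List.map_map]
  congr 1
  refine List.map_congr_left fun s hs => ?_
  rw [Function.comp_apply, map_prod]
  exact Finset.prod_congr rfl fun r _ => by rw [pact_xiNum h.1, h.2 y hy, h.2 s (hC s hs)]

/-- The rational function attached to the chain `C`, its next element `y` and the remaining
variables `U'`. -/
def chainTerm (Q : EdgeQuiver I E) (q : kˣ) (t : E → kˣ) (col : V → I) (U' : Finset V) (C : List V)
    (y : V) (f h : Laurent k V) : RatFun k V :=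
  toRat k V f * pairProd (xi Q q t col) (y :: C) *
    (C.map fun s => ∏ z ∈ U', xi Q q t col s z).prod *
    (toRat k V (h * chainNum Q q t col U'.card y C * ∏ z ∈ U', tProd Q q t col y z) /
      toRat k V (∏ v ∈ U'.filter (fun v => col v = col y), Laurent.lin 1 y v))

/-- The field identity behind `exists_chainTerm_eq`: `hX` reorders `c` past the old chain, `hφ` uses
the `r = 0` factor of the correction, and `u` inverts the unit `w` left over from normalizing the
interpolating factor. -/
theorem chainTerm_aux {F : Type*} [Field F]
    {a X Xsc Y Hm P B h Nq G φ w Δ t B' l Δ' p u x Xcs : F}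
    (hX : Xsc * P = p * Xcs) (hφ : φ = -(x * l)) (hu : u * w = 1)
    (hl : l ≠ 0) (hΔ : Δ ≠ 0) (hΔ' : Δ' ≠ 0) :
    a * X * (Xsc * Y) * ((Hm * P) * (B * h) * ((Nq * (G * φ)) / (Δ * w)) * (t * B') / (l * Δ')) =
      (a * p * -t * u) * ((x * Xcs) * X) * ((B' * (Nq / Δ')) * Y) * (h * (G * Hm) * B / Δ) := by
  have hw : w ≠ 0 := right_ne_zero_of_mul_eq_one hu
  obtain rfl : u = w⁻¹ := eq_inv_of_mul_eq_one_left hu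
  subst hφ
  field_simp
  linear_combination (-(a * X * Y * Hm * B * h * Nq * G * x * t * B')) * hX

/-- The correction of the interpolating factors, which equals `1` at `z_y = q z_c` up to a unit. -/
def interpCorr (Q : EdgeQuiver I E) (q : kˣ) (t : E → kˣ) (col : V → I) (m : ℕ) (y c : V) :
    Laurent k V :=
  ∏ r ∈ Finset.range m, xiNum Q q t col (q⁻¹ ^ r) c y

/-- Each interpolation term of the remainder is again a chain term, with `y` joined to the chain and
`c` as next element. The factors of `interpCorr` with `r ≥ 1` are those which `chainNum` requires
for the new chain member `y`; the factor with `r = 0` creates `ξ(c,y)`. -/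
theorem exists_chainTerm_eq {N : Subsemigroup kˣ} (hN : SmallIn N q t) {C : List V} {y c : V}
    (hc : c ∈ U') (hcy : col c = col y) (hy : y ∉ U') (hyC : y ∉ C)
    (hCU : ∀ s ∈ C, s ∉ U') (hcol : ∀ s ∈ C, col s = col y) {f h h' : Laurent k V}
    (hf : ∀ σ ∈ colPerm col U', pact k σ f = f)
    (hh : Laurent.spec q y c h = (∏ z ∈ U'.erase c, tProd Q q t col c z) * h') :
    ∃ f', (∀ σ ∈ colPerm col (U'.erase c), pact k σ f' = f') ∧
      toRat k V f * pairProd (xi Q q t col) (y :: C) *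
        (C.map fun s => ∏ z ∈ U', xi Q q t col s z).prod *
        (toRat k V (Laurent.spec q y c (chainNum Q q t col U'.card y C * h)) *
          (toRat k V (interpNum q col U' y (interpCorr Q q t col U'.card y) c) /
            toRat k V (Laurent.spec q y c
              (interpNum q col U' y (interpCorr Q q t col U'.card y) c))) *
          toRat k V (∏ z ∈ U', tProd Q q t col y z) /
          toRat k V (∏ v ∈ U'.filter (fun v => col v = col y), Laurent.lin 1 y v)) =
      chainTerm Q q t col (U'.erase c) (y :: C) c f' h' := by
  have hne : ∀ {v}, v ∈ U' → v ≠ y := fun hv h => hy (h ▸ hv)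
  obtain ⟨m, hm⟩ : ∃ m, U'.card = m + 1 :=
    Nat.exists_eq_succ_of_ne_zero (Finset.card_ne_zero_of_mem hc)
  have hm' : (U'.erase c).card = m := by rw [Finset.card_erase_of_mem hc, hm]; rfl
  have hfil : (U'.erase c).filter (fun v => col v = col c) =
      (U'.filter fun v => col v = col y).erase c := by
    rw [hcy, Finset.filter_erase]
  set Uy := (U'.filter fun v => col v = col y).erase c with hUy
  have hmem : ∀ {v}, v ∈ Uy → v ∈ U' := fun hv =>
    (Finset.mem_filter.1 (Finset.mem_of_mem_erase hv)).1
  set w : Laurent k V := (∏ v ∈ Uy, algebraMap k (Laurent k V) (q : k)) *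
    Laurent.spec q y c (interpCorr Q q t col U'.card y c) with hw
  have hwu : IsUnit w := by
    refine IsUnit.mul ?_ ?_
    · rw [Finset.prod_const]
      exact ((q.ne_zero.isUnit).map _).pow _
    · rw [interpCorr, map_prod]
      exact Finset.prod_induction _ IsUnit (fun _ _ => IsUnit.mul) isUnit_one fun r _ =>
        isUnit_spec_xiNum hN (hne hc) r
  obtain ⟨u, hu⟩ := hwu.exists_left_inv
  have hfix : ∀ σ ∈ colPerm col (U'.erase c), σ c = c ∧ σ y = y ∧ ∀ s ∈ C, σ s = s := by
    intro σ hσ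
    have h := mem_colPerm.1 hσ
    exact ⟨h.2 c (by simp), h.2 y fun h' => hy (Finset.mem_of_mem_erase h'),
      fun s hs => h.2 s fun h' => hCU s hs (Finset.mem_of_mem_erase h')⟩
  have hspecΨ : Laurent.spec q y c (interpNum q col U' y (interpCorr Q q t col U'.card y) c) =
      (∏ v ∈ Uy, Laurent.lin 1 c v) * w := by
    rw [spec_interpNum hy, Finset.prod_mul_distrib, hw]
    ring
  -- The new polynomial collects the by-products: those of moving `c` past `C`, the factor of `B_y`
  -- belonging to `c`, the sign from `xiNum_one_eq`, and the inverse of the unit `w`.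
  refine ⟨f * (C.map fun s => -(tProd Q q t col s c * Laurent.lin q s c)).prod *
    -(tProd Q q t col y c) * u, fun σ hσ => ?_, ?_⟩
  · have h := mem_colPerm.1 hσ
    obtain ⟨h1, h2, h3⟩ := hfix σ hσ
    have hpw : pact k σ w = w := by
      rw [hw, map_mul, map_prod, pact_spec, h1, h2, interpCorr, map_prod]
      simp only [pact_xiNum h.1, h1, h2, AlgHom.commutes]
    have hpu : pact k σ u = u := by
      have h4 := congrArg (pact k σ) hu
      rw [map_mul, hpw, map_one, ← hu] at h4
      exact mul_right_cancel₀ hwu.ne_zero h4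
    rw [map_mul, map_mul, map_mul, hf σ (colPerm_mono (Finset.erase_subset _ _) hσ), hpu, map_neg,
      pact_tProd h.1, h1, h2, map_list_prod, List.map_map]
    congr 4
    refine List.map_congr_left fun s hs => ?_
    rw [Function.comp_apply, map_neg, map_mul, pact_tProd h.1, pact_lin, h1, h3 s hs]
  · have hl : Laurent.lin (k := k) 1 y c ≠ 0 := Laurent.lin_ne_zero _ (hne hc).symm
    have hΔ : ∏ v ∈ Uy, Laurent.lin (k := k) 1 c v ≠ 0 :=
      Finset.prod_ne_zero_iff.2 fun v hv => Laurent.lin_ne_zero _ (Finset.ne_of_mem_erase hv).symm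
    have hΔ' : ∏ v ∈ Uy, Laurent.lin (k := k) 1 y v ≠ 0 :=
      Finset.prod_ne_zero_iff.2 fun v hv => Laurent.lin_ne_zero _ (hne (hmem hv)).symm
    have hcUy : c ∈ U'.filter fun v => col v = col y := Finset.mem_filter.2 ⟨hc, hcy⟩
    have hX : (C.map fun s => xi Q q t col s c).prod *
        toRat k V (C.map fun s => xiNum Q q t col 1 c s).prod =
        toRat k V (C.map fun s => -(tProd Q q t col s c * Laurent.lin q s c)).prod *
          (C.map fun s => xi Q q t col c s).prod := by
      rw [map_list_prod, map_list_prod, List.map_map, List.map_map, ← List.prod_map_mul,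
        ← List.prod_map_mul]
      congr 1
      refine List.map_congr_left fun s hs => ?_
      exact xi_mul_xiNum ((hcol s hs).trans hcy.symm) fun h => hCU s hs (h ▸ hc)
    have key := chainTerm_aux (a := toRat k V f) (X := pairProd (xi Q q t col) (y :: C))
      (Y := (C.map fun s => ∏ z ∈ U'.erase c, xi Q q t col s z).prod)
      (Hm := toRat k V (chainNum Q q t col m c C))
      (B := toRat k V (∏ z ∈ U'.erase c, tProd Q q t col c z)) (h := toRat k V h')
      (Nq := toRat k V (∏ v ∈ Uy, Laurent.lin q y v))
      (G := toRat k V (∏ r ∈ Finset.range m, xiNum Q q t col (q⁻¹ ^ (r + 1)) c y))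
      (t := toRat k V (tProd Q q t col y c))
      (B' := toRat k V (∏ z ∈ U'.erase c, tProd Q q t col y z))
      (u := toRat k V u) (w := toRat k V w) hX (xiNum_one_eq (Q := Q) (q := q) (t := t) hcy (hne hc))
      (by rw [← map_mul, hu, map_one])
      (toRat_ne_zero hl) (toRat_ne_zero hΔ) (toRat_ne_zero hΔ')
    have e1 : (C.map fun s => ∏ z ∈ U', xi Q q t col s z).prod =
        (C.map fun s => xi Q q t col s c).prod *
          (C.map fun s => ∏ z ∈ U'.erase c, xi Q q t col s z).prod := by
      rw [← List.prod_map_mul]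
      simp only [Finset.mul_prod_erase U' _ hc]
    have e2 : interpNum q col U' y (interpCorr Q q t col U'.card y) c =
        (∏ v ∈ Uy, Laurent.lin q y v) *
          ((∏ r ∈ Finset.range m, xiNum Q q t col (q⁻¹ ^ (r + 1)) c y) *
            xiNum Q q t col 1 c y) := by
      rw [interpNum, interpCorr, hm, Finset.prod_range_succ', pow_zero]
    rw [hspecΨ, e2, e1, map_mul (Laurent.spec q y c), hm, spec_chainNum hyC hcy, hh, chainTerm, hm',
      hfil, ← Finset.mul_prod_erase U' _ hc, ← Finset.mul_prod_erase _ _ hcUy, ← hUy]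
    have e3 : chainNum Q q t col m c (y :: C) =
        (∏ r ∈ Finset.range m, xiNum Q q t col (q⁻¹ ^ (r + 1)) c y) *
          chainNum Q q t col m c C := by
      simp only [chainNum, List.map_cons, List.prod_cons]
    have e4 : pairProd (xi Q q t col) (c :: y :: C) = (xi Q q t col c y *
        (C.map fun s => xi Q q t col c s).prod) * pairProd (xi Q q t col) (y :: C) := by
      rw [pairProd, List.map_cons, List.prod_cons]
    have e5 : ((y :: C).map fun s => ∏ z ∈ U'.erase c, xi Q q t col s z).prod =
        (toRat k V (∏ z ∈ U'.erase c, tProd Q q t col y z) *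
          (toRat k V (∏ v ∈ Uy, Laurent.lin q y v) / toRat k V (∏ v ∈ Uy, Laurent.lin 1 y v))) *
          (C.map fun s => ∏ z ∈ U'.erase c, xi Q q t col s z).prod := by
      rw [List.map_cons, List.prod_cons, prod_xi, ← hcy, hfil]
    rw [e3, e4, e5]
    simp only [map_mul, map_neg] at key ⊢
    exact key

/-- Recursion on the number of free variables. In the division of `chainNum · h`, the quotient gives
words through `IH`, because `U'` is a proper subset of `U`, and every interpolation term is a chain
term with fewer free variables. With no free variable of the colour of `y` the remainder is empty.
-/
theorem sym_chainTerm_mem [CharZero k] {N : Subsemigroup kˣ} (hN : SmallIn N q t)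
    (IH : ∀ W : Finset V, W ⊂ U → ∀ R, IsWheel Q q t col W R →
      toRat k V R ∈ wordSpan col (xi Q q t col) W)
    (m : ℕ) {C : List V} {y : V} (hm : U'.card = m) (hy : y ∉ U') (hyC : y ∉ C) (hC : C.Nodup)
    (hCU : ∀ s ∈ C, s ∉ U') (hcol : ∀ s ∈ C, col s = col y)
    (hU : U = (y :: C).toFinset ∪ U') {f h : Laurent k V}
    (hf : ∀ σ ∈ colPerm col U', pact k σ f = f) (hh : IsWheelAt Q q t col U' y h) :
    sym col U (chainTerm Q q t col U' C y f h) ∈ wordSpan col (xi Q q t col) U := by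
  induction m using Nat.strong_induction_on generalizing U' C y f h with
  | _ m ih =>
  have hne : ∀ {v}, v ∈ U' → v ≠ y := fun hv h => hy (h ▸ hv)
  obtain ⟨h1, hw, heq⟩ := IsWheelAt.exists_division hN
    (hh.mul fun σ hσ => pact_chainNum (Q := Q) (q := q) (t := t) hσ hy hCU U'.card) hy
    (interpCorr Q q t col U'.card y)
    (fun σ hσ c => by
      have h := mem_colPerm.1 hσ
      rw [interpCorr, map_prod, interpCorr]
      exact Finset.prod_congr rfl fun r _ => by rw [pact_xiNum h.1, h.2 y hy])
    (fun c hc _ => by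
      rw [interpCorr, map_prod]
      exact Finset.prod_induction _ IsUnit (fun _ _ => IsUnit.mul) isUnit_one fun r _ =>
        isUnit_spec_xiNum hN (hne hc) r)
  have hsplit : chainTerm Q q t col U' C y f h =
      toRat k V f * pairProd (xi Q q t col) (y :: C) *
        ((y :: C).map fun s => ∏ z ∈ U', xi Q q t col s z).prod * toRat k V h1 +
      ∑ c ∈ U'.filter (fun v => col v = col y),
        toRat k V f * pairProd (xi Q q t col) (y :: C) *
        (C.map fun s => ∏ z ∈ U', xi Q q t col s z).prod *
        (toRat k V (Laurent.spec q y c (chainNum Q q t col U'.card y C * h)) *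
          (toRat k V (interpNum q col U' y (interpCorr Q q t col U'.card y) c) /
            toRat k V (Laurent.spec q y c
              (interpNum q col U' y (interpCorr Q q t col U'.card y) c))) *
          toRat k V (∏ z ∈ U', tProd Q q t col y z) /
          toRat k V (∏ v ∈ U'.filter (fun v => col v = col y), Laurent.lin 1 y v)) := by
    rw [chainTerm, mul_comm h, map_mul, heq, ← Finset.mul_sum, ← Finset.sum_div, ← Finset.sum_mul,
      List.map_cons, List.prod_cons, prod_xi]
    ring
  rw [hsplit, sym_add, sym_sum]
  refine add_mem ?_ (Submodule.sum_mem _ fun c hc => ?_)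
  · refine sym_prefix_mem_wordSpan equivariant_xi (List.nodup_cons.2 ⟨hyC, hC⟩) ?_ hU hf
      (IH U' ?_ h1 hw)
    · intro s hs
      rcases List.mem_cons.1 hs with rfl | hs
      · exact hy
      · exact hCU s hs
    · rw [hU, Finset.ssubset_iff_of_subset Finset.subset_union_right]
      exact ⟨y, by simp, hy⟩
  · obtain ⟨hc, hcy⟩ := Finset.mem_filter.1 hc
    obtain ⟨h', hh', hw'⟩ := hh.exists_spec_eq hN hy hc hcy
    obtain ⟨f', hf', he⟩ := exists_chainTerm_eq hN hc hcy hy hyC hCU hcol hf hh'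
    rw [he]
    refine ih (U'.erase c).card ?_ rfl (by simp) ?_ (List.nodup_cons.2 ⟨hyC, hC⟩) ?_ ?_ ?_ hf' hw'
    · rw [← hm]; exact Finset.card_erase_lt_of_mem hc
    · rw [List.mem_cons, not_or]
      exact ⟨hne hc, fun h => hCU c h hc⟩
    · intro s hs h
      rcases List.mem_cons.1 hs with rfl | hs
      · exact hy (Finset.mem_of_mem_erase h)
      · exact hCU s hs (Finset.mem_of_mem_erase h)
    · intro s hs
      rcases List.mem_cons.1 hs with rfl | hs
      · exact hcy.symm
      · exact (hcol s hs).trans hcy.symm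
    · rw [hU]
      ext v
      simp only [List.toFinset_cons, Finset.mem_union, Finset.mem_insert, List.mem_toFinset,
        Finset.mem_erase]
      by_cases hv : v = c
      · subst hv; simp [hc]
      · simp [hv]

end Generation

/-! ### Wheel elements are combinations of words -/

section Main

variable {I E : Type*} [DecidableEq I] [Fintype E] {k : Type*} [Field k]
variable {Q : EdgeQuiver I E} {q : kˣ} {t : E → kˣ}
variable {V : Type*} [DecidableEq V] [Fintype V] {col : V → I} {U : Finset V}

/-- Words are symmetric, so `Sym (p x) = Sym (p) x` for a word `x`, with `Sym (p)` a symmetric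
Laurent polynomial. This permits arbitrary Laurent coefficients in intermediate steps. -/
theorem sym_mul_mem_wordSpan {ξ : V → V → RatFun k V} {x : RatFun k V}
    (hx : x ∈ Submodule.span (Laurent k V) (wordSpan col ξ U : Set (RatFun k V))) :
    sym col U x ∈ wordSpan col ξ U := by
  suffices h : ∀ p : Laurent k V, sym col U (toRat k V p * x) ∈ wordSpan col ξ U by
    simpa using h 1
  induction hx using Submodule.span_induction with
  | mem x hx =>
    intro p
    rw [mul_comm, sym_mul_of_invariant fun σ hσ => act_wordSpan hx hσ, mul_comm]
    have h1 : sym col U (toRat k V p) = toRat k V (∑ σ ∈ colPerm col U, pact k σ p) := by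
      rw [sym, map_sum]
      exact Finset.sum_congr rfl fun σ _ => act_toRat σ p
    have h2 : ∀ σ ∈ colPerm col U, pact k σ (∑ σ ∈ colPerm col U, pact k σ p) =
        ∑ σ ∈ colPerm col U, pact k σ p := by
      intro σ hσ
      apply toRat_injective
      rw [← act_toRat, ← h1, act_sym hσ]
    rw [h1]
    exact mul_mem_wordSpan h2 hx
  | zero => intro p; simp [sym]
  | add x y _ _ hx hy => intro p; rw [mul_add, sym_add]; exact add_mem (hx p) (hy p)
  | smul a x _ hx =>
    intro p
    rw [Algebra.smul_def, ← mul_assoc, ← map_mul]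
    exact hx _

/-- The chain argument, started with an empty chain, handles `Sym [z_y^i B_y R / Δ_y]` for all `i ≥
0`. A combination of these with Laurent coefficients isolates the permutations fixing `y`, and so
recovers `B_y R`. -/
theorem IsWheel.prod_tProd_smul_mem [CharZero k] {N : Subsemigroup kˣ} (hN : SmallIn N q t)
    (IH : ∀ W : Finset V, W ⊂ U → ∀ R, IsWheel Q q t col W R →
      toRat k V R ∈ wordSpan col (xi Q q t col) W) {R : Laurent k V}
    (hR : IsWheel Q q t col U R) {y : V} (hy : y ∈ U) :
    (∏ z ∈ U.erase y, tProd Q q t col y z) • toRat k V R ∈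
      Submodule.span (Laurent k V) (wordSpan col (xi Q q t col) U : Set (RatFun k V)) := by
  set B := ∏ z ∈ U.erase y, tProd Q q t col y z with hB
  set Uy := (U.erase y).filter fun v => col v = col y with hUy
  set Δ := ∏ v ∈ Uy, Laurent.lin (k := k) 1 y v with hΔ
  have hΔ0 : Δ ≠ 0 := Finset.prod_ne_zero_iff.2 fun v hv =>
    Laurent.lin_ne_zero _ (Finset.ne_of_mem_erase (Finset.mem_filter.1 hv).1).symm
  set ρ : RatFun k V := toRat k V (B * R) / toRat k V Δ with hρ
  have hpow : ∀ i : ℕ, sym col U (toRat k V (Laurent.var k y ^ i) * ρ) ∈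
      wordSpan col (xi Q q t col) U := by
    intro i
    have h0 : ∀ σ ∈ colPerm col (U.erase y), pact k σ (Laurent.var k y ^ i) =
        Laurent.var k y ^ i := fun σ hσ => by
      rw [map_pow, pact_var, (mem_colPerm.1 hσ).2 y (by simp)]
    have := sym_chainTerm_mem hN IH (U' := U.erase y) _ (C := []) (y := y) (f := 1) rfl (by simp)
      (by simp) (by simp) (by simp) (by simp)
      (by ext v; by_cases h : v = y <;> simp [h, hy]) (fun _ _ => map_one _)
      (hR.isWheelAt hy h0)
    convert this using 2
    rw [hρ, chainTerm]
    simp only [pairProd, chainNum, List.map_nil, List.prod_nil, map_one, one_mul, mul_one]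
    rw [← mul_div_assoc, ← map_mul]
    congr 2
    ring
  -- The coefficients of `f` are the required multipliers: the permutation `σ` contributes `f(z_{σ
  -- y})`, which is `Δ_y` if `σ y = y` and `0` otherwise.
  let f : Polynomial (Laurent k V) := ∏ v ∈ Uy, (Polynomial.X - Polynomial.C (Laurent.var k v))
  have hsum : ∑ i ∈ Finset.range (f.natDegree + 1), toRat k V (f.coeff i) *
      sym col U (toRat k V (Laurent.var k y ^ i) * ρ) =
      ((colPerm col U).filter fun σ => σ y = y).card • toRat k V (B * R) := by
    have h1 : ∀ σ ∈ colPerm col U, ∑ i ∈ Finset.range (f.natDegree + 1), toRat k V (f.coeff i) *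
        act k σ (toRat k V (Laurent.var k y ^ i) * ρ) =
        if σ y = y then toRat k V (B * R) else 0 := by
      intro σ hσ
      have hσ' := mem_colPerm.1 hσ
      have h2 : ∑ i ∈ Finset.range (f.natDegree + 1), toRat k V (f.coeff i) *
          act k σ (toRat k V (Laurent.var k y ^ i) * ρ) =
          toRat k V (f.eval (Laurent.var k (σ y))) * act k σ ρ := by
        rw [Polynomial.eval_eq_sum_range, map_sum, Finset.sum_mul]
        refine Finset.sum_congr rfl fun i _ => ?_
        rw [map_mul, act_toRat, map_pow, pact_var, map_mul, mul_assoc]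
      have h3 : f.eval (Laurent.var k (σ y)) = ∏ v ∈ Uy, Laurent.lin 1 (σ y) v := by
        simp [f, Polynomial.eval_prod, Laurent.lin]
      rw [h2, h3]
      split_ifs with h
      · rw [h, ← hΔ]
        have hσy : σ ∈ colPerm col (U.erase y) := by
          rw [mem_colPerm]
          refine ⟨hσ'.1, fun v hv => ?_⟩
          by_cases hvy : v = y
          · rw [hvy, h]
          · exact hσ'.2 v fun hvU => hv (Finset.mem_erase.2 ⟨hvy, hvU⟩)
        have h4 : pact k σ (B * R) = B * R := by
          rw [map_mul, hR.pact_eq σ hσ, hB, prod_tProd_erase_invariant hσy]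
        have h5 : pact k σ Δ = Δ := by
          rw [hΔ, map_prod, Finset.prod_congr rfl fun v _ => pact_lin σ 1 y v, h, hUy,
            prod_filter_comp_colPerm hσy _ fun v => Laurent.lin 1 y v]
        rw [hρ, map_div₀, act_toRat, act_toRat, h4, h5, mul_div_cancel₀]
        exact toRat_ne_zero hΔ0
      · rw [Finset.prod_eq_zero (i := σ y), map_zero, zero_mul]
        · rw [hUy, Finset.mem_filter, Finset.mem_erase, apply_mem_of_mem_colPerm hσ]
          exact ⟨⟨h, hy⟩, hσ'.1 y⟩
        · simp [Laurent.lin]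
    simp only [sym, Finset.mul_sum]
    rw [Finset.sum_comm, Finset.sum_congr rfl h1, ← Finset.sum_filter, Finset.sum_const]
  set n := ((colPerm col U).filter fun σ => σ y = y).card with hn
  have hn0 : (n : k) ≠ 0 := Nat.cast_ne_zero.2 (Finset.card_ne_zero_of_mem (a := 1)
    (Finset.mem_filter.2 ⟨one_mem_colPerm, rfl⟩))
  have hmem : (n : k) • toRat k V (B * R) ∈
      Submodule.span (Laurent k V) (wordSpan col (xi Q q t col) U : Set (RatFun k V)) := by
    rw [Nat.cast_smul_eq_nsmul, ← hsum]
    refine Submodule.sum_mem _ fun i _ => ?_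
    rw [← Algebra.smul_def]
    exact Submodule.smul_mem _ _ (Submodule.subset_span (hpow i))
  have := Submodule.smul_of_tower_mem _ ((n : k)⁻¹) hmem
  rw [smul_smul, inv_mul_cancel₀ hn0, one_smul, map_mul, ← Algebra.smul_def] at this
  exact this

/-- Symmetric Laurent polynomials that satisfy the three-variable wheel conditions are combinations
of words. -/
theorem IsWheel.toRat_mem_wordSpan [CharZero k] {N : Subsemigroup kˣ} (hN : SmallIn N q t)
    {R : Laurent k V} (hR : IsWheel Q q t col U R) :
    toRat k V R ∈ wordSpan col (xi Q q t col) U := by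
  induction U using Finset.strongInduction generalizing R with
  | H U IH =>
  have hsym : sym col U (toRat k V R) = ((colPerm col U).card : k) • toRat k V R := by
    rw [Nat.cast_smul_eq_nsmul]
    exact sym_of_invariant fun σ hσ => by rw [act_toRat, hR.pact_eq σ hσ]
  suffices h : sym col U (toRat k V R) ∈ wordSpan col (xi Q q t col) U by
    rw [hsym] at h
    have := Submodule.smul_mem _ ((colPerm col U).card : k)⁻¹ h
    rwa [smul_smul, inv_mul_cancel₀ card_colPerm_ne_zero, one_smul] at this
  rcases U.eq_empty_or_nonempty with rfl | hne
  · exact Submodule.subset_span ⟨R, [], by simp, rfl, by simp [pairProd]⟩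
  · refine sym_mul_mem_wordSpan ?_
    -- The multipliers that carry `R` into the Laurent span of the words form an ideal. It contains
    -- every `B_y`, hence `1`.
    let J : Ideal (Laurent k V) :=
      (Submodule.span (Laurent k V) (wordSpan col (xi Q q t col) U : Set (RatFun k V))).comap
        (LinearMap.toSpanSingleton (Laurent k V) (RatFun k V) (toRat k V R))
    have hJ : J = ⊤ := by
      rw [eq_top_iff, ← span_prod_tProd_eq_top (Q := Q) (col := col) hN hne, Ideal.span_le]
      rintro _ ⟨y, hy, rfl⟩
      exact hR.prod_tProd_smul_mem hN (fun W hW R hR => IH W hW hR) hy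
    have h1 : (1 : Laurent k V) ∈ J := hJ ▸ Submodule.mem_top
    simpa [J] using h1

end Main

/-! ### Words satisfy the three-variable wheel conditions -/

section WordsWheel

variable {I E : Type*} [DecidableEq I] [Fintype E] {k : Type*} [Field k]
variable {Q : EdgeQuiver I E} {q : kˣ} {t : E → kˣ}
variable {V : Type*} [Fintype V] [DecidableEq V] {col : V → I}

theorem mem_pairs_trans {L : List V} (hL : L.Nodup) {a b c : V} (hab : (a, b) ∈ pairs L)
    (hbc : (b, c) ∈ pairs L) : (a, c) ∈ pairs L := by
  induction L with
  | nil => simp [pairs] at hab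
  | cons u L ih =>
    rw [List.nodup_cons] at hL
    simp only [pairs, Finset.mem_union, Finset.mem_image, List.mem_toFinset, Prod.mk.injEq] at *
    rcases hbc with ⟨v, hv, rfl, rfl⟩ | hbc
    · rcases hab with ⟨v', hv', rfl, rfl⟩ | hab
      · exact absurd hv' hL.1
      · exact absurd (mem_of_mem_pairs hab).2 hL.1
    · rcases hab with ⟨v', hv', rfl, rfl⟩ | hab
      · exact Or.inl ⟨c, (mem_of_mem_pairs hbc).2, rfl, rfl⟩
      · exact Or.inr (ih hL.2 hab hbc)

/-- Reordering changes the linear forms only by signs. Applied with `L'` a permuted word, this gives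
all terms of a symmetrization the common denominator of `L`. -/
theorem pairProd_diag_dvd {L L' : List V} (hL : L.Nodup) (hL' : L'.Nodup)
    (h : ∀ v ∈ L', v ∈ L) : pairProd (diag k col) L' ∣ pairProd (diag k col) L := by
  rw [pairProd_eq_prod_pairs hL']
  simp only [diag]
  rw [← Finset.prod_filter]
  have hS : ∀ p ∈ (pairs L').filter (fun p => col p.1 = col p.2),
      p.1 ∈ L ∧ p.2 ∈ L ∧ p.1 ≠ p.2 ∧ col p.1 = col p.2 ∧ p.swap ∉ pairs L' := by
    intro p hp
    rw [Finset.mem_filter] at hp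
    have h1 := mem_of_mem_pairs hp.1
    have h2 := ne_and_swap_notMem_pairs hL' hp.1
    exact ⟨h _ h1.1, h _ h1.2, h2.1, hp.2, h2.2⟩
  refine prod_prime_dvd _ _ (fun p hp => Laurent.prime_lin _ (hS p hp).2.2.1)
    (fun p hp p' hp' hpp => ?_) fun p hp => ?_
  · by_cases h1 : p'.1 ≠ p.1 ∧ p'.1 ≠ p.2
    · exact Laurent.not_lin_dvd_lin_of_ne _ _ (hS p hp).2.2.1 (hS p' hp').2.2.1 h1.1 h1.2
    · by_cases h2 : p'.2 ≠ p.1 ∧ p'.2 ≠ p.2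
      · exact Laurent.not_lin_dvd_lin_of_ne' _ _ (hS p hp).2.2.1 (hS p' hp').2.2.1 h2.1 h2.2
      · exfalso
        have h3 := (hS p' hp').2.2.1
        have h4 := (hS p hp).2.2.2.2
        have h5 := (Finset.mem_filter.1 hp').1
        obtain ⟨a, b⟩ := p
        obtain ⟨c, d⟩ := p'
        simp only [ne_eq, Prod.mk.injEq, Prod.swap_prod_mk] at *
        grind
  · obtain ⟨h1, h2, h3, h4, -⟩ := hS p hp
    exact lin_dvd_pairProd_diag hL h1 h2 h3 h4

/-- Reversing an arrow of the doubled quiver exchanges `κ` and `q / κ`, and at `z_b = q z_a` the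
form `z_b - (q / κ) z_z` is a multiple of `z_z - κ z_a`. -/
theorem tProd_dvd_spec_tProd {a b z : V} (hzb : z ≠ b) (hcol : col a = col b) :
    tProd Q q t col a z ∣ Laurent.spec q b a (tProd Q q t col z b) := by
  rw [tProd, tProd, map_prod]
  rw [Finset.prod_bij' (s := arrows Q (col z) (col b)) (t := arrows Q (col a) (col z))
    (g := fun p => Laurent.spec q b a (Laurent.lin (kap q t p.swap) b z))
    (fun p _ => p.swap) (fun p _ => p.swap)
    (fun p hp => by rw [swap_mem_arrows, hcol]; exact hp)
    (fun p hp => by rw [swap_mem_arrows, ← hcol]; exact hp)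
    (fun p _ => Sum.swap_swap p) (fun p _ => Sum.swap_swap p) (fun p _ => by rw [Sum.swap_swap])]
  refine Finset.prod_dvd_prod_of_dvd _ _ fun p _ => ?_
  rw [Laurent.lin, Laurent.lin, map_sub, map_smul, Laurent.spec_var_self,
    Laurent.spec_var_of_ne _ hzb, kap_swap]
  refine ⟨algebraMap k _ (-((q / kap q t p : kˣ) : k)), ?_⟩
  rw [mul_comm, ← Algebra.smul_def, smul_sub, smul_smul, neg_mul, ← Units.val_mul, div_mul_cancel,
    neg_smul, neg_smul]
  abel

variable (Q q t col) in
/-- The numerator of `xi`. -/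
def xiNumer (u v : V) : Laurent k V :=
  tProd Q q t col u v * if col u = col v then Laurent.lin q u v else 1

theorem toRat_diag_mul_xi {u v : V} (h : u ≠ v) :
    toRat k V (diag k col u v) * xi Q q t col u v = toRat k V (xiNumer Q q t col u v) := by
  rw [xi, xiNumer, diag]
  split_ifs
  · rw [map_mul]
    have := toRat_ne_zero (Laurent.lin_ne_zero (k := k) 1 h)
    field_simp
  · simp

theorem toRat_pairProd_diag_mul {L : List V} (hL : L.Nodup) :
    toRat k V (pairProd (diag k col) L) * pairProd (xi Q q t col) L =
      toRat k V (pairProd (xiNumer Q q t col) L) := by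
  rw [pairProd_eq_prod_pairs hL, pairProd_eq_prod_pairs hL, pairProd_eq_prod_pairs hL, map_prod,
    map_prod, ← Finset.prod_mul_distrib]
  exact Finset.prod_congr rfl fun p hp =>
    toRat_diag_mul_xi (ne_and_swap_notMem_pairs hL hp).1

/-- There are three cases. If `b` precedes `a`, the factor `z_b - q z_a` kills everything. Otherwise
`z` comes after `a`, and the pair `(a, z)` supplies the factor, or `z` comes before `a` and hence
before `b`, and the pair `(z, b)` does. -/
theorem tProd_dvd_spec_pairProd {L : List V} (hL : L.Nodup) {a b z : V} (ha : a ∈ L) (hb : b ∈ L)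
    (hz : z ∈ L) (hab : a ≠ b) (hcol : col a = col b) (hza : z ≠ a) (hzb : z ≠ b) :
    tProd Q q t col a z ∣ Laurent.spec q b a (pairProd (xiNumer Q q t col) L) := by
  rw [pairProd_eq_prod_pairs hL, map_prod]
  rcases mem_pairs_or ha hb hab with h1 | h1
  · rcases mem_pairs_or ha hz hza.symm with h2 | h2
    · refine dvd_trans ?_ (Finset.dvd_prod_of_mem _ h2)
      dsimp only
      rw [xiNumer, map_mul, spec_tProd_of_ne _ hab hzb]
      exact dvd_mul_right _ _
    · refine dvd_trans ?_ (Finset.dvd_prod_of_mem _ (mem_pairs_trans hL h2 h1))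
      dsimp only
      rw [xiNumer, map_mul]
      exact (tProd_dvd_spec_tProd hzb hcol).mul_right _
  · rw [Finset.prod_eq_zero h1]
    · exact dvd_zero _
    · dsimp only
      rw [xiNumer, if_pos hcol.symm, map_mul, Laurent.spec_lin _ hab.symm, mul_zero]

variable {U : Finset V}

theorem spec_spec_pairProd_diag_ne_zero {N : Subsemigroup kˣ} (hN : SmallIn N q t) {L : List V}
    (hL : L.Nodup) {a b z : V} (hzb : z ≠ b) (hza : z ≠ a) (p : E ⊕ E) :
    Laurent.spec (kap q t p) z a (Laurent.spec q b a (pairProd (diag k col) L)) ≠ 0 := by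
  rw [pairProd_eq_prod_pairs hL, map_prod, map_prod, Finset.prod_ne_zero_iff]
  intro x hx
  rw [diag]
  split_ifs
  · exact spec_spec_lin_one_ne_zero (hN.ne_one hN.q_mem) (hN.ne_one (hN.kap_mem p))
      (hN.q_ne_kap p) hzb hza (ne_and_swap_notMem_pairs hL hx).1
  · simp

/-- Words are Laurent polynomials that satisfy the three-variable wheel conditions. -/
theorem exists_isWheel_of_word [CharZero k] {N : Subsemigroup kˣ} (hN : SmallIn N q t)
    {L : List V} (hL : L.Nodup) (f : Laurent k V) :
    ∃ R, IsWheel Q q t col L.toFinset R ∧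
      sym col L.toFinset (toRat k V f * pairProd (xi Q q t col) L) = toRat k V R := by
  set U := L.toFinset with hU
  set D := pairProd (diag k col) L with hD
  have hmap : ∀ σ ∈ colPerm col U, (L.map σ).Nodup ∧ ∀ v, v ∈ L.map σ ↔ v ∈ L := by
    intro σ hσ
    refine ⟨hL.map σ.injective, fun v => ?_⟩
    rw [← List.mem_toFinset (l := L), ← hU, ← map_colPerm hσ, hU]
    simp only [List.mem_map, Finset.mem_map_equiv, List.mem_toFinset]
    exact ⟨by rintro ⟨a, ha, rfl⟩; simpa, fun h => ⟨_, h, by simp⟩⟩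
  have hx : ∀ σ, ∃ x : Laurent k V, σ ∈ colPerm col U →
      (∃ e, x = pact k σ f * pairProd (xiNumer Q q t col) (L.map σ) * e ∧
        toRat k V D * act k σ (toRat k V f * pairProd (xi Q q t col) L) = toRat k V x) := by
    intro σ
    by_cases hσ : σ ∈ colPerm col U
    · obtain ⟨h1, h2⟩ := hmap σ hσ
      obtain ⟨e, he⟩ := pairProd_diag_dvd (k := k) (col := col) hL h1 fun v hv => (h2 v).1 hv
      refine ⟨_, fun _ => ⟨e, rfl, ?_⟩⟩
      have h3 : act k σ (pairProd (xi Q q t col) L) = pairProd (xi Q q t col) (L.map σ) := by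
        rw [map_pairProd, pairProd_map]
        exact pairProd_congr fun u _ v _ => equivariant_xi σ (mem_colPerm.1 hσ).1 u v
      rw [map_mul, act_toRat, h3, hD, he, map_mul, map_mul, map_mul, ← toRat_pairProd_diag_mul h1]
      ring
    · exact ⟨0, fun h => absurd h hσ⟩
  choose x hx using hx
  have hDsym : toRat k V D * sym col U (toRat k V f * pairProd (xi Q q t col) L) =
      toRat k V (∑ σ ∈ colPerm col U, x σ) := by
    rw [sym, Finset.mul_sum, map_sum]
    exact Finset.sum_congr rfl fun σ hσ => by
      obtain ⟨-, -, h⟩ := hx σ hσ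
      exact h
  obtain ⟨R, hR⟩ := exists_toRat_of_invariant (col := col) hL (fun σ hσ => act_sym hσ _) hDsym
  refine ⟨R, ⟨fun σ hσ => ?_, fun a ha b hb hab hcol z hz hza hzb => ?_⟩, hR⟩
  · apply toRat_injective
    rw [← act_toRat, ← hR, act_sym hσ]
  · have h1 : D * R = ∑ σ ∈ colPerm col U, x σ := by
      apply toRat_injective
      rw [← hDsym, hR, map_mul]
    have h2 : tProd Q q t col a z ∣ Laurent.spec q b a (D * R) := by
      rw [h1, map_sum]
      refine Finset.dvd_sum fun σ hσ => ?_
      obtain ⟨e, he, -⟩ := hx σ hσ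
      obtain ⟨h3, h4⟩ := hmap σ hσ
      rw [hU, List.mem_toFinset] at ha hb hz
      rw [he, map_mul, map_mul]
      exact ((tProd_dvd_spec_pairProd h3 ((h4 a).2 ha) ((h4 b).2 hb) ((h4 z).2 hz) hab hcol hza
        hzb).mul_left _).mul_right _
    rw [mul_comm, map_mul] at h2
    exact tProd_dvd_of_dvd_mul hza
      (fun p _ => spec_spec_pairProd_diag_ne_zero hN hL hzb hza p) h2

theorem exists_isWheel_of_mem_wordSpan [CharZero k] {N : Subsemigroup kˣ} (hN : SmallIn N q t)
    {r : RatFun k V} (hr : r ∈ wordSpan col (xi Q q t col) U) :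
    ∃ R, IsWheel Q q t col U R ∧ r = toRat k V R := by
  induction hr using Submodule.span_induction with
  | mem x hx =>
    obtain ⟨f, L, h1, rfl, rfl⟩ := hx
    exact exists_isWheel_of_word hN h1 f
  | zero => exact ⟨0, ⟨fun _ _ => map_zero _, fun _ _ _ _ _ _ _ _ _ _ => by simp⟩, by simp⟩
  | add x y _ _ hx hy =>
    obtain ⟨R, hR, rfl⟩ := hx
    obtain ⟨S, hS, rfl⟩ := hy
    refine ⟨R + S, ⟨fun σ hσ => by rw [map_add, hR.pact_eq σ hσ, hS.pact_eq σ hσ],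
      fun a ha b hb hab hcol z hz hza hzb => ?_⟩, (map_add _ _ _).symm⟩
    rw [map_add]
    exact dvd_add (hR.dvd a ha b hb hab hcol z hz hza hzb)
      (hS.dvd a ha b hb hab hcol z hz hza hzb)
  | smul c x _ hx =>
    obtain ⟨R, hR, rfl⟩ := hx
    refine ⟨c • R, ⟨fun σ hσ => by rw [map_smul, hR.pact_eq σ hσ],
      fun a ha b hb hab hcol z hz hza hzb => ?_⟩, (toRat_smul _ _).symm⟩
    rw [map_smul, Algebra.smul_def]
    exact (hR.dvd a ha b hb hab hcol z hz hza hzb).mul_left _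

end WordsWheel

/-! ### Graded pieces in terms of coloured variables -/

section Symmetrize

variable {I : Type*} [Fintype I] [DecidableEq I] {k : Type*} [Field k] {n : I → ℕ}

theorem mem_colPerm_univ {σ : Equiv.Perm (Var n)} :
    σ ∈ colPerm Sigma.fst Finset.univ ↔ ∀ v, (σ v).1 = v.1 := by
  simp [mem_colPerm]

theorem exists_varPerm {σ : Equiv.Perm (Var n)} (hσ : ∀ v, (σ v).1 = v.1) :
    ∃ τ : VarPerm n, Equiv.sigmaCongrRight τ = σ := by
  have h : ∀ (i : I) (a : Fin (n i)), ∃ b, σ ⟨i, a⟩ = ⟨i, b⟩ := fun i a =>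
    ⟨cast (congrArg (fun j => Fin (n j)) (hσ ⟨i, a⟩)) (σ ⟨i, a⟩).2,
      Sigma.ext (hσ ⟨i, a⟩) (cast_heq _ _).symm⟩
  choose f hf using h
  have hinj : ∀ i, Function.Injective (f i) := fun i a b hab => by
    have : σ ⟨i, a⟩ = σ ⟨i, b⟩ := by rw [hf, hf, hab]
    simpa using σ.injective this
  exact ⟨fun i => Equiv.ofBijective (f i) (Finite.injective_iff_bijective.1 (hinj i)),
    Equiv.ext fun v => (hf v.1 v.2).symm⟩

theorem sigmaCongrRight_mem_colPerm (τ : VarPerm n) :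
    Equiv.sigmaCongrRight τ ∈ colPerm Sigma.fst (Finset.univ : Finset (Var n)) :=
  mem_colPerm_univ.2 fun _ => rfl

theorem symmetrize_eq_sym (r : RatFun k (Var n)) :
    symmetrize n r = sym Sigma.fst Finset.univ r := by
  refine Finset.sum_bij (fun τ _ => Equiv.sigmaCongrRight τ)
    (fun τ _ => sigmaCongrRight_mem_colPerm τ) (fun τ _ τ' _ h => ?_) (fun σ hσ => ?_)
    fun τ _ => rfl
  · ext i a
    have := Equiv.congr_fun h ⟨i, a⟩
    simp only [Equiv.sigmaCongrRight_apply, Sigma.mk.injEq, true_and, heq_eq_eq] at this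
    exact congrArg _ this
  · obtain ⟨τ, hτ⟩ := exists_varPerm (mem_colPerm_univ.1 hσ)
    exact ⟨τ, Finset.mem_univ _, hτ⟩

theorem mem_symRat_iff {r : RatFun k (Var n)} :
    r ∈ SymRat k n ↔ ∀ σ ∈ colPerm Sigma.fst Finset.univ, act k σ r = r := by
  constructor
  · intro h σ hσ
    obtain ⟨τ, rfl⟩ := exists_varPerm (mem_colPerm_univ.1 hσ)
    exact h τ
  · exact fun h τ => h _ (sigmaCongrRight_mem_colPerm τ)

end Symmetrize

/-! ### Three-variable and many-variable wheel conditions -/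

section WheelCondition

variable {I E : Type*} [Fintype I] [DecidableEq I] [Fintype E] {k : Type*} [Field k]
variable {Q : EdgeQuiver I E} {q : kˣ} {t : E → kˣ} {n : I → ℕ}

theorem wheelProduct_eq (j : I) (l : ℕ) (v : Var n) :
    wheelProduct Q q t n j l v = ∏ s ∈ Finset.Ico 1 l, ∏ p ∈ arrows Q j v.1,
      Laurent.lin (kap q t p * q ^ (s - 1)) (some v) none := by
  refine Finset.prod_congr rfl fun s hs => ?_
  obtain ⟨s, rfl⟩ := Nat.exists_eq_add_of_le' (Finset.mem_Ico.1 hs).1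
  rw [arrows, Finset.prod_disjSum, mul_comm]
  congr 1
  · refine Finset.prod_congr rfl fun e _ => ?_
    simp only [Laurent.lin, kap, Sum.elim_inl, Units.val_mul, Units.val_pow_eq_pow_val]
    rw [mul_comm]
  · refine Finset.prod_congr rfl fun e _ => ?_
    simp only [Laurent.lin, kap, Sum.elim_inr, Units.val_mul, Units.val_pow_eq_pow_val,
      Units.val_div_eq_div_val, Nat.add_sub_cancel]
    congr 2
    ring

theorem chainSubst_var_of_lt {j : I} {l : ℕ} {a : Fin (n j)} (ha : a.val < l) :
    chainSubst q n j l (Laurent.var k ⟨j, a⟩) = ((q ^ a.val : kˣ) : k) • Laurent.var k none := by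
  rw [chainSubst, Laurent.subst_var, if_pos ⟨rfl, ha⟩, Algebra.smul_def, mul_comm]
  rfl

theorem chainSubst_var_of_not {j : I} {l : ℕ} {v : Var n} (hv : ¬ (v.1 = j ∧ v.2.val < l)) :
    chainSubst q n j l (Laurent.var k v) = Laurent.var k (some v) := by
  rw [chainSubst, Laurent.subst_var, if_neg hv]
  rfl

/-- Only chains of length two are needed; symmetry moves `a` and `b` to the first two places. -/
theorem isWheel_of_wheelCondition {P : Laurent k (Var n)}
    (hP : ∀ σ ∈ colPerm Sigma.fst Finset.univ, pact k σ P = P) (h : WheelCondition Q q t n P) :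
    IsWheel Q q t Sigma.fst Finset.univ P := by
  refine ⟨hP, ?_⟩
  rintro ⟨j, a⟩ - ⟨j', b⟩ - hab (rfl : j = j') z - hza hzb
  have hab' : (a : ℕ) ≠ b := fun h => hab (by rw [Fin.ext h])
  have hn : 2 ≤ n j := by have := a.2; have := b.2; omega
  set c0 : Var n := ⟨j, ⟨0, by omega⟩⟩ with hc0
  set c1 : Var n := ⟨j, ⟨1, by omega⟩⟩ with hc1
  have hc : c1 ≠ c0 := by simp [hc0, hc1]
  -- The inner swap sends `c0` to `a`; the outer one then corrects the image of `c1` to `b` without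
  -- moving `a`.
  set σ : Equiv.Perm (Var n) := Equiv.swap ⟨j, b⟩ (Equiv.swap c0 ⟨j, a⟩ c1) *
    Equiv.swap c0 ⟨j, a⟩ with hσdef
  have hcol : (Equiv.swap c0 ⟨j, a⟩ c1).1 = j := by
    rw [Equiv.swap_apply_def]; split_ifs <;> rfl
  have hσ : σ ∈ colPerm Sigma.fst Finset.univ :=
    mul_mem_colPerm (swap_mem_colPerm (by simp) (by simp) hcol.symm)
      (swap_mem_colPerm (by simp) (by simp) rfl)
  have hσ0 : σ c0 = ⟨j, a⟩ := by
    rw [hσdef, Equiv.Perm.mul_apply, Equiv.swap_apply_left]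
    refine Equiv.swap_apply_of_ne_of_ne hab fun h => hc ?_
    rw [← Equiv.swap_apply_left c0 ⟨j, a⟩] at h
    exact ((Equiv.swap c0 _).injective (h.trans (by simp))).symm
  have hσ1 : σ c1 = ⟨j, b⟩ := by
    rw [hσdef, Equiv.Perm.mul_apply, Equiv.swap_apply_right]
  have hlt : ∀ w : Var n, (w.1 = j ∧ w.2.val < 2) ↔ w = c0 ∨ w = c1 := by
    rintro ⟨i, w⟩
    constructor
    · rintro ⟨h1, h2⟩
      obtain rfl : i = j := h1
      dsimp only at h2
      rcases Nat.lt_or_ge w.val 1 with h | h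
      · left; rw [hc0]; congr 1; ext; simp; omega
      · right; rw [hc1]; congr 1; ext; simp; omega
    · rintro (h | h) <;> rw [h]
      · exact ⟨rfl, Nat.two_pos⟩
      · exact ⟨rfl, Nat.one_lt_two⟩
  -- Putting `x = z_a` and renaming by `σ` turns the chain substitution into `z_b = q z_a`.
  let ρ : Laurent k (Option (Var n)) →ₐ[k] Laurent k (Var n) :=
    Laurent.subst fun o => o.elim (Laurent.X k ⟨j, a⟩) fun w => Laurent.X k (σ w)
  have hρn : ρ (Laurent.var k none) = Laurent.var k ⟨j, a⟩ := Laurent.subst_var _ _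
  have hρs : ∀ w, ρ (Laurent.var k (some w)) = Laurent.var k (σ w) := fun w =>
    Laurent.subst_var _ _
  have hcomp : ρ.comp (chainSubst q n j 2) =
      (Laurent.spec q ⟨j, b⟩ ⟨j, a⟩).comp (pact k σ) := by
    refine Laurent.algHom_ext fun w => ?_
    rw [AlgHom.comp_apply, AlgHom.comp_apply, pact_var]
    by_cases hw : w.1 = j ∧ w.2.val < 2
    · rcases (hlt w).1 hw with rfl | rfl
      · rw [hc0, chainSubst_var_of_lt (by simp), ← hc0, hσ0, Laurent.spec_var_of_ne _ hab, map_smul,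
          hρn]
        simp
      · rw [hc1, chainSubst_var_of_lt (by simp), ← hc1, hσ1, Laurent.spec_var_self, map_smul, hρn]
        simp
    · rw [chainSubst_var_of_not hw, hρs, Laurent.spec_var_of_ne]
      intro h
      rw [← hσ1] at h
      exact hw ((hlt w).2 (Or.inr (σ.injective h)))
  obtain ⟨v, rfl⟩ := σ.surjective z
  have hv : ¬ (v.1 = j ∧ v.2.val < 2) := by
    rw [hlt]
    rintro (rfl | rfl)
    · exact hza hσ0
    · exact hzb hσ1
  have h1 := map_dvd ρ (h j 2 (by norm_num) hn v hv)
  rw [show ρ (chainSubst q n j 2 P) = _ from DFunLike.congr_fun hcomp P, AlgHom.comp_apply, hP σ hσ,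
    wheelProduct_eq, map_prod] at h1
  convert h1 using 1
  rw [show Finset.Ico 1 2 = {1} from rfl, Finset.prod_singleton, map_prod, tProd,
    mem_colPerm_univ.1 hσ]
  refine Finset.prod_congr rfl fun p _ => ?_
  simp [Laurent.lin, hρn, hρs]

/-- The chain substitution factors through `z_b = q z_a` for consecutive members `a`, `b` of the
chain, and the three-variable condition for the pair at position `s` gives the factor of index `s`.
Coprimality for different `s` assembles the product. -/
theorem IsWheel.wheelCondition {N : Subsemigroup kˣ} (hN : SmallIn N q t) {P : Laurent k (Var n)}
    (hP : IsWheel Q q t Sigma.fst Finset.univ P) : WheelCondition Q q t n P := by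
  intro j l _ hln v hv
  rw [wheelProduct_eq]
  have hne : ∀ s s' : ℕ, s < s' → ∀ p p' : E ⊕ E, kap q t p' * q ^ s' ≠ kap q t p * q ^ s := by
    intro s s' hs p p' h
    obtain ⟨d, rfl⟩ := Nat.exists_eq_add_of_lt hs
    refine hN.pow_mul_kap_ne_kap d p' p (mul_right_cancel (b := q ^ s) (Eq.trans ?_ h))
    rw [show s + d + 1 = d + 1 + s by omega, pow_add q (d + 1) s]
    ac_rfl
  refine prod_prod_prime_dvd _ _ _ (fun s _ p _ => Laurent.prime_lin _ (by simp))
    (fun s hs s' hs' hss p _ p' _ => Laurent.not_lin_dvd_lin_of_coeff_ne _ _ (by simp) ?_) ?_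
  · rw [Finset.mem_Ico] at hs hs'
    rcases lt_or_gt_of_ne hss with h | h
    · exact (hne _ _ (by omega) p p').symm
    · exact hne _ _ (by omega) p' p
  · intro s hs
    rw [Finset.mem_Ico] at hs
    obtain ⟨s, rfl⟩ := Nat.exists_eq_add_of_le' hs.1
    -- After the shift by one the wheel factor has index `s + 1`; as variables are counted from `0`,
    -- the pair has positions `s` and `s + 1`.
    set a : Var n := ⟨j, ⟨s, by omega⟩⟩ with ha
    set b : Var n := ⟨j, ⟨s + 1, by omega⟩⟩ with hb
    have hab : a ≠ b := by simp [ha, hb]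
    have hva : v ≠ a := by rintro rfl; exact hv ⟨rfl, Nat.lt_of_succ_lt hs.2⟩
    have hvb : v ≠ b := by rintro rfl; exact hv ⟨rfl, hs.2⟩
    have h1 := map_dvd (chainSubst q n j l)
      (hP.dvd a (by simp) b (by simp) hab rfl v (by simp) hva hvb)
    have hcomp : (chainSubst q n j l).comp (Laurent.spec q b a) = chainSubst (k := k) q n j l := by
      refine Laurent.algHom_ext fun w => ?_
      rw [AlgHom.comp_apply]
      by_cases hw : w = b
      · rw [hw, Laurent.spec_var_self, map_smul, ha, hb, chainSubst_var_of_lt (by dsimp only; omega),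
          chainSubst_var_of_lt hs.2, smul_smul, ← Units.val_mul, pow_succ']
      · rw [Laurent.spec_var_of_ne _ hw]
    rw [show chainSubst q n j l (Laurent.spec q b a P) = _ from DFunLike.congr_fun hcomp P, tProd,
      map_prod] at h1
    refine dvd_trans (dvd_of_eq (Finset.prod_congr rfl fun p _ => ?_)) h1
    rw [Laurent.lin, Laurent.lin, map_sub, map_smul, chainSubst_var_of_not hv, ha,
      chainSubst_var_of_lt (by dsimp only; omega), smul_smul, Units.val_mul, Nat.add_sub_cancel]

theorem toRat_mem_wordSpan_of_mem_shufflePiece [CharZero k] {N : Subsemigroup kˣ}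
    (hN : SmallIn N q t) {R : SymRat k n} (hR : R ∈ shufflePiece Q q t n) :
    (R : RatFun k (Var n)) ∈ wordSpan Sigma.fst (xi Q q t Sigma.fst) Finset.univ := by
  obtain ⟨P, hP, h⟩ := hR
  rw [← h]
  refine (isWheel_of_wheelCondition (fun σ hσ => toRat_injective ?_) hP).toRat_mem_wordSpan hN
  rw [← act_toRat]
  change act k σ (algebraMap _ _ P) = algebraMap _ _ P
  rw [h]
  exact mem_symRat_iff.1 R.2 σ hσ

theorem mem_shufflePiece_of_mem_wordSpan [CharZero k] {N : Subsemigroup kˣ}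
    (hN : SmallIn N q t) {R : SymRat k n}
    (hR : (R : RatFun k (Var n)) ∈ wordSpan Sigma.fst (xi Q q t Sigma.fst) Finset.univ) :
    R ∈ shufflePiece Q q t n := by
  obtain ⟨P, hP, h⟩ := exists_isWheel_of_mem_wordSpan hN hR
  exact ⟨P, hP.wheelCondition hN, h.symm⟩

end WheelCondition

/-! ### Concatenation of words -/

section RenameSym

variable {k : Type*} [Field k] {I V W : Type*} [Fintype V] [DecidableEq V] [Fintype W]
  [DecidableEq W] {col : V → I} {col' : W → I}

theorem viaEmbedding_mem_colPerm {ι : W ↪ V} (hι : ∀ w, col (ι w) = col' w) {σ : Equiv.Perm W}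
    (hσ : σ ∈ colPerm col' Finset.univ) :
    σ.viaEmbedding ι ∈ colPerm col (Finset.univ.map ι) := by
  have h : ∀ v, v ∉ Set.range ι → σ.viaEmbedding ι v = v := fun v hv =>
    Equiv.Perm.viaEmbedding_apply_of_notMem σ ι v hv
  refine mem_colPerm.2 ⟨fun v => ?_, fun v hv => h v (by simpa using hv)⟩
  by_cases hv : v ∈ Set.range ι
  · obtain ⟨w, rfl⟩ := hv
    rw [Equiv.Perm.viaEmbedding_apply, hι, hι, (mem_colPerm.1 hσ).1]
  · rw [h v hv]

theorem rename_act (ι : W ↪ V) (σ : Equiv.Perm W) (x : RatFun k W) :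
    RatFun.rename k ι (act k σ x) = act k (σ.viaEmbedding ι) (RatFun.rename k ι x) := by
  rw [act, act, RatFun.rename_rename, RatFun.rename_rename]
  congr 2
  ext w
  exact (Equiv.Perm.viaEmbedding_apply σ ι w).symm

/-- Permutations of `W` extend by the identity to `V`; they fix `g` and are absorbed by the outer
symmetrization. -/
theorem sym_mul_rename_sym {ι : W ↪ V} (hι : ∀ w, col (ι w) = col' w) {g : RatFun k V}
    (hg : ∀ σ ∈ colPerm col (Finset.univ.map ι), act k σ g = g) (x : RatFun k W) :
    sym col Finset.univ (g * RatFun.rename k ι (sym col' Finset.univ x)) =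
      (colPerm col' (Finset.univ : Finset W)).card •
        sym col Finset.univ (g * RatFun.rename k ι x) := by
  rw [sym.eq_1 col', map_sum, Finset.mul_sum, sym_sum]
  refine Finset.sum_eq_card_nsmul fun σ hσ => ?_
  have h := viaEmbedding_mem_colPerm hι hσ
  rw [rename_act]
  conv_lhs => rw [← hg _ h]
  rw [← map_mul, sym_act (colPerm_mono (Finset.subset_univ _) h)]

end RenameSym

/-! ### Comparison of `ζ` with `ξ` -/

section Zeta

variable {I E : Type*} [DecidableEq I] [Fintype E] {k : Type*} [Field k]
variable (Q : EdgeQuiver I E) (q : kˣ) (t : E → kˣ) {V W : Type*} {col : V → I}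

theorem ratFunX_ne_zero (v : V) : RatFun.X k v ≠ 0 := toRat_ne_zero (Laurent.var_ne_zero v)

theorem algebraMap_ratFun (c : k) :
    algebraMap k (RatFun k V) c = toRat k V (algebraMap k _ c) :=
  IsScalarTower.algebraMap_apply _ _ _ _

theorem toRat_lin (c : kˣ) (u v : V) : toRat k V (Laurent.lin c u v) =
    RatFun.X k u - algebraMap k _ (c : k) * RatFun.X k v := by
  rw [Laurent.lin, map_sub, toRat_smul, Algebra.smul_def]
  rfl

theorem one_sub_mul_div (c : kˣ) (u v : V) :
    1 - algebraMap k (RatFun k V) (c : k) * (RatFun.X k u / RatFun.X k v) =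
      toRat k V (((Laurent.X k v)⁻¹ : (Laurent k V)ˣ) : Laurent k V) *
        toRat k V (Laurent.lin c v u) := by
  have h : toRat k V (((Laurent.X k v)⁻¹ : (Laurent k V)ˣ) : Laurent k V) = (RatFun.X k v)⁻¹ := by
    refine eq_inv_of_mul_eq_one_left ?_
    change toRat k V _ * toRat k V ((Laurent.X k v : (Laurent k V)ˣ) : Laurent k V) = 1
    rw [← map_mul, Units.inv_mul, map_one]
  rw [h, toRat_lin]
  have := ratFunX_ne_zero (k := k) v
  field_simp

/-- Clearing denominators in `1 - κ z_u / z_v` gives one factor `z_v⁻¹` per arrow, and the diagonal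
factor contributes the constant `q⁻¹`. Such units are harmless because `f` in a word is arbitrary.
-/
theorem exists_zeta_eq {u v : V} (h : u ≠ v) : ∃ μ : (Laurent k V)ˣ,
    zeta Q q t (col u) (col v) (RatFun.X k u / RatFun.X k v) =
      toRat k V μ * xi Q q t col u v := by
  have h1 : ∃ μ : (Laurent k V)ˣ, (if col u = col v then
      (1 - RatFun.X k u / RatFun.X k v * algebraMap k (RatFun k V) (q : k)⁻¹) /
        (1 - RatFun.X k u / RatFun.X k v) else 1) = toRat k V μ * if col u = col v then
          toRat k V (Laurent.lin q u v) / toRat k V (Laurent.lin 1 u v) else 1 := by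
    split_ifs
    · refine ⟨Laurent.C k V q⁻¹, ?_⟩
      have h2 := toRat_ne_zero (Laurent.lin_ne_zero (k := k) 1 h)
      have h3 := ratFunX_ne_zero (k := k) v
      have h4 : algebraMap k (RatFun k V) (q : k) ≠ 0 := by simp
      rw [Laurent.coe_C, ← algebraMap_ratFun, toRat_lin, Units.val_inv_eq_inv_val, map_inv₀]
      rw [toRat_lin, Units.val_one, map_one, one_mul] at *
      have h5 : 1 - RatFun.X k u / RatFun.X k v ≠ 0 := by
        rw [one_sub_div h3]
        exact div_ne_zero (fun h => h2 (by linear_combination -h)) h3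
      rw [← mul_div_assoc, div_eq_div_iff h5 h2]
      field_simp
      ring
    · exact ⟨1, by simp⟩
  obtain ⟨μ, hμ⟩ := h1
  refine ⟨μ * ∏ p ∈ arrows Q (col u) (col v), (Laurent.X k v)⁻¹, ?_⟩
  have h2 : (∏ e : E with Q.src e = col u ∧ Q.tgt e = col v,
        (1 - algebraMap k (RatFun k V) (t e) * (RatFun.X k u / RatFun.X k v))) *
      ∏ e : E with Q.src e = col v ∧ Q.tgt e = col u,
        (1 - algebraMap k (RatFun k V) (q / t e : k) * (RatFun.X k u / RatFun.X k v)) =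
      (∏ p ∈ arrows Q (col u) (col v),
        toRat k V (((Laurent.X k v)⁻¹ : (Laurent k V)ˣ) : Laurent k V)) *
      ∏ p ∈ arrows Q (col u) (col v), toRat k V (Laurent.lin (kap q t p) v u) := by
    rw [← Finset.prod_mul_distrib, arrows, Finset.prod_disjSum]
    congr 1 <;> refine Finset.prod_congr rfl fun e _ => ?_
    · rw [← one_sub_mul_div]; rfl
    · rw [← one_sub_mul_div]
      simp [kap]
  rw [zeta, hμ, xi, tProd, mul_assoc, h2, Units.val_mul, map_mul, Units.coe_prod, map_prod,
    map_prod]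
  ring

end Zeta

section Concatenation

variable {I E : Type*} [Fintype I] [DecidableEq I] [Fintype E] {k : Type*} [Field k]
variable (Q : EdgeQuiver I E) (q : kˣ) (t : E → kˣ) {n m : I → ℕ}

/-- The symmetrization of `f` times the shuffle factors for an ordering `L` of the variables. -/
def word (f : Laurent k (Var n)) (L : List (Var n)) : SymRat k n :=
  ⟨sym Sigma.fst Finset.univ (toRat k (Var n) f * pairProd (xi Q q t Sigma.fst) L),
    mem_symRat_iff.2 fun _ hσ => act_sym hσ _⟩

theorem univ_eq_union_leftVar_rightVar (v : Var (n + m)) :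
    (∃ w, leftVar n m w = v) ∨ ∃ w, rightVar n m w = v := by
  obtain ⟨i, a⟩ := v
  induction a using Fin.addCases with
  | left a => exact Or.inl ⟨⟨i, a⟩, rfl⟩
  | right a => exact Or.inr ⟨⟨i, a⟩, rfl⟩

theorem leftVar_ne_rightVar (v : Var n) (w : Var m) : leftVar n m v ≠ rightVar n m w := by
  obtain ⟨i, a⟩ := v
  obtain ⟨j, b⟩ := w
  intro h
  obtain ⟨h1, h2⟩ := Sigma.mk.inj_iff.1 h
  dsimp only at h1 h2
  subst h1
  have := congrArg Fin.val (eq_of_heq h2)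
  simp at this
  omega

theorem rightVar_notMem (n m : I → ℕ) (w : Var m) :
    rightVar n m w ∉ Finset.univ.map (leftVar n m) := fun h => by
  obtain ⟨v, -, h⟩ := Finset.mem_map.1 h
  exact leftVar_ne_rightVar v w h

theorem leftVar_notMem (n m : I → ℕ) (v : Var n) :
    leftVar n m v ∉ Finset.univ.map (rightVar n m) := fun h => by
  obtain ⟨w, -, h⟩ := Finset.mem_map.1 h
  exact leftVar_ne_rightVar v w h.symm

theorem zeta_act {V : Type*} {K : Type*} [Field K] [Algebra k K] (φ : RatFun k V →ₐ[k] K) (i j : I)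
    (x : RatFun k V) : φ (zeta Q q t i j x) = zeta Q q t i j (φ x) := by
  simp only [zeta, map_mul, map_prod, map_sub, map_one, AlgHom.commutes, apply_ite φ, map_div₀]

theorem act_X {V : Type*} (σ : Equiv.Perm V) (v : V) :
    act k σ (RatFun.X k v) = RatFun.X k (σ v) := by
  rw [RatFun.X, RatFun.X, ← pact_var]
  exact act_toRat _ _

theorem shuffleFactor_eq : shuffleFactor Q q t n m =
    ∏ v ∈ Finset.univ.map (leftVar n m), ∏ w ∈ Finset.univ.map (rightVar n m),
      zeta Q q t v.1 w.1 (RatFun.X k v / RatFun.X k w) := by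
  rw [Finset.prod_map]
  refine Finset.prod_congr rfl fun v _ => ?_
  rw [Finset.prod_map]
  rfl

theorem act_shuffleFactor_of_left {σ : Equiv.Perm (Var (n + m))}
    (hσ : σ ∈ colPerm Sigma.fst (Finset.univ.map (leftVar n m))) :
    act k σ (shuffleFactor Q q t n m) = shuffleFactor Q q t n m := by
  have h := mem_colPerm.1 hσ
  rw [shuffleFactor_eq, map_prod]
  conv_rhs => rw [← prod_comp_colPerm hσ]
  refine Finset.prod_congr rfl fun v _ => ?_
  rw [map_prod]
  refine Finset.prod_congr rfl fun w hw => ?_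
  obtain ⟨w, -, rfl⟩ := Finset.mem_map.1 hw
  have hw' : σ (rightVar n m w) = rightVar n m w := h.2 _ (rightVar_notMem n m w)
  rw [zeta_act, map_div₀, act_X, act_X, h.1, hw']

theorem act_shuffleFactor_of_right {σ : Equiv.Perm (Var (n + m))}
    (hσ : σ ∈ colPerm Sigma.fst (Finset.univ.map (rightVar n m))) :
    act k σ (shuffleFactor Q q t n m) = shuffleFactor Q q t n m := by
  have h := mem_colPerm.1 hσ
  rw [shuffleFactor_eq, map_prod]
  refine Finset.prod_congr rfl fun v hv => ?_
  obtain ⟨v, -, rfl⟩ := Finset.mem_map.1 hv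
  have hv' : σ (leftVar n m v) = leftVar n m v := h.2 _ (leftVar_notMem n m v)
  rw [map_prod]
  conv_rhs => rw [← prod_comp_colPerm hσ]
  refine Finset.prod_congr rfl fun w hw => ?_
  rw [zeta_act, map_div₀, act_X, act_X, h.1, hv']

theorem act_rename_of_disjoint {V W I : Type*} [Fintype V] [DecidableEq V] {col : V → I}
    {U : Finset V} {ι : W ↪ V} (hι : ∀ w, ι w ∉ U) {σ : Equiv.Perm V} (hσ : σ ∈ colPerm col U)
    (x : RatFun k W) : act k σ (RatFun.rename k ι x) = RatFun.rename k ι x := by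
  rw [act, RatFun.rename_rename]
  congr 2
  ext w
  exact (mem_colPerm.1 hσ).2 _ (hι w)

theorem exists_shuffleFactor_eq (n m : I → ℕ) : ∃ μ : (Laurent k (Var (n + m)))ˣ,
    shuffleFactor Q q t n m = toRat k _ μ *
      ∏ v : Var n, ∏ w : Var m, xi Q q t Sigma.fst (leftVar n m v) (rightVar n m w) := by
  choose μ hμ using fun (v : Var n) (w : Var m) =>
    exists_zeta_eq (col := Sigma.fst) Q q t (leftVar_ne_rightVar v w)
  refine ⟨∏ v, ∏ w, μ v w, ?_⟩
  simp only [Units.coe_prod, map_prod, ← Finset.prod_mul_distrib]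
  exact Finset.prod_congr rfl fun v _ => Finset.prod_congr rfl fun w _ => hμ v w

theorem rename_xi {V W I : Type*} [DecidableEq I] (Q : EdgeQuiver I E) {col : V → I}
    {col' : W → I} {ι : W ↪ V}
    (hι : ∀ w, col (ι w) = col' w) (u v : W) :
    RatFun.rename k ι (xi Q q t col' u v) = xi Q q t col (ι u) (ι v) := by
  have h : ∀ (c : kˣ) (u v : W),
      Laurent.rename k ι (Laurent.lin c u v) = Laurent.lin c (ι u) (ι v) := fun c u v => by
    simp only [Laurent.lin, map_sub, map_smul, Laurent.rename_var]
  rw [xi, xi, tProd, tProd, map_mul, RatFun.rename_algebraMap, map_prod, hι, hι]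
  simp only [h, apply_ite (RatFun.rename k ι), map_div₀, RatFun.rename_algebraMap, map_one]

theorem rename_word_term {V W I : Type*} [DecidableEq I] (Q : EdgeQuiver I E) {col : V → I}
    {col' : W → I} {ι : W ↪ V}
    (hι : ∀ w, col (ι w) = col' w) (f : Laurent k W) (L : List W) :
    RatFun.rename k ι (toRat k W f * pairProd (xi Q q t col') L) =
      toRat k V (Laurent.rename k ι f) * pairProd (xi Q q t col) (L.map ι) := by
  rw [map_mul, map_pairProd, pairProd_map, RatFun.rename_algebraMap]
  congr 2
  ext u v
  exact rename_xi q t Q hι u v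

/-- The shuffle product of two words is a concatenated word. -/
theorem exists_shuffleMulAux_word [CharZero k] (n m : I → ℕ) :
    ∃ μ : (Laurent k (Var (n + m)))ˣ, ∀ (f : Laurent k (Var n)) (g : Laurent k (Var m))
      (L : List (Var n)) (L' : List (Var m)), L.Nodup → L'.Nodup → L.toFinset = Finset.univ →
      L'.toFinset = Finset.univ →
      shuffleMulAux Q q t n m (word Q q t f L) (word Q q t g L') =
        word Q q t ((μ : Laurent k (Var (n + m))) *
            (Laurent.rename k (leftVar n m) f * Laurent.rename k (rightVar n m) g))
          (L.map (leftVar n m) ++ L'.map (rightVar n m)) := by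
  obtain ⟨μ, hμ⟩ := exists_shuffleFactor_eq Q q t n m
  have hc : (((∏ i, (n i).factorial) * ∏ i, (m i).factorial : ℕ) : k) ≠ 0 :=
    Nat.cast_ne_zero.2 (mul_ne_zero (Finset.prod_ne_zero_iff.2 fun _ _ => Nat.factorial_ne_zero _)
      (Finset.prod_ne_zero_iff.2 fun _ _ => Nat.factorial_ne_zero _))
  set c := (((∏ i, (n i).factorial) * ∏ i, (m i).factorial : ℕ) : k)⁻¹ with hcdef
  set cn := (colPerm Sigma.fst (Finset.univ : Finset (Var n))).card with hcn
  set cm := (colPerm Sigma.fst (Finset.univ : Finset (Var m))).card with hcm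
  have h0 : c * cn * cm ≠ 0 :=
    mul_ne_zero (mul_ne_zero (inv_ne_zero hc) card_colPerm_ne_zero) card_colPerm_ne_zero
  -- The constant combines the inverse factorials with the orders of the two inner symmetry groups;
  -- only its being nonzero is needed.
  refine ⟨Laurent.C k _ (Units.mk0 _ h0) * μ, fun f g L L' hL hL' hLu hLu' => Subtype.ext ?_⟩
  change c • symmetrize (n + m) (RatFun.rename k (leftVar n m)
      (sym Sigma.fst Finset.univ (toRat k _ f * pairProd (xi Q q t Sigma.fst) L)) *
    RatFun.rename k (rightVar n m)
      (sym Sigma.fst Finset.univ (toRat k _ g * pairProd (xi Q q t Sigma.fst) L')) *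
    shuffleFactor Q q t n m) = sym Sigma.fst Finset.univ _
  have hleft : ∀ y : RatFun k (Var m), ∀ σ ∈ colPerm Sigma.fst (Finset.univ.map (leftVar n m)),
      act k σ (shuffleFactor Q q t n m * RatFun.rename k (rightVar n m) y) =
        shuffleFactor Q q t n m * RatFun.rename k (rightVar n m) y := fun y σ hσ => by
    rw [map_mul, act_shuffleFactor_of_left Q q t hσ,
      act_rename_of_disjoint (rightVar_notMem n m) hσ]
  have hright : ∀ y : RatFun k (Var n), ∀ σ ∈ colPerm Sigma.fst (Finset.univ.map (rightVar n m)),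
      act k σ (shuffleFactor Q q t n m * RatFun.rename k (leftVar n m) y) =
        shuffleFactor Q q t n m * RatFun.rename k (leftVar n m) y := fun y σ hσ => by
    rw [map_mul, act_shuffleFactor_of_right Q q t hσ,
      act_rename_of_disjoint (leftVar_notMem n m) hσ]
  rw [symmetrize_eq_sym, mul_assoc, mul_comm, mul_comm (RatFun.rename k (rightVar n m) _),
    sym_mul_rename_sym (col := Sigma.fst) (col' := Sigma.fst) (ι := leftVar n m) (fun _ => rfl)
      (hleft _), mul_right_comm,
    sym_mul_rename_sym (col := Sigma.fst) (col' := Sigma.fst) (ι := rightVar n m) (fun _ => rfl)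
      (hright _),
    rename_word_term q t Q (col := Sigma.fst) (col' := Sigma.fst) (ι := leftVar n m) (fun _ => rfl),
    rename_word_term q t Q (col := Sigma.fst) (col' := Sigma.fst) (ι := rightVar n m) (fun _ => rfl), hμ,
    ← Nat.cast_smul_eq_nsmul k, ← Nat.cast_smul_eq_nsmul k, smul_smul, smul_smul, ← hcn, ← hcm,
    pairProd_append]
  rw [← sym_smul]
  congr 1
  have : (((L.map (leftVar n m)).map fun u => ((L'.map (rightVar n m)).map
      (xi Q q t Sigma.fst u)).prod).prod : RatFun k (Var (n + m))) =
      ∏ v : Var n, ∏ w : Var m, xi Q q t Sigma.fst (leftVar n m v) (rightVar n m w) := by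
    simp only [List.map_map]
    rw [list_prod_map_eq_finset_prod hL, hLu]
    refine Finset.prod_congr rfl fun v _ => ?_
    rw [Function.comp_apply, list_prod_map_eq_finset_prod hL', hLu']
    rfl
  rw [this, Units.val_mul, Laurent.coe_C, Algebra.smul_def, algebraMap_ratFun]
  simp only [map_mul, Units.val_mk0]
  ring

end Concatenation

/-! ### The spherical subalgebra -/

section Spherical

variable {I E : Type*} [Fintype I] [DecidableEq I] [Fintype E] {k : Type*} [Field k]
variable {Q : EdgeQuiver I E} {q : kˣ} {t : E → kˣ} {n m : I → ℕ}

variable (Q q t n) in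
/-- The span of the words of degree `n`. -/
def wordPiece : Submodule k (SymRat k n) :=
  Submodule.span k {R | ∃ (f : Laurent k (Var n)) (L : List (Var n)), L.Nodup ∧
    L.toFinset = Finset.univ ∧ R = word Q q t f L}

theorem mem_wordPiece_iff {R : SymRat k n} : R ∈ wordPiece Q q t n ↔
    (R : RatFun k (Var n)) ∈ wordSpan Sigma.fst (xi Q q t Sigma.fst) Finset.univ := by
  have h : wordSpan Sigma.fst (xi Q q t Sigma.fst) Finset.univ =
      (wordPiece Q q t n).map (SymRat k n).subtype := by
    rw [wordPiece, Submodule.map_span, wordSpan]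
    congr 1
    ext x
    constructor
    · rintro ⟨f, L, h1, h2, rfl⟩
      exact ⟨_, ⟨f, L, h1, h2, rfl⟩, rfl⟩
    · rintro ⟨_, ⟨f, L, h1, h2, rfl⟩, rfl⟩
      exact ⟨f, L, h1, h2, rfl⟩
  rw [h, Submodule.mem_map]
  exact ⟨fun hR => ⟨R, hR, rfl⟩, by rintro ⟨R', hR', h⟩; exact Subtype.ext h ▸ hR'⟩

theorem shufflePiece_eq_wordPiece [CharZero k] {N : Subsemigroup kˣ} (hN : SmallIn N q t) :
    shufflePiece Q q t n = wordPiece Q q t n := by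
  ext R
  rw [mem_wordPiece_iff]
  exact ⟨toRat_mem_wordSpan_of_mem_shufflePiece hN, mem_shufflePiece_of_mem_wordSpan hN⟩

theorem shuffleMulAux_mem_wordPiece [CharZero k] {R : SymRat k n} {S : SymRat k m}
    (hR : R ∈ wordPiece Q q t n) (hS : S ∈ wordPiece Q q t m) :
    shuffleMulAux Q q t n m R S ∈ wordPiece Q q t (n + m) := by
  obtain ⟨μ, hμ⟩ := exists_shuffleMulAux_word Q q t n m
  induction hR using Submodule.span_induction with
  | mem x hx =>
    obtain ⟨f, L, hL, hLu, rfl⟩ := hx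
    induction hS using Submodule.span_induction with
    | mem y hy =>
      obtain ⟨g, L', hL', hLu', rfl⟩ := hy
      rw [hμ f g L L' hL hL' hLu hLu']
      refine Submodule.subset_span ⟨_, _, ?_, ?_, rfl⟩
      · refine (hL.map (leftVar n m).injective).append (hL'.map (rightVar n m).injective) ?_
        intro v hv hv'
        obtain ⟨a, -, rfl⟩ := List.mem_map.1 hv
        obtain ⟨b, -, h⟩ := List.mem_map.1 hv'
        exact leftVar_ne_rightVar a b h.symm
      · refine Finset.eq_univ_of_forall fun v => ?_
        rw [List.mem_toFinset, List.mem_append, List.mem_map, List.mem_map]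
        refine (univ_eq_union_leftVar_rightVar v).imp (fun ⟨w, hw⟩ => ⟨w, ?_, hw⟩)
          (fun ⟨w, hw⟩ => ⟨w, ?_, hw⟩)
        · rw [← List.mem_toFinset, hLu]; exact Finset.mem_univ _
        · rw [← List.mem_toFinset, hLu']; exact Finset.mem_univ _
    | zero => rw [map_zero]; exact zero_mem _
    | add x y _ _ hx hy => rw [map_add]; exact add_mem hx hy
    | smul c x _ hx => rw [map_smul]; exact Submodule.smul_mem _ c hx
  | zero => rw [map_zero, LinearMap.zero_apply]; exact zero_mem _
  | add x y _ _ hx hy => rw [map_add, LinearMap.add_apply]; exact add_mem hx hy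
  | smul c x _ hx => rw [map_smul, LinearMap.smul_apply]; exact Submodule.smul_mem _ c hx

theorem shuffleMul_lof (R : SymRat k n) (S : SymRat k m) :
    shuffleMul Q q t (DirectSum.lof k (I → ℕ) (fun n => SymRat k n) n R)
      (DirectSum.lof k (I → ℕ) (fun n => SymRat k n) m S) =
    DirectSum.lof k (I → ℕ) (fun n => SymRat k n) (n + m) (shuffleMulAux Q q t n m R S) := by
  simp [shuffleMul]

theorem lof_mem_shuffleAlgebra {R : SymRat k n} (hR : R ∈ shufflePiece Q q t n) :
    DirectSum.lof k (I → ℕ) (fun n => SymRat k n) n R ∈ shuffleAlgebra Q q t := by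
  intro m
  by_cases h : n = m
  · subst h
    rwa [DirectSum.lof_apply]
  · rw [DirectSum.lof_eq_of, DirectSum.of_eq_of_ne _ _ _ (Ne.symm h)]
    exact zero_mem _

theorem eq_sum_lof (x : Big I k) : ∃ s : Finset (I → ℕ),
    x = ∑ n ∈ s, DirectSum.lof k (I → ℕ) (fun n => SymRat k n) n (x n) := by
  classical
  exact ⟨DFinsupp.support x, (DirectSum.sum_support_of x).symm⟩

theorem shuffleMul_mem_shuffleAlgebra [CharZero k] {N : Subsemigroup kˣ} (hN : SmallIn N q t)
    {x y : Big I k} (hx : x ∈ shuffleAlgebra Q q t) (hy : y ∈ shuffleAlgebra Q q t) :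
    shuffleMul Q q t x y ∈ shuffleAlgebra Q q t := by
  obtain ⟨s, hs⟩ := eq_sum_lof x
  obtain ⟨s', hs'⟩ := eq_sum_lof y
  rw [hs, map_sum, LinearMap.sum_apply]
  refine Submodule.sum_mem _ fun n _ => ?_
  rw [hs', map_sum]
  refine Submodule.sum_mem _ fun m _ => ?_
  rw [shuffleMul_lof]
  refine lof_mem_shuffleAlgebra ?_
  rw [shufflePiece_eq_wordPiece hN]
  refine shuffleMulAux_mem_wordPiece ?_ ?_ <;> rw [← shufflePiece_eq_wordPiece hN]
  · exact hx n
  · exact hy m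

theorem shuffleOne_mem_shuffleAlgebra : shuffleOne I k ∈ shuffleAlgebra Q q t :=
  lof_mem_shuffleAlgebra ⟨1, fun j l h1 h2 => absurd (h1.trans h2) (by simp), map_one _⟩

theorem sphericalSubalgebra_le_shuffleAlgebra [CharZero k] {N : Subsemigroup kˣ}
    (hN : SmallIn N q t) : sphericalSubalgebra Q q t ≤ shuffleAlgebra Q q t :=
  sInf_le ⟨shuffleOne_mem_shuffleAlgebra, fun _ _ hR => lof_mem_shuffleAlgebra hR,
    fun _ hx _ hy => shuffleMul_mem_shuffleAlgebra hN hx hy⟩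

theorem shuffleOne_mem_sphericalSubalgebra : shuffleOne I k ∈ sphericalSubalgebra Q q t :=
  Submodule.mem_sInf.2 fun _ hW => hW.1

theorem lof_single_mem_sphericalSubalgebra {i : I} {R : SymRat k (Pi.single i 1)}
    (hR : R ∈ shufflePiece Q q t (Pi.single i 1)) :
    DirectSum.lof k (I → ℕ) (fun n => SymRat k n) (Pi.single i 1) R ∈
      sphericalSubalgebra Q q t :=
  Submodule.mem_sInf.2 fun _ hW => hW.2.1 i R hR

theorem shuffleMul_mem_sphericalSubalgebra {x y : Big I k} (hx : x ∈ sphericalSubalgebra Q q t)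
    (hy : y ∈ sphericalSubalgebra Q q t) : shuffleMul Q q t x y ∈ sphericalSubalgebra Q q t :=
  Submodule.mem_sInf.2 fun W hW =>
    hW.2.2 x (Submodule.mem_sInf.1 hx W hW) y (Submodule.mem_sInf.1 hy W hW)

variable (Q q t) in
/-- `word` as a linear map. -/
def wordHom (L : List (Var n)) : Laurent k (Var n) →ₗ[k] SymRat k n where
  toFun f := word Q q t f L
  map_add' f g := Subtype.ext (by
    change sym _ _ _ = sym _ _ _ + sym _ _ _
    rw [map_add, add_mul, sym_add])
  map_smul' c f := Subtype.ext (by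
    change sym _ _ _ = c • sym _ _ _
    rw [toRat_smul, smul_mul_assoc, sym_smul])

theorem wordHom_apply (L : List (Var n)) (f : Laurent k (Var n)) :
    wordHom Q q t L f = word Q q t f L := rfl

theorem exists_mapDomain_add (x : Var (n + m) →₀ ℤ) : ∃ a b,
    x = Finsupp.mapDomain (leftVar n m) a + Finsupp.mapDomain (rightVar n m) b := by
  induction x using Finsupp.induction_linear with
  | zero => exact ⟨0, 0, by simp⟩
  | add x y hx hy =>
    obtain ⟨a, b, rfl⟩ := hx
    obtain ⟨a', b', rfl⟩ := hy
    exact ⟨a + a', b + b', by rw [Finsupp.mapDomain_add, Finsupp.mapDomain_add]; abel⟩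
  | single v d =>
    rcases univ_eq_union_leftVar_rightVar v with ⟨w, rfl⟩ | ⟨w, rfl⟩
    · exact ⟨Finsupp.single w d, 0, by simp [Finsupp.mapDomain_single]⟩
    · exact ⟨0, Finsupp.single w d, by simp [Finsupp.mapDomain_single]⟩

/-- Every monomial splits into a left and a right part, so polynomials with separated variables span
everything. -/
theorem laurent_mem_of_rename_mul_rename {W : Submodule k (Laurent k (Var (n + m)))}
    (h : ∀ f g, Laurent.rename k (leftVar n m) f * Laurent.rename k (rightVar n m) g ∈ W)
    (f : Laurent k (Var (n + m))) : f ∈ W := by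
  induction f using AddMonoidAlgebra.induction_linear with
  | zero => exact zero_mem _
  | add f g hf hg => exact add_mem hf hg
  | single x c =>
    obtain ⟨a, b, rfl⟩ := exists_mapDomain_add x
    have := h (AddMonoidAlgebra.single a c) (AddMonoidAlgebra.single b 1)
    simpa [Laurent.rename, AddMonoidAlgebra.mapDomain_single,
      AddMonoidAlgebra.single_mul_single] using this

theorem word_act {σ : Equiv.Perm (Var n)} (hσ : σ ∈ colPerm Sigma.fst Finset.univ)
    (f : Laurent k (Var n)) (L : List (Var n)) :
    word Q q t (pact k σ f) (L.map σ) = word Q q t f L := by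
  refine Subtype.ext ?_
  change sym _ _ _ = sym _ _ _
  rw [← sym_act hσ (toRat k _ f * _)]
  congr 1
  exact (rename_word_term (ι := σ.toEmbedding) q t Q (mem_colPerm_univ.1 hσ) f L).symm

theorem exists_eq_algebraMap {V : Type*} [IsEmpty V] (P : Laurent k V) :
    ∃ c, P = algebraMap k _ c := by
  induction P using AddMonoidAlgebra.induction_linear with
  | zero => exact ⟨0, (map_zero _).symm⟩
  | add f g hf hg =>
    obtain ⟨c, rfl⟩ := hf
    obtain ⟨d, rfl⟩ := hg
    exact ⟨c + d, (map_add _ _ _).symm⟩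
  | single x c =>
    rw [Subsingleton.elim x 0]
    exact ⟨c, rfl⟩

instance isEmpty_var_zero : IsEmpty (Var (0 : I → ℕ)) := ⟨fun v => v.2.elim0⟩

theorem lof_mem_sphericalSubalgebra_of_zero (R : SymRat k 0) (hR : R ∈ shufflePiece Q q t 0) :
    DirectSum.lof k (I → ℕ) (fun n => SymRat k n) 0 R ∈ sphericalSubalgebra Q q t := by
  obtain ⟨P, -, hP⟩ := hR
  obtain ⟨c, rfl⟩ := exists_eq_algebraMap P
  have : R = c • (⟨1, fun _ => map_one _⟩ : SymRat k (0 : I → ℕ)) := by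
    refine Subtype.ext ?_
    rw [← hP, Submodule.coe_smul, ← algebraMap_ratFun, Algebra.algebraMap_eq_smul_one]
  rw [this, map_smul]
  exact Submodule.smul_mem _ _ shuffleOne_mem_sphericalSubalgebra

instance subsingleton_var_single (i : I) : Subsingleton (Var (Pi.single i 1 : I → ℕ)) := by
  have h : ∀ v : Var (Pi.single i 1 : I → ℕ), v = ⟨i, ⟨0, by simp⟩⟩ := by
    rintro ⟨j, a⟩
    by_cases hj : j = i
    · subst hj
      have : a.val < 1 := a.2.trans_eq (Pi.single_eq_same (M := fun _ => ℕ) j 1)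
      congr 1
      ext
      simp only
      omega
    · exact absurd (a.2.trans_eq (Pi.single_eq_of_ne (M := fun _ => ℕ) hj 1)) (Nat.not_lt_zero _)
  exact ⟨fun v w => (h v).trans (h w).symm⟩

/-- If the first letter is the variable of the left factor, the word is, for separated `f`, the
shuffle product of a degree-one word and a shorter word. Linearity extends this to all `f`, and the
unit `μ` is removed by starting from `μ⁻¹ f`. -/
theorem lof_word_cons_mem_sphericalSubalgebra [CharZero k] {N : Subsemigroup kˣ}
    (hN : SmallIn N q t) {i : I} (u : Var (Pi.single i 1 : I → ℕ))
    (L : List (Var (Pi.single i 1 + m))) (hL : (leftVar _ m u :: L).Nodup)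
    (hLu : (leftVar _ m u :: L).toFinset = Finset.univ)
    (ih : ∀ L' : List (Var m), L'.Nodup → L'.toFinset = Finset.univ → ∀ g, L'.length = L.length →
      DirectSum.lof k (I → ℕ) (fun n => SymRat k n) m (word Q q t g L') ∈
        sphericalSubalgebra Q q t) (f : Laurent k (Var (Pi.single i 1 + m))) :
    DirectSum.lof k (I → ℕ) (fun n => SymRat k n) (Pi.single i 1 + m)
      (word Q q t f (leftVar _ m u :: L)) ∈ sphericalSubalgebra Q q t := by
  have hr : ∀ v ∈ L, v ∈ Set.range (rightVar (Pi.single i 1) m) := by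
    intro v hv
    refine (univ_eq_union_leftVar_rightVar v).resolve_left ?_
    rintro ⟨w, rfl⟩
    rw [Subsingleton.elim w u] at hv
    exact (List.nodup_cons.1 hL).1 hv
  obtain ⟨L', rfl⟩ : L ∈ Set.range (List.map (rightVar (Pi.single i 1) m)) := by
    rw [Set.range_list_map]; exact hr
  have hL' : L'.Nodup := (List.nodup_cons.1 hL).2.of_map _
  have hLu' : L'.toFinset = Finset.univ := by
    refine Finset.eq_univ_of_forall fun w => ?_
    have := Finset.mem_univ (rightVar (Pi.single i 1) m w)
    rw [← hLu, List.mem_toFinset, List.mem_cons] at this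
    have := this.resolve_left (leftVar_ne_rightVar u w).symm
    rw [List.mem_map_of_injective (rightVar _ m).injective] at this
    exact List.mem_toFinset.2 this
  obtain ⟨μ, hμ⟩ := exists_shuffleMulAux_word Q q t (Pi.single i 1) m
  have hu : ([u] : List (Var (Pi.single i 1 : I → ℕ))).toFinset = Finset.univ :=
    Finset.eq_univ_of_forall fun w => by simp [Subsingleton.elim w u]
  have h : ∀ f g, DirectSum.lof k (I → ℕ) (fun n => SymRat k n) (Pi.single i 1 + m)
      (word Q q t ((μ : Laurent k (Var (Pi.single i 1 + m))) *
        (Laurent.rename k (leftVar (Pi.single i 1) m) f *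
          Laurent.rename k (rightVar (Pi.single i 1) m) g))
        (leftVar _ m u :: L'.map (rightVar _ m))) ∈ sphericalSubalgebra Q q t := by
    intro f g
    have h1 := hμ f g [u] L' (List.nodup_singleton u) hL' hu hLu'
    rw [List.map_cons, List.map_nil, List.singleton_append] at h1
    rw [← h1, ← shuffleMul_lof]
    refine shuffleMul_mem_sphericalSubalgebra (lof_single_mem_sphericalSubalgebra ?_)
      (ih L' hL' hLu' g (by rw [List.length_map]))
    rw [shufflePiece_eq_wordPiece hN]
    exact Submodule.subset_span ⟨f, [u], List.nodup_singleton u, hu, rfl⟩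
  have key := laurent_mem_of_rename_mul_rename (W := ((sphericalSubalgebra Q q t).comap
    (DirectSum.lof k (I → ℕ) (fun n => SymRat k n) (Pi.single i 1 + m) ∘ₗ
      wordHom Q q t (leftVar _ m u :: L'.map (rightVar _ m)))).comap
        (LinearMap.mulLeft k (μ : Laurent k (Var (Pi.single i 1 + m))))) (fun f g => by
    rw [Submodule.mem_comap, Submodule.mem_comap, LinearMap.mulLeft_apply, LinearMap.comp_apply,
      wordHom_apply]
    exact h f g)
    (((μ⁻¹ : (Laurent k (Var (Pi.single i 1 + m)))ˣ) : Laurent k (Var (Pi.single i 1 + m))) * f)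
  rwa [Submodule.mem_comap, LinearMap.mulLeft_apply, Units.mul_inv_cancel_left,
    Submodule.mem_comap, LinearMap.comp_apply, wordHom_apply] at key

/-- Induction on the length. Simultaneous relabelling of `f` and the ordering does not change a
word, so the first letter may be assumed to be the first variable of its colour. -/
theorem lof_word_mem_sphericalSubalgebra [CharZero k] {N : Subsemigroup kˣ} (hN : SmallIn N q t)
    (L : List (Var n)) (hL : L.Nodup) (hLu : L.toFinset = Finset.univ) (f : Laurent k (Var n)) :
    DirectSum.lof k (I → ℕ) (fun n => SymRat k n) n (word Q q t f L) ∈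
      sphericalSubalgebra Q q t := by
  induction hd : L.length generalizing n with
  | zero =>
    obtain rfl := List.length_eq_zero_iff.1 hd
    have hn : n = 0 := by
      ext i
      by_contra h
      have := Finset.mem_univ (⟨i, ⟨0, Nat.pos_of_ne_zero h⟩⟩ : Var n)
      rw [← hLu] at this
      simp at this
    subst hn
    refine lof_mem_sphericalSubalgebra_of_zero _ ?_
    rw [shufflePiece_eq_wordPiece hN]
    exact Submodule.subset_span ⟨f, [], hL, hLu, rfl⟩
  | succ d ih =>
    obtain ⟨u, L, rfl⟩ := List.exists_cons_of_length_eq_add_one hd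
    obtain ⟨i, hi⟩ : ∃ i, u.1 = i := ⟨_, rfl⟩
    obtain ⟨m, rfl⟩ : ∃ m : I → ℕ, n = Pi.single i 1 + m := by
      refine ⟨fun j => n j - (Pi.single i 1 : I → ℕ) j, funext fun j => ?_⟩
      rw [Pi.add_apply]
      refine (add_tsub_cancel_of_le ?_).symm
      by_cases h : j = i
      · subst h
        have := u.2.2
        rw [Pi.single_eq_same, ← hi]
        omega
      · rw [Pi.single_eq_of_ne h]
        exact Nat.zero_le _
    set v : Var (Pi.single i 1 : I → ℕ) := ⟨i, ⟨0, by simp⟩⟩ with hv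
    have hσ : Equiv.swap u (leftVar _ m v) ∈ colPerm Sigma.fst Finset.univ :=
      swap_mem_colPerm (by simp) (by simp) hi
    rw [← word_act hσ, List.map_cons, Equiv.swap_apply_left]
    refine lof_word_cons_mem_sphericalSubalgebra hN v _ ?_ ?_ (fun L' h1 h2 g h3 =>
      ih L' h1 h2 g ?_) _
    · have := hL.map (Equiv.swap u (leftVar _ m v)).injective
      rwa [List.map_cons, Equiv.swap_apply_left] at this
    · refine Finset.eq_univ_of_forall fun w => ?_
      have h1 := Finset.mem_univ ((Equiv.swap u (leftVar _ m v)).symm w)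
      rw [← hLu, List.mem_toFinset,
        ← List.mem_map_of_injective (Equiv.swap u (leftVar _ m v)).injective,
        Equiv.apply_symm_apply, List.map_cons, Equiv.swap_apply_left] at h1
      exact List.mem_toFinset.2 h1
    · rw [h3, List.length_map]
      simpa using hd

theorem shuffleAlgebra_le_sphericalSubalgebra [CharZero k] {N : Subsemigroup kˣ}
    (hN : SmallIn N q t) : shuffleAlgebra Q q t ≤ sphericalSubalgebra Q q t := by
  intro x hx
  obtain ⟨s, hs⟩ := eq_sum_lof x
  rw [hs]
  refine Submodule.sum_mem _ fun n _ => ?_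
  have h : wordPiece Q q t n ≤ (sphericalSubalgebra Q q t).comap
      (DirectSum.lof k (I → ℕ) (fun n => SymRat k n) n) := by
    refine Submodule.span_le.2 ?_
    rintro _ ⟨f, L, hL, hLu, rfl⟩
    exact lof_word_mem_sphericalSubalgebra hN L hL hLu f
  refine h ?_
  rw [← shufflePiece_eq_wordPiece hN]
  exact hx n

/-- The shuffle algebra is generated by its pieces of degree one, if the parameters `q`, `t_e` and
`q / t_e` lie in a semigroup that does not contain `1`. -/
theorem sphericalSubalgebra_eq_shuffleAlgebra [CharZero k] {N : Subsemigroup kˣ}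
    (hN : SmallIn N q t) : sphericalSubalgebra Q q t = shuffleAlgebra Q q t :=
  le_antisymm (sphericalSubalgebra_le_shuffleAlgebra hN) (shuffleAlgebra_le_sphericalSubalgebra hN)

end Spherical

/-! ### The parameters of a subtorus -/

namespace Subtorus

variable {E : Type*} (ρ : Subtorus E)

theorem char_add (χ ψ : Fin ρ.rank →₀ ℤ) : ρ.char (χ + ψ) = ρ.char χ * ρ.char ψ := by
  ext
  simp only [char, Units.val_mk0, Units.val_mul, ← map_mul, AddMonoidAlgebra.single_mul_single,
    one_mul]

theorem char_zero : ρ.char 0 = 1 := by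
  ext
  simp only [char, Units.val_mk0, ← AddMonoidAlgebra.one_def, map_one, Units.val_one]

theorem char_sub (χ ψ : Fin ρ.rank →₀ ℤ) : ρ.char (χ - ψ) = ρ.char χ / ρ.char ψ := by
  rw [eq_div_iff_mul_eq', ← char_add, sub_add_cancel]

theorem char_injective : Function.Injective ρ.char := by
  intro χ ψ h
  have h1 := IsFractionRing.injective (Laurent ℤ (Fin ρ.rank)) ρ.CoeffField
    (congrArg Units.val h)
  exact (AddMonoidAlgebra.single_left_inj (one_ne_zero (α := ℤ))).1 h1

theorem charValue_add {r : ℕ} (θ : Fin r → ℂˣ) (χ ψ : Fin r →₀ ℤ) :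
    charValue θ (χ + ψ) = charValue θ χ * charValue θ ψ := by
  simp only [charValue, Finsupp.add_apply, zpow_add, Finset.prod_mul_distrib, Units.val_mul]

theorem charValue_zero {r : ℕ} (θ : Fin r → ℂˣ) : charValue θ 0 = 1 := by
  simp [charValue]

theorem charValue_ne_zero {r : ℕ} (θ : Fin r → ℂˣ) (χ : Fin r →₀ ℤ) : charValue θ χ ≠ 0 :=
  Units.ne_zero _

instance charZero_coeffField : CharZero ρ.CoeffField := by
  have h : CharZero (Laurent ℤ (Fin ρ.rank)) :=
    charZero_of_injective_algebraMap (R := ℤ)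
      (FaithfulSMul.algebraMap_injective ℤ (Laurent ℤ (Fin ρ.rank)))
  exact charZero_of_injective_algebraMap
    (IsFractionRing.injective (Laurent ℤ (Fin ρ.rank)) ρ.CoeffField)

/-- The semigroup consists of the characters of absolute value less than `1` at the given point;
`|q| < |t_e| < 1` puts `t_e`, `q / t_e` and `q` into it. -/
theorem exists_smallIn [Fintype E] (hq : ρ.QGeneric) (hρ : ρ.CanSpecialize) :
    ∃ N : Subsemigroup ρ.CoeffFieldˣ, SmallIn N (ρ.char ρ.q) fun e => ρ.char (ρ.t e) := by
  obtain ⟨θ, hθ⟩ := hρ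
  rcases isEmpty_or_nonempty E with hE | ⟨⟨e₀⟩⟩
  -- Without edges the specialization hypothesis is empty and does not bound `|q|`. The positive
  -- powers of `q` serve instead; none is `1` because the character lattice is torsion-free and `q`
  -- is nontrivial.
  · refine ⟨⟨{x | ∃ n : ℕ, ρ.char ((n + 1) • ρ.q) = x}, ?_⟩, ?_, ⟨0, by simp⟩, fun p => ?_⟩
    · rintro _ _ ⟨n, rfl⟩ ⟨m, rfl⟩
      refine ⟨n + 1 + m, ?_⟩
      rw [← char_add, ← add_nsmul]
      congr 2
    · rintro ⟨n, hn⟩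
      rw [← char_zero] at hn
      exact hq ((smul_eq_zero.1 (ρ.char_injective hn)).resolve_left n.succ_ne_zero)
    · rcases p with e | e <;> exact isEmptyElim e
  · refine ⟨⟨{x | ∃ χ, ‖charValue θ χ‖ < 1 ∧ ρ.char χ = x}, ?_⟩, ?_,
      ⟨_, (hθ e₀).1.trans (hθ e₀).2, rfl⟩, fun p => ?_⟩
    · rintro _ _ ⟨χ, hχ, rfl⟩ ⟨ψ, hψ, rfl⟩
      refine ⟨χ + ψ, ?_, ρ.char_add χ ψ⟩
      rw [charValue_add, norm_mul]
      exact mul_lt_one_of_nonneg_of_lt_one_left (norm_nonneg _) hχ hψ.le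
    · rintro ⟨χ, hχ, h⟩
      rw [← char_zero] at h
      rw [ρ.char_injective h, charValue_zero, norm_one] at hχ
      exact lt_irrefl _ hχ
    · rcases p with e | e
      · exact ⟨_, (hθ e).2, rfl⟩
      · refine ⟨ρ.q - ρ.t e, ?_, ρ.char_sub _ _⟩
        have h1 : charValue θ ρ.q = charValue θ (ρ.q - ρ.t e) * charValue θ (ρ.t e) := by
          rw [← charValue_add, sub_add_cancel]
        have h2 : 0 < ‖charValue θ (ρ.t e)‖ := norm_pos_iff.2 (charValue_ne_zero θ _)
        have h3 := (hθ e).1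
        rw [h1, norm_mul] at h3
        exact (mul_lt_iff_lt_one_left h2).1 h3

end Subtorus

end QuiverShuffle

end

theorem corollary4p2 {I E : Type*} [Fintype I] [DecidableEq I] [Fintype E]
    (Q : QuiverShuffle.EdgeQuiver I E) (ρ : QuiverShuffle.Subtorus E)
    (hq : ρ.QGeneric) (hρ : ρ.CanSpecialize) :
    QuiverShuffle.sphericalSubalgebra Q (ρ.char ρ.q) (fun e => ρ.char (ρ.t e)) =
      QuiverShuffle.shuffleAlgebra Q (ρ.char ρ.q) (fun e => ρ.char (ρ.t e)) := by
  obtain ⟨N, hN⟩ := ρ.exists_smallIn hq hρ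
  exact QuiverShuffle.sphericalSubalgebra_eq_shuffleAlgebra hN
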